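/- **Conventions.** Let $p$ be a prime. For a complete discrete valuation field $K$ of characteristic $p$ with residue field $\overline K$ (not assumed perfect), fix an algebraic closure $\Omega$ of $K$ with the unique prolongation of the valuation of $K$; all extensions of $K$ are taken inside $\Omega$. Fix also a base subfield $B\subset K$, i.e. a subfield that is complete with respect to the (nontrivial) restriction of the valuation of $K$ and has residue field $\mathbb F_p$. For a finite extension $M/K$ (including $M=K$) let $\mathcal R_M\subset M$ be the set of Teichmüller representatives of the elements of the maximal perfect subfield $\bigcap_{i} \overline M^{\,p^i}$ of $\overline M$, let $k_0$ be the completion (closure in $M$) of $B(\mathcal R_M)$, and call the algebraic closure of $k_0$ in $M$ the *constant subfield* of $M$. For a finite extension $L/K$: * $L/K$ is *unramified* if $\overline L/\overline K$ is separable and $[L:K]=[\overline L:\overline K]$; it is *ferociously ramified* if $[L:K]=[\overline L:\overline K]_{\rm insep}$. (The same terms are used with $K$ replaced by a finite extension of $K$.) * An extension of $K$ is *constant* if it has the form $lK$ with $l$ an algebraic extension of the constant subfield $k$ of $K$, and *almost constant* if it is contained in the compositum of a constant extension of $K$ and an unramified extension of $K$. * $L/K$ is *infernal* if the only almost constant extension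 $M/K$ with $K\subset M\subset L$ is $M=K$. * A finite extension $M$ of $K$ is *standard* if the ramification index of $M$ over the constant subfield of $M$ is $1$, and *almost standard* if some finite unramified extension of $M$ is standard. **Proposition.** Let $K$ be a complete discrete valuation field of characteristic $p$ with a fixed base subfield $B$, let $k$ be the constant subfield of $K$, and let $L/K$ be a (finite) infernal extension. Then there exists a finite purely inseparable extension $l/k$ such that $lK$ is almost standard and $lL/lK$ is ferociously ramified. -/

import Mathlib

/-! All fields live inside one field `Ω` with a nonarchimedean absolute value.  In the theorem `Ω`
is an algebraic closure of a complete discretely valued field `K`, so that the absolute value of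
`Ω` is the unique prolongation of the one of `K`.  Every subfield carries the restricted absolute
value. -/

namespace RamTheory

noncomputable section

variable {Ω : Type*} [NormedField Ω] [IsUltrametricDist Ω]

/-- The valuation of a subfield `M`. -/
abbrev val (M : Subfield Ω) : Valuation M NNReal := NormedField.valuation (K := M)

/-- The valuation ring of `Ω`. -/
abbrev bigRing (Ω : Type*) [NormedField Ω] [IsUltrametricDist Ω] : ValuationSubring Ω :=
  (NormedField.valuation (K := Ω)).valuationSubring

/-- The residue field of `Ω`. -/
abbrev BigResidue (Ω : Type*) [NormedField Ω] [IsUltrametricDist Ω] : Type _ :=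
  IsLocalRing.ResidueField (bigRing Ω)

/-- The residue field of a subfield `M`, viewed inside the residue field of `Ω`: the classes of
the elements of the valuation ring of `M`. -/
def residueSubfield (M : Subfield Ω) : Subfield (BigResidue Ω) where
  carrier := {y | ∃ x : bigRing Ω, (x : Ω) ∈ M ∧ IsLocalRing.residue (bigRing Ω) x = y}
  zero_mem' := ⟨0, M.zero_mem, map_zero _⟩
  one_mem' := ⟨1, M.one_mem, map_one _⟩
  add_mem' := by
    rintro _ _ ⟨x, hx, rfl⟩ ⟨y, hy, rfl⟩
    exact ⟨x + y, M.add_mem hx hy, map_add _ _ _⟩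
  mul_mem' := by
    rintro _ _ ⟨x, hx, rfl⟩ ⟨y, hy, rfl⟩
    exact ⟨x * y, M.mul_mem hx hy, map_mul _ _ _⟩
  neg_mem' := by
    rintro _ ⟨x, hx, rfl⟩
    exact ⟨-x, M.neg_mem hx, map_neg _ _⟩
  inv_mem' := by
    rintro _ ⟨x, hx, rfl⟩
    by_cases h : IsLocalRing.residue (bigRing Ω) x = 0
    · exact ⟨0, M.zero_mem, by rw [h, map_zero, inv_zero]⟩
    · have hu : IsUnit x := by
        by_contra hu
        exact h ((IsLocalRing.residue_eq_zero_iff x).2 ((IsLocalRing.mem_maximalIdeal x).2 hu))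
      obtain ⟨u, rfl⟩ := hu
      have hmul : ((u : bigRing Ω) : Ω) * ((↑u⁻¹ : bigRing Ω) : Ω) = 1 := by
        exact congrArg (fun z : bigRing Ω => (z : Ω)) u.mul_inv
      refine ⟨(↑u⁻¹ : bigRing Ω), ?_, ?_⟩
      · rw [eq_inv_of_mul_eq_one_right hmul]
        exact M.inv_mem hx
      · refine eq_inv_of_mul_eq_one_right ?_
        rw [← map_mul, u.mul_inv, map_one]

theorem residueSubfield_mono {K L : Subfield Ω} (h : K ≤ L) :
    residueSubfield K ≤ residueSubfield L := by
  rintro _ ⟨x, hx, rfl⟩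
  exact ⟨x, h hx, rfl⟩

/-- `L/K` is a finite extension. -/
def IsFiniteExt (K L : Subfield Ω) : Prop :=
  ∃ h : K ≤ L, FiniteDimensional K (Subfield.extendScalars h)

/-- The ramification index `e_{L/K}`: the index of the value group of `K` in that of `L`
(with value `0` if this index is infinite). -/
def ramIndex (K L : Subfield Ω) : ℕ :=
  (MonoidWithZeroHom.valueGroup (.ofClass (val K))).relIndex
    (MonoidWithZeroHom.valueGroup (.ofClass (val L)))

/-- `L/K` is (finite and) unramified: the residue extension is separable, of degree `[L : K]`. -/
def IsUnramifiedExt (K L : Subfield Ω) : Prop :=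
  ∃ h : K ≤ L,
    FiniteDimensional K (Subfield.extendScalars h) ∧
    Algebra.IsSeparable (residueSubfield K) (Subfield.extendScalars (residueSubfield_mono h)) ∧
    Module.finrank K (Subfield.extendScalars h) =
      Module.finrank (residueSubfield K) (Subfield.extendScalars (residueSubfield_mono h))

/-- `L/K` is finite and ferociously ramified: `[L : K]` is the inseparable degree of the residue
extension. -/
def IsFerocious (K L : Subfield Ω) : Prop :=
  ∃ h : K ≤ L,
    FiniteDimensional K (Subfield.extendScalars h) ∧
    Module.finrank K (Subfield.extendScalars h) =
      Field.finInsepDegree (residueSubfield K)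
        (Subfield.extendScalars (residueSubfield_mono h))

/-- `B` is a base subfield of `K`: it is complete, its valuation is nontrivial, and its residue
field is the field with `p` elements. -/
structure IsBaseSubfield (p : ℕ) (B K : Subfield Ω) : Prop where
  le : B ≤ K
  complete : IsComplete (B : Set Ω)
  nontrivial : ∃ x ∈ B, x ≠ 0 ∧ ‖x‖ < 1
  residue : Nat.card (residueSubfield B) = p

/-- The maximal perfect subfield `⋂ M̄^{p^n}` of the residue field `M̄` of `M` (as a set). -/
def perfectResidues (p : ℕ) (M : Subfield Ω) : Set (BigResidue Ω) :=
  {y | ∀ n : ℕ, ∃ z ∈ residueSubfield M, z ^ p ^ n = y}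

/-- The Teichmüller representatives in the valuation ring of `M` of the elements of the maximal
perfect subfield of the residue field of `M`.  The Teichmüller representative of such an element
is its unique lift which has a `p ^ n`-th root in `M` for every `n`. -/
def teichmullerReps (p : ℕ) (M : Subfield Ω) : Set Ω :=
  {x | ∃ x' : bigRing Ω, (x' : Ω) = x ∧ x ∈ M ∧
    IsLocalRing.residue (bigRing Ω) x' ∈ perfectResidues p M ∧
    ∀ n : ℕ, ∃ z ∈ M, z ^ p ^ n = x}

/-- The subfield `k₀` of `M`: the closure in `M` of the field generated over `B` by the
Teichmüller representatives. -/
def constantBase (p : ℕ) (B M : Subfield Ω) : Subfield Ω :=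
  (Subfield.closure ((B : Set Ω) ∪ teichmullerReps p M)).topologicalClosure ⊓ M

/-- The constant subfield of `M`, relative to the base subfield `B`: the algebraic closure of
`k₀` in `M`. -/
def constantSubfield (p : ℕ) (B M : Subfield Ω) : Subfield Ω :=
  (algebraicClosure (constantBase p B M) Ω).toSubfield ⊓ M

/-- `L/K` is constant: `L = lK` for an algebraic extension `l` of the constant subfield of `K`. -/
def IsConstantExt (p : ℕ) (B K L : Subfield Ω) : Prop :=
  ∃ (l : Subfield Ω) (h : constantSubfield p B K ≤ l),
    Algebra.IsAlgebraic (constantSubfield p B K) (Subfield.extendScalars h) ∧ L = l ⊔ K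

/-- `L/K` is almost constant: it lies in a compositum of a constant extension and an unramified
one. -/
def IsAlmostConstantExt (p : ℕ) (B K L : Subfield Ω) : Prop :=
  K ≤ L ∧ ∃ C U : Subfield Ω, IsConstantExt p B K C ∧ IsUnramifiedExt K U ∧ L ≤ C ⊔ U

/-- `L/K` is infernal: it is finite, and its only almost constant subextension is `K`. -/
def IsInfernal (p : ℕ) (B K L : Subfield Ω) : Prop :=
  IsFiniteExt K L ∧
    ∀ M : Subfield Ω, K ≤ M → M ≤ L → IsAlmostConstantExt p B K M → M = K

/-- `K` is standard: `e_{K/k} = 1` for the constant subfield `k` of `K`. -/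
def IsStandard (p : ℕ) (B K : Subfield Ω) : Prop :=
  ramIndex (constantSubfield p B K) K = 1

/-- `K` is almost standard: some unramified extension of it is standard. -/
def IsAlmostStandard (p : ℕ) (B K : Subfield Ω) : Prop :=
  ∃ M : Subfield Ω, IsUnramifiedExt K M ∧ IsStandard p B M

/-- `l/k` is a finite purely inseparable extension. -/
def IsFinitePurelyInsep (k l : Subfield Ω) : Prop :=
  ∃ h : k ≤ l,
    FiniteDimensional k (Subfield.extendScalars h) ∧
    IsPurelyInseparable k (Subfield.extendScalars h)

end

end RamTheory

/-!
The field `K` is finite over a field `E = C((π))`, where `C` is a coefficient field of `K` and `π`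
is an element of `K` which is algebraic over the base subfield `B` and has no `p`-th root in `K`.
The field `k = R((π))`, where `R` is the largest perfect subfield of `K`, lies in the constant
subfield.  Let `κ` be the algebraic closure of `k`, and let `A₀` be generated over `E` by `κ` and
all unramified elements, where an element is called unramified (`IsEtaleElement`) if it is a simple
root, modulo the maximal ideal, of an integral polynomial over `E`.

The main step is that over `A₀` every finite extension has the same degree as its residue extension
(`IsConstantClosed.isResidual`).  Finitely many elements of `A₀` lie in a complete discretely valued
subfield which has a constant uniformizer and only constants in its largest perfect subfield
(`IsConstantClosed`, proved for `A₀` in `IsConstantBase.isConstantClosed`).  This property allows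
one to reduce Artin-Schreier equations and equations `y ^ p = a` to equations `b ^ p - c * b = u`
with `‖c‖ < 1` whose residual equation is inseparable of degree `p`; and the property is inherited
by the extension generated by a root.  Extensions of degree prime to `p` do not exist, so an
induction in a normal closure gives the claim.

Put `A = K A₀`.  Since `L / K` is infernal, `L ∩ A = K`, and then `L` and `A` are linearly disjoint
over `K` (`IsRootTower.linearIndependent`): a minimal relation has coefficients which are purely
inseparable over `K`, so that they lie in `K (ϖ n)` for a root `ϖ n` of `π` of order `p ^ n`; but
`π` is not a `p`-th power in `L`.  So `L A / A` has degree `[L : K]` and so has its residue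
extension, which is purely inseparable because the residue field of `A₀` is separably closed.

Constant extensions do not change the residue field once all `p`-power roots of elements of `k` are
present (`residueSubfield_sup_algClosure`), hence everything can be brought down to the extension
generated by finitely many unramified elements and one `ϖ n`, and, as unramified extensions do not
change inseparable degrees, to `L (ϖ n) / K (ϖ n)` (`IsRootTower.exists_isFerocious`).  Similarly a
finite unramified extension `X` of `K (ϖ n)` has a finite totally ramified extension with a constant
uniformizer; the norm of this uniformizer is a constant uniformizer of `X`
(`exists_constant_norm_eq`), which shows that `K (ϖ n)` is almost standard
(`IsRootTower.exists_isAlmostStandard`).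
-/

namespace RamTheory

set_option linter.unusedSectionVars false

/-! ### Finite extensions of subfields -/

section SpanningFamilies

variable {F : Type*} [Field F]

/-- Every element of `N` is a combination of the finite family `b` with coefficients in `M`. -/
def Spans (M N : Subfield F) {ι : Type*} [Fintype ι] (b : ι → F) : Prop :=
  ∀ x ∈ N, ∃ a : ι → F, (∀ i, a i ∈ M) ∧ x = ∑ i, a i * b i

/-- `N / M` is a finite extension of subfields of `F`. -/
def FiniteOver (M N : Subfield F) : Prop := M ≤ N ∧ M.relfinrank N ≠ 0

variable {M N P : Subfield F} {ι : Type*} [Fintype ι] {b : ι → F}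

theorem spans_iff_span : Spans M N b ↔
    (N : Set F) ⊆ Submodule.span M (Set.range b) := by
  constructor
  · intro h x hx
    obtain ⟨a, ha, rfl⟩ := h x hx
    refine Submodule.sum_mem _ fun i _ => ?_
    exact Submodule.smul_mem _ (⟨a i, ha i⟩ : M) (Submodule.subset_span ⟨i, rfl⟩)
  · intro h x hx
    obtain ⟨c, hc⟩ := (Submodule.mem_span_range_iff_exists_fun M).1 (h hx)
    exact ⟨fun i => c i, fun i => (c i).2, hc.symm⟩

theorem Spans.le (hs : Spans M N b) (h : M ≤ P) (hb : ∀ i, b i ∈ P) : N ≤ P := by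
  intro x hx
  obtain ⟨a, ha, rfl⟩ := hs x hx
  exact P.sum_mem fun i _ => P.mul_mem (h (ha i)) (hb i)

theorem linearIndependent_subfield_iff : LinearIndependent M b ↔
    ∀ a : ι → F, (∀ i, a i ∈ M) → ∑ i, a i * b i = 0 → ∀ i, a i = 0 := by
  rw [Fintype.linearIndependent_iff]
  constructor
  · intro h a ha hs i
    have := h (fun i => ⟨a i, ha i⟩) hs i
    exact congrArg Subtype.val this
  · intro h g hg i
    exact Subtype.ext (h (fun i => g i) (fun i => (g i).2) hg i)

theorem finiteOver_iff (h : M ≤ N) :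
    FiniteOver M N ↔ FiniteDimensional M (Subfield.extendScalars h) := by
  rw [FiniteOver, Subfield.relfinrank_eq_finrank_of_le h, and_iff_right h]
  constructor
  · intro hn
    exact Module.finite_of_finrank_pos (Nat.pos_of_ne_zero hn)
  · intro hn
    exact Module.finrank_pos.ne'

theorem Spans.finiteOver (h : M ≤ N) (hs : Spans M N b) : FiniteOver M N := by
  rw [finiteOver_iff h]
  rw [spans_iff_span] at hs
  have : (Subalgebra.toSubmodule (Subfield.extendScalars h).toSubalgebra) ≤
      Submodule.span M (Set.range b) := hs
  have hf : FiniteDimensional M (Submodule.span M (Set.range b)) :=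
    FiniteDimensional.span_of_finite M (Set.finite_range b)
  exact Submodule.finiteDimensional_of_le this

theorem Spans.relfinrank_le (h : M ≤ N) (hs : Spans M N b) :
    M.relfinrank N ≤ Fintype.card ι := by
  rw [Subfield.relfinrank_eq_finrank_of_le h]
  rw [spans_iff_span] at hs
  have : (Subalgebra.toSubmodule (Subfield.extendScalars h).toSubalgebra) ≤
      Submodule.span M (Set.range b) := hs
  have hf : FiniteDimensional M (Submodule.span M (Set.range b)) :=
    FiniteDimensional.span_of_finite M (Set.finite_range b)
  exact (Submodule.finrank_mono this).trans (finrank_range_le_card b)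

theorem FiniteOver.exists_basis (h : FiniteOver M N) :
    ∃ b : Fin (M.relfinrank N) → F, (∀ i, b i ∈ N) ∧ LinearIndependent M b ∧ Spans M N b := by
  have hf := (finiteOver_iff h.1).1 h
  rw [Subfield.relfinrank_eq_finrank_of_le h.1]
  let B := Module.finBasis M (Subfield.extendScalars h.1)
  refine ⟨fun i => B i, fun i => (B i).2, ?_, ?_⟩
  · exact B.linearIndependent.map' (Subfield.extendScalars h.1).val.toLinearMap
      (LinearMap.ker_eq_bot.2 Subtype.val_injective)
  · intro x hx
    refine ⟨fun i => B.repr ⟨x, hx⟩ i, fun i => (B.repr ⟨x, hx⟩ i).2, ?_⟩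
    have := congrArg (Subfield.extendScalars h.1).val (B.sum_repr ⟨x, hx⟩)
    rw [map_sum] at this
    exact this.symm

theorem linearIndependent_extendScalars (h : M ≤ N) (hb : ∀ i, b i ∈ N)
    (hl : LinearIndependent M b) :
    LinearIndependent M (fun i => (⟨b i, hb i⟩ : Subfield.extendScalars h)) :=
  LinearIndependent.of_comp (Subfield.extendScalars h).val.toLinearMap hl

theorem FiniteOver.card_le (h : FiniteOver M N) (hb : ∀ i, b i ∈ N)
    (hl : LinearIndependent M b) : Fintype.card ι ≤ M.relfinrank N := by
  have hf := (finiteOver_iff h.1).1 h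
  rw [Subfield.relfinrank_eq_finrank_of_le h.1]
  exact (linearIndependent_extendScalars h.1 hb hl).fintype_card_le_finrank

theorem FiniteOver.spans_of_card (h : FiniteOver M N) (hb : ∀ i, b i ∈ N)
    (hl : LinearIndependent M b) (hc : M.relfinrank N ≤ Fintype.card ι) : Spans M N b := by
  have hf := (finiteOver_iff h.1).1 h
  have hl' := linearIndependent_extendScalars h.1 hb hl
  have hc' : Fintype.card ι = Module.finrank M (Subfield.extendScalars h.1) := by
    rw [← Subfield.relfinrank_eq_finrank_of_le h.1]
    exact le_antisymm (h.card_le hb hl) hc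
  have htop := hl'.span_eq_top_of_card_eq_finrank' hc'
  intro x hx
  have hx' : (⟨x, hx⟩ : Subfield.extendScalars h.1) ∈
      Submodule.span M (Set.range fun i => (⟨b i, hb i⟩ : Subfield.extendScalars h.1)) := by
    rw [htop]; trivial
  obtain ⟨c, hc⟩ := (Submodule.mem_span_range_iff_exists_fun M).1 hx'
  refine ⟨fun i => c i, fun i => (c i).2, ?_⟩
  have := congrArg (Subfield.extendScalars h.1).val hc
  rw [map_sum] at this
  exact this.symm

theorem FiniteOver.trans (h : FiniteOver M N) (h' : FiniteOver N P) : FiniteOver M P := by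
  refine ⟨h.1.trans h'.1, ?_⟩
  rw [← Subfield.relfinrank_mul_relfinrank h.1 h'.1]
  exact mul_ne_zero h.2 h'.2

theorem FiniteOver.bot_le (h : FiniteOver M P) (h1 : M ≤ N) (h2 : N ≤ P) : FiniteOver M N := by
  refine ⟨h1, fun h0 => h.2 ?_⟩
  rw [← Subfield.relfinrank_mul_relfinrank h1 h2, h0, zero_mul]

theorem FiniteOver.le_top (h : FiniteOver M P) (h1 : M ≤ N) (h2 : N ≤ P) : FiniteOver N P := by
  refine ⟨h2, fun h0 => h.2 ?_⟩
  rw [← Subfield.relfinrank_mul_relfinrank h1 h2, h0, mul_zero]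

theorem FiniteOver.refl (M : Subfield F) : FiniteOver M M :=
  ⟨le_rfl, by rw [Subfield.relfinrank_self]; exact one_ne_zero⟩

theorem isAlgebraic_mono (h : M ≤ P) {x : F} (hx : IsAlgebraic M x) : IsAlgebraic P x := by
  let _ := (Subfield.inclusion h).toAlgebra
  have : IsScalarTower M P F := IsScalarTower.of_algebraMap_eq fun _ => rfl
  exact hx.tower_top P

/-- The element `x` is separable over the subfield `M`. -/
def SepOver (M : Subfield F) (x : F) : Prop := IsSeparable M x

theorem SepOver.isIntegral {x : F} (hx : SepOver M x) : IsIntegral M x :=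
  IsSeparable.isIntegral hx

theorem sepOver_of_mem {x : F} (hx : x ∈ M) : SepOver M x :=
  isSeparable_algebraMap (⟨x, hx⟩ : M)

theorem SepOver.mono (h : M ≤ P) {x : F} (hx : SepOver M x) : SepOver P x := by
  let _ := (Subfield.inclusion h).toAlgebra
  have : IsScalarTower M P F := IsScalarTower.of_algebraMap_eq fun _ => rfl
  exact IsSeparable.tower_top P hx

theorem FiniteOver.isAlgebraic (h : FiniteOver M N) {x : F} (hx : x ∈ N) : IsAlgebraic M x := by
  have hf := (finiteOver_iff h.1).1 h
  have := Algebra.IsAlgebraic.isAlgebraic (R := M) (⟨x, hx⟩ : Subfield.extendScalars h.1)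
  exact this.algebraMap (A := F)

/-- The subfield generated by `M` and a set `S`. -/
def adj (M : Subfield F) (S : Set F) : Subfield F := M ⊔ Subfield.closure S

theorem le_adj (M : Subfield F) (S : Set F) : M ≤ adj M S := le_sup_left

theorem subset_adj (M : Subfield F) (S : Set F) : S ⊆ adj M S :=
  fun _ hx => (le_sup_right : Subfield.closure S ≤ adj M S) (Subfield.subset_closure hx)

theorem adj_le {S : Set F} (h : M ≤ N) (hS : S ⊆ N) : adj M S ≤ N :=
  sup_le h (Subfield.closure_le.2 hS)

theorem adj_mono {S T : Set F} (h : M ≤ N) (hS : S ⊆ T) : adj M S ≤ adj N T :=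
  adj_le (h.trans (le_adj _ _)) (hS.trans (subset_adj _ _))

theorem adj_eq_adjoin (M : Subfield F) (S : Set F) :
    adj M S = (IntermediateField.adjoin M S).toSubfield := by
  rw [IntermediateField.adjoin_toSubfield, adj, Subfield.closure_union]
  congr 1
  have : Set.range (algebraMap M F) = M := Subtype.range_coe
  rw [this, Subfield.closure_eq]

theorem mem_adj_iff {S : Set F} {x : F} : x ∈ adj M S ↔ x ∈ IntermediateField.adjoin M S := by
  rw [adj_eq_adjoin]; rfl

theorem adj_adj (M : Subfield F) (S T : Set F) : adj (adj M S) T = adj M (S ∪ T) := by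
  rw [adj, adj, adj, Subfield.closure_union, sup_assoc]

theorem sup_adj (M N : Subfield F) (S : Set F) : M ⊔ adj N S = adj (M ⊔ N) S := by
  rw [adj, adj, sup_assoc]

theorem adj_sup (M N : Subfield F) (S : Set F) : adj N S ⊔ M = adj (N ⊔ M) S := by
  rw [adj, adj, sup_right_comm]

theorem adj_eq_self {S : Set F} (h : S ⊆ M) : adj M S = M :=
  le_antisymm (adj_le le_rfl h) (le_adj _ _)

theorem exists_finset_mem_adj {S : Set F} {x : F} (h : x ∈ adj M S) :
    ∃ T : Finset F, (T : Set F) ⊆ S ∧ x ∈ adj M T := by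
  rw [mem_adj_iff] at h
  obtain ⟨T, hT, hx⟩ := IntermediateField.exists_finset_of_mem_adjoin h
  exact ⟨T, hT, mem_adj_iff.2 hx⟩

theorem exists_finset_subset_adj {S : Set F} (t : Finset F) (h : (t : Set F) ⊆ adj M S) :
    ∃ T : Finset F, (T : Set F) ⊆ S ∧ (t : Set F) ⊆ adj M T := by
  classical
  induction t using Finset.induction_on with
  | empty => exact ⟨∅, by simp, by simp⟩
  | insert x t hxt ih =>
    rw [Finset.coe_insert, Set.insert_subset_iff] at h
    obtain ⟨T, hT, hT'⟩ := ih h.2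
    obtain ⟨T', hT2, hT3⟩ := exists_finset_mem_adj h.1
    refine ⟨T ∪ T', by simp [hT, hT2], ?_⟩
    rw [Finset.coe_insert, Set.insert_subset_iff]
    exact ⟨adj_mono le_rfl (by simp) hT3, hT'.trans (adj_mono le_rfl (by simp))⟩

/-- Base change of a finite extension: a spanning family of `N / M` spans `P N / P`. -/
theorem Spans.sup (h : M ≤ N) (hb : ∀ i, b i ∈ N) (hs : Spans M N b) (hP : M ≤ P) :
    Spans P (P ⊔ N) b := by
  have hfin := hs.finiteOver h
  have hle : ∀ x ∈ Algebra.adjoin P (N : Set F), x ∈ Submodule.span P (Set.range b) := by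
    have hN : ∀ x ∈ N, x ∈ Submodule.span P (Set.range b) := by
      intro x hx
      obtain ⟨a, ha, rfl⟩ := hs x hx
      refine Submodule.sum_mem _ fun i _ => ?_
      exact Submodule.smul_mem _ (⟨a i, hP (ha i)⟩ : P) (Submodule.subset_span ⟨i, rfl⟩)
    intro x hx
    refine Algebra.adjoin_induction (p := fun x _ => x ∈ Submodule.span P (Set.range b))
      (fun x hx => hN x hx) ?_ (fun x y _ _ hx hy => add_mem hx hy) ?_ hx
    · intro r
      rw [Algebra.algebraMap_eq_smul_one]
      exact Submodule.smul_mem _ _ (hN 1 N.one_mem)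
    · intro x y _ _ hx hy
      have hxy := Submodule.mul_mem_mul hx hy
      rw [Submodule.span_mul_span] at hxy
      refine Submodule.span_le.2 ?_ hxy
      rintro _ ⟨_, ⟨i, rfl⟩, _, ⟨j, rfl⟩, rfl⟩
      exact hN _ (N.mul_mem (hb i) (hb j))
  have hal : ∀ x ∈ (N : Set F), IsAlgebraic P x := fun x hx =>
    isAlgebraic_mono hP (hfin.isAlgebraic hx)
  rw [spans_iff_span]
  intro x hx
  have : P ⊔ N = adj P (N : Set F) := by rw [adj, Subfield.closure_eq]
  rw [this] at hx
  have hx' : x ∈ IntermediateField.adjoin P (N : Set F) := mem_adj_iff.1 hx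
  rw [← IntermediateField.mem_toSubalgebra,
    IntermediateField.adjoin_toSubalgebra_of_isAlgebraic hal] at hx'
  exact hle x hx'

theorem finiteOver_adj {S : Set F} (hS : S.Finite) (hal : ∀ x ∈ S, IsAlgebraic M x) :
    FiniteOver M (adj M S) := by
  have hf : FiniteDimensional M (IntermediateField.adjoin M S) := by
    have := hS.to_subtype
    exact IntermediateField.finiteDimensional_adjoin fun x hx => (hal x hx).isIntegral
  refine (finiteOver_iff (le_adj M S)).2 ?_
  have : Subfield.extendScalars (le_adj M S) = IntermediateField.adjoin M S := by
    ext x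
    exact mem_adj_iff
  rw [this]
  exact hf

theorem isAlgebraic_trans (hN : ∀ x ∈ N, IsAlgebraic M x) (h : M ≤ N) {x : F}
    (hx : IsAlgebraic N x) : IsAlgebraic M x := by
  let _ := (Subfield.inclusion h).toAlgebra
  have : IsScalarTower M N F := IsScalarTower.of_algebraMap_eq fun _ => rfl
  have : Algebra.IsAlgebraic M N := ⟨fun y =>
    (isAlgebraic_algebraMap_iff (A := F) Subtype.val_injective).1 (hN y y.2)⟩
  exact hx.restrictScalars M

theorem spans_powers (f : Polynomial M) (hf : f.Monic) {y : F}
    (hy : Polynomial.aeval y f = 0) :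
    Spans M (adj M {y}) (fun i : Fin f.natDegree => y ^ (i : ℕ)) := by
  intro x hx
  have hal : IsAlgebraic M y := ⟨f, hf.ne_zero, hy⟩
  rw [mem_adj_iff, ← IntermediateField.mem_toSubalgebra,
    IntermediateField.adjoin_simple_toSubalgebra_of_isAlgebraic hal] at hx
  obtain ⟨q, rfl⟩ := Algebra.adjoin_mem_exists_aeval _ _ hx
  have h1 : Polynomial.aeval y q = Polynomial.aeval y (q %ₘ f) := by
    conv_lhs => rw [← Polynomial.modByMonic_add_div q f]
    simp [hy]
  by_cases h1f : f = 1
  · exact absurd hy (by simp [h1f])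
  refine ⟨fun i => ((q %ₘ f).coeff i : M), fun i => Subtype.prop _, ?_⟩
  rw [h1, Polynomial.aeval_eq_sum_range' (Polynomial.natDegree_modByMonic_lt q hf h1f),
    Finset.sum_range]
  rfl

theorem isSeparable_of_mem (E : IntermediateField M F) (h : Algebra.IsSeparable M E) {x : F}
    (hx : x ∈ E) : IsSeparable M x :=
  IsSeparable.map (x := (⟨x, hx⟩ : E)) E.val Subtype.val_injective
    (Algebra.IsSeparable.isSeparable M _)

theorem sepOver_of_mem_adj {S : Set F} (hS : ∀ x ∈ S, SepOver M x) {x : F}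
    (hx : x ∈ adj M S) : SepOver M x :=
  isSeparable_of_mem _ ((IntermediateField.isSeparable_adjoin_iff_isSeparable M F).2 hS)
    (mem_adj_iff.1 hx)

theorem sepOver_trans (hN : ∀ x ∈ N, SepOver M x) (h : M ≤ N) {x : F}
    (hx : SepOver N x) : SepOver M x := by
  let _ := (Subfield.inclusion h).toAlgebra
  have : IsScalarTower M N F := IsScalarTower.of_algebraMap_eq fun _ => rfl
  have : Algebra.IsSeparable M N := ⟨fun y =>
    (isSeparable_map_iff (IsScalarTower.toAlgHom M N F)
      Subtype.val_injective).1 (hN y y.2)⟩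
  exact IsSeparable.of_algebra_isSeparable_of_isSeparable M hx

/-- A separable element with a `p ^ n`-th power in the base field lies in the base field. -/
theorem mem_of_sepOver_of_pow_mem (p : ℕ) [ExpChar F p] {x : F} (hx : SepOver M x)
    {n : ℕ} (h : x ^ p ^ n ∈ M) : x ∈ M := by
  have : ExpChar M p := (M.subtype.expChar_iff M.subtype_injective p).2 inferInstance
  have h1 := (IntermediateField.isPurelyInseparable_adjoin_simple_iff_pow_mem M F p (x := x)).2
    ⟨n, ⟨⟨_, h⟩, rfl⟩⟩
  have h2 := (IntermediateField.isSeparable_adjoin_simple_iff_isSeparable M F (x := x)).2 hx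
  have h3 := IsPurelyInseparable.inseparable M
    (⟨x, IntermediateField.mem_adjoin_simple_self M x⟩ : IntermediateField.adjoin M {x})
    (Algebra.IsSeparable.isSeparable M _)
  obtain ⟨y, hy⟩ := h3
  have : (y : F) = x := congrArg Subtype.val hy
  rw [← this]
  exact y.2

end SpanningFamilies

/-! ### Residues and residue degrees -/

section Residues

variable {Ω : Type*} [NormedField Ω] [IsUltrametricDist Ω]

theorem mem_bigRing {x : Ω} : x ∈ bigRing Ω ↔ ‖x‖ ≤ 1 := by
  rw [Valuation.mem_valuationSubring_iff, NormedField.valuation_apply]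
  exact Iff.rfl

open Classical in
/-- The residue class of `x` if `‖x‖ ≤ 1`, and `0` otherwise. -/
noncomputable def res (x : Ω) : BigResidue Ω :=
  if h : ‖x‖ ≤ 1 then IsLocalRing.residue (bigRing Ω) ⟨x, mem_bigRing.2 h⟩ else 0

theorem res_coe (x : bigRing Ω) : res (x : Ω) = IsLocalRing.residue (bigRing Ω) x := by
  rw [res, dif_pos (mem_bigRing.1 x.2)]

theorem res_eq_zero {x : Ω} (hx : ‖x‖ ≤ 1) : res x = 0 ↔ ‖x‖ < 1 := by
  rw [res, dif_pos hx, IsLocalRing.residue_eq_zero_iff, IsLocalRing.mem_maximalIdeal,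
    mem_nonunits_iff]
  constructor
  · intro h
    refine lt_of_le_of_ne hx fun h1 => h ?_
    have h0 : x ≠ 0 := by
      rintro rfl
      simp at h1
    refine ⟨⟨⟨x, mem_bigRing.2 hx⟩, ⟨x⁻¹, mem_bigRing.2 (by rw [norm_inv, h1, inv_one])⟩,
      Subtype.ext (mul_inv_cancel₀ h0), Subtype.ext (inv_mul_cancel₀ h0)⟩, rfl⟩
  · rintro h ⟨u, hu⟩
    have h1 : ((u : bigRing Ω) : Ω) * ((↑u⁻¹ : bigRing Ω) : Ω) = 1 :=
      congrArg (fun z : bigRing Ω => (z : Ω)) u.mul_inv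
    have h2 : ((u : bigRing Ω) : Ω) = x := by rw [hu]
    have h3 := mem_bigRing.1 (↑u⁻¹ : bigRing Ω).2
    have h4 := congrArg norm h1
    rw [norm_mul, norm_one, h2] at h4
    nlinarith [norm_nonneg x, norm_nonneg ((↑u⁻¹ : bigRing Ω) : Ω)]

theorem norm_add_le_one {x y : Ω} (hx : ‖x‖ ≤ 1) (hy : ‖y‖ ≤ 1) : ‖x + y‖ ≤ 1 :=
  (IsUltrametricDist.norm_add_le_max x y).trans (max_le hx hy)

theorem norm_add_lt {x y : Ω} {r : ℝ} (hx : ‖x‖ < r) (hy : ‖y‖ < r) : ‖x + y‖ < r :=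
  (IsUltrametricDist.norm_add_le_max x y).trans_lt (max_lt hx hy)

theorem norm_sub_lt {x y : Ω} {r : ℝ} (hx : ‖x‖ < r) (hy : ‖y‖ < r) : ‖x - y‖ < r := by
  rw [sub_eq_add_neg]
  exact norm_add_lt hx (by rwa [norm_neg])

theorem norm_sub_le {x y : Ω} {r : ℝ} (hx : ‖x‖ ≤ r) (hy : ‖y‖ ≤ r) : ‖x - y‖ ≤ r := by
  rw [sub_eq_add_neg]
  exact (IsUltrametricDist.norm_add_le_max x (-y)).trans (max_le hx (by rwa [norm_neg]))

theorem norm_add_eq_left {x y : Ω} (h : ‖y‖ < ‖x‖) : ‖x + y‖ = ‖x‖ := by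
  rw [IsUltrametricDist.norm_add_eq_max_of_norm_ne_norm h.ne', max_eq_left h.le]

theorem norm_eq_of_norm_sub_lt {x y : Ω} (h : ‖x - y‖ < ‖x‖) : ‖y‖ = ‖x‖ := by
  have : y = x + -(x - y) := by ring
  rw [this, norm_add_eq_left (by rwa [norm_neg])]

theorem norm_mul_le_one {x y : Ω} (hx : ‖x‖ ≤ 1) (hy : ‖y‖ ≤ 1) : ‖x * y‖ ≤ 1 := by
  rw [norm_mul]; exact mul_le_one₀ hx (norm_nonneg _) hy

theorem norm_pow_le_one {x : Ω} (hx : ‖x‖ ≤ 1) (n : ℕ) : ‖x ^ n‖ ≤ 1 := by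
  rw [norm_pow]; exact pow_le_one₀ (norm_nonneg _) hx

theorem res_add {x y : Ω} (hx : ‖x‖ ≤ 1) (hy : ‖y‖ ≤ 1) : res (x + y) = res x + res y := by
  rw [res, res, res, dif_pos hx, dif_pos hy, dif_pos (norm_add_le_one hx hy), ← map_add]
  rfl

theorem res_mul {x y : Ω} (hx : ‖x‖ ≤ 1) (hy : ‖y‖ ≤ 1) : res (x * y) = res x * res y := by
  rw [res, res, res, dif_pos hx, dif_pos hy, dif_pos (norm_mul_le_one hx hy), ← map_mul]
  rfl

theorem res_zero : res (0 : Ω) = 0 := (res_eq_zero (by simp)).2 (by simp)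

theorem res_one : res (1 : Ω) = 1 := by
  have := res_coe (1 : bigRing Ω)
  rw [map_one] at this
  exact this

theorem res_neg {x : Ω} (hx : ‖x‖ ≤ 1) : res (-x) = -res x := by
  have := res_add hx (y := -x) (by rwa [norm_neg])
  rw [add_neg_cancel, res_zero] at this
  exact (neg_eq_of_add_eq_zero_right this.symm).symm

theorem res_sub {x y : Ω} (hx : ‖x‖ ≤ 1) (hy : ‖y‖ ≤ 1) : res (x - y) = res x - res y := by
  rw [sub_eq_add_neg, res_add hx (by rwa [norm_neg]), res_neg hy, sub_eq_add_neg]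

theorem res_pow {x : Ω} (hx : ‖x‖ ≤ 1) (n : ℕ) : res (x ^ n) = res x ^ n := by
  induction n with
  | zero => simp [res_one]
  | succ n ih => rw [pow_succ, res_mul (norm_pow_le_one hx n) hx, ih, pow_succ]

theorem norm_sum_le_one {ι : Type*} (s : Finset ι) {f : ι → Ω} (hf : ∀ i ∈ s, ‖f i‖ ≤ 1) :
    ‖∑ i ∈ s, f i‖ ≤ 1 :=
  IsUltrametricDist.norm_sum_le_of_forall_le_of_nonneg zero_le_one hf

theorem res_sum {ι : Type*} (s : Finset ι) {f : ι → Ω} (hf : ∀ i ∈ s, ‖f i‖ ≤ 1) :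
    res (∑ i ∈ s, f i) = ∑ i ∈ s, res (f i) := by
  classical
  induction s using Finset.induction_on with
  | empty => simp [res_zero]
  | insert i s his ih =>
    have h := fun j hj => hf j (Finset.mem_insert_of_mem hj)
    rw [Finset.sum_insert his, Finset.sum_insert his,
      res_add (hf i (Finset.mem_insert_self _ _)) (norm_sum_le_one s h), ih h]

theorem res_eq_iff {x y : Ω} (hx : ‖x‖ ≤ 1) (hy : ‖y‖ ≤ 1) : res x = res y ↔ ‖x - y‖ < 1 := by
  rw [← sub_eq_zero, ← res_sub hx hy, res_eq_zero (norm_sub_le hx hy)]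

theorem exists_res_eq (y : BigResidue Ω) : ∃ x : Ω, ‖x‖ ≤ 1 ∧ res x = y := by
  obtain ⟨x, rfl⟩ := IsLocalRing.residue_surjective y
  exact ⟨x, mem_bigRing.1 x.2, res_coe x⟩

variable {M N P : Subfield Ω}

theorem mem_residueSubfield {y : BigResidue Ω} :
    y ∈ residueSubfield M ↔ ∃ x ∈ M, ‖x‖ ≤ 1 ∧ res x = y := by
  constructor
  · rintro ⟨x, hx, rfl⟩
    exact ⟨x, hx, mem_bigRing.1 x.2, res_coe x⟩
  · rintro ⟨x, hx, h1, rfl⟩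
    exact ⟨⟨x, mem_bigRing.2 h1⟩, hx, (res_coe _).symm⟩

theorem res_mem {x : Ω} (hx : x ∈ M) : res x ∈ residueSubfield M := by
  by_cases h : ‖x‖ ≤ 1
  · exact mem_residueSubfield.2 ⟨x, hx, h, rfl⟩
  · rw [res, dif_neg h]
    exact zero_mem _

theorem res_mem_iff {x : Ω} (hx : ‖x‖ ≤ 1) :
    res x ∈ residueSubfield M ↔ ∃ y ∈ M, ‖x - y‖ < 1 := by
  constructor
  · intro h
    obtain ⟨y, hy, h1, h2⟩ := mem_residueSubfield.1 h
    exact ⟨y, hy, (res_eq_iff hx h1).1 h2.symm⟩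
  · rintro ⟨y, hy, h⟩
    have h1 : ‖y‖ ≤ 1 := by
      have : y = x - (x - y) := by ring
      rw [this]
      exact norm_sub_le hx h.le
    exact mem_residueSubfield.2 ⟨y, hy, h1, ((res_eq_iff hx h1).2 h).symm⟩

theorem charP_bigResidue (p : ℕ) [Fact p.Prime] [CharP Ω p] : CharP (BigResidue Ω) p := by
  refine (CharP.charP_iff_prime_eq_zero Fact.out).2 ?_
  have := map_natCast (IsLocalRing.residue (bigRing Ω)) p
  rw [← this]
  have h0 : ((p : ℕ) : bigRing Ω) = 0 := Subtype.ext (by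
    have : ((p : bigRing Ω) : Ω) = (p : Ω) := map_natCast (bigRing Ω).subtype p
    rw [this, CharP.cast_eq_zero]; rfl)
  rw [h0, map_zero]

/-- A family with linearly independent residues is orthonormal. -/
theorem norm_le_norm_sum {ι : Type*} [Fintype ι] {b : ι → Ω} (hb : ∀ i, ‖b i‖ ≤ 1)
    (hl : LinearIndependent (residueSubfield M) (fun i => res (b i)))
    {a : ι → Ω} (ha : ∀ i, a i ∈ M) (i : ι) : ‖a i‖ ≤ ‖∑ i, a i * b i‖ := by
  obtain ⟨j, -, hj⟩ := Finset.exists_max_image Finset.univ (fun i => ‖a i‖) ⟨i, Finset.mem_univ i⟩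
  refine (hj i (Finset.mem_univ i)).trans ?_
  by_cases h0 : a j = 0
  · rw [h0, norm_zero]; exact norm_nonneg _
  have hpos : 0 < ‖a j‖ := norm_pos_iff.2 h0
  have hc : ∀ i, ‖a i / a j‖ ≤ 1 := fun i => by
    rw [norm_div, div_le_one hpos]; exact hj i (Finset.mem_univ i)
  have h1 : ∀ i ∈ Finset.univ, ‖a i / a j * b i‖ ≤ 1 := fun i _ => norm_mul_le_one (hc i) (hb i)
  have hs : ∑ i, a i * b i = a j * ∑ i, a i / a j * b i := by
    rw [Finset.mul_sum]
    refine Finset.sum_congr rfl fun i _ => ?_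
    field_simp
  have hn : ¬ ‖∑ i, a i / a j * b i‖ < 1 := by
    rw [← res_eq_zero (norm_sum_le_one _ h1), res_sum _ h1]
    intro hz
    have := linearIndependent_subfield_iff.1 hl (fun i => res (a i / a j))
      (fun i => res_mem (M.div_mem (ha i) (ha j)))
      (by rw [← hz]; exact Finset.sum_congr rfl fun i _ => (res_mul (hc i) (hb i)).symm) j
    rw [div_self h0, res_one] at this
    exact one_ne_zero this
  rw [hs, norm_mul]
  exact le_mul_of_one_le_right hpos.le (not_lt.1 hn)

theorem linearIndependent_of_res {ι : Type*} [Fintype ι] {b : ι → Ω} (hb : ∀ i, ‖b i‖ ≤ 1)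
    (hl : LinearIndependent (residueSubfield M) (fun i => res (b i))) :
    LinearIndependent M b := by
  rw [linearIndependent_subfield_iff]
  intro a ha hs i
  have := norm_le_norm_sum hb hl ha i
  rw [hs, norm_zero] at this
  exact norm_le_zero_iff.1 this

theorem exists_lift_residues {ι : Type*} {r : ι → BigResidue Ω}
    (hr : ∀ i, r i ∈ residueSubfield N) :
    ∃ b : ι → Ω, (∀ i, b i ∈ N) ∧ (∀ i, ‖b i‖ ≤ 1) ∧ (fun i => res (b i)) = r := by
  choose b hb h1 h2 using fun i => mem_residueSubfield.1 (hr i)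
  exact ⟨b, hb, h1, funext h2⟩

theorem FiniteOver.card_le_of_res (h : FiniteOver M N) {ι : Type*} [Fintype ι]
    {r : ι → BigResidue Ω} (hr : ∀ i, r i ∈ residueSubfield N)
    (hl : LinearIndependent (residueSubfield M) r) : Fintype.card ι ≤ M.relfinrank N := by
  obtain ⟨b, hb, h1, rfl⟩ := exists_lift_residues hr
  exact h.card_le hb (linearIndependent_of_res h1 hl)

theorem FiniteOver.residue (h : FiniteOver M N) :
    FiniteOver (residueSubfield M) (residueSubfield N) := by
  have hle := residueSubfield_mono h.1
  rw [finiteOver_iff hle]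
  have := rank_le (R := residueSubfield M) (M := Subfield.extendScalars hle)
    (n := M.relfinrank N) fun s hs => by
      have h1 := hs.map' (Subfield.extendScalars hle).val.toLinearMap
        (LinearMap.ker_eq_bot.2 Subtype.val_injective)
      have := h.card_le_of_res (r := fun i : s => ((i : Subfield.extendScalars hle) : BigResidue Ω))
        (fun i => i.1.2) h1
      rwa [Fintype.card_coe] at this
  exact Module.rank_lt_aleph0_iff.1 (this.trans_lt (Cardinal.natCast_lt_aleph0))

/-- The residue degree is at most the degree. -/
theorem FiniteOver.relfinrank_residue_le (h : FiniteOver M N) :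
    (residueSubfield M).relfinrank (residueSubfield N) ≤ M.relfinrank N := by
  obtain ⟨r, hr, hl, -⟩ := h.residue.exists_basis
  simpa using h.card_le_of_res hr hl

/-- `N / M` is a finite extension whose degree is equal to the degree of the residue
extension. -/
def IsResidual (M N : Subfield Ω) : Prop :=
  FiniteOver M N ∧ M.relfinrank N ≤ (residueSubfield M).relfinrank (residueSubfield N)

theorem IsResidual.eq (h : IsResidual M N) :
    (residueSubfield M).relfinrank (residueSubfield N) = M.relfinrank N :=
  le_antisymm h.1.relfinrank_residue_le h.2

theorem IsResidual.refl (M : Subfield Ω) : IsResidual M M :=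
  ⟨FiniteOver.refl M, by rw [Subfield.relfinrank_self, Subfield.relfinrank_self]⟩

theorem IsResidual.trans (h : IsResidual M N) (h' : IsResidual N P) : IsResidual M P := by
  refine ⟨h.1.trans h'.1, ?_⟩
  rw [← Subfield.relfinrank_mul_relfinrank h.1.1 h'.1.1,
    ← Subfield.relfinrank_mul_relfinrank h.1.residue.1 h'.1.residue.1, h.eq, h'.eq]

theorem IsResidual.of_trans (h : IsResidual M P) (h1 : M ≤ N) (h2 : N ≤ P) :
    IsResidual M N ∧ IsResidual N P := by
  have f1 := h.1.bot_le h1 h2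
  have f2 := h.1.le_top h1 h2
  have he := h.eq
  rw [← Subfield.relfinrank_mul_relfinrank h1 h2,
    ← Subfield.relfinrank_mul_relfinrank f1.residue.1 f2.residue.1] at he
  have a1 := f1.relfinrank_residue_le
  have a2 := f2.relfinrank_residue_le
  have b1 := Nat.pos_of_ne_zero f1.2
  have b2 := Nat.pos_of_ne_zero f2.2
  refine ⟨⟨f1, ?_⟩, ⟨f2, ?_⟩⟩
  · by_contra hc
    push Not at hc
    have := Nat.mul_lt_mul_of_lt_of_le hc a2 b2
    omega
  · by_contra hc
    push Not at hc
    have := Nat.mul_lt_mul_of_le_of_lt a1 hc b1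
    omega

theorem isResidual_of_card {ι : Type*} [Fintype ι] {b : ι → Ω} (h : FiniteOver M N)
    (hbN : ∀ i, b i ∈ N) (hl : LinearIndependent (residueSubfield M) (fun i => res (b i)))
    (hc : M.relfinrank N ≤ Fintype.card ι) : IsResidual M N :=
  ⟨h, hc.trans (h.residue.card_le (fun i => res_mem (hbN i)) hl)⟩

theorem isResidual_of_spans {ι : Type*} [Fintype ι] {b : ι → Ω} (h : M ≤ N)
    (hs : Spans M N b) (hbN : ∀ i, b i ∈ N)
    (hl : LinearIndependent (residueSubfield M) (fun i => res (b i))) : IsResidual M N :=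
  isResidual_of_card (hs.finiteOver h) hbN hl (hs.relfinrank_le h)

theorem IsResidual.spans (h : IsResidual M N) {ι : Type*} [Fintype ι] {b : ι → Ω}
    (hbN : ∀ i, b i ∈ N) (hb : ∀ i, ‖b i‖ ≤ 1)
    (hl : LinearIndependent (residueSubfield M) (fun i => res (b i)))
    (hc : M.relfinrank N ≤ Fintype.card ι) : Spans M N b :=
  h.1.spans_of_card hbN (linearIndependent_of_res hb hl) hc

theorem IsResidual.exists_basis (h : IsResidual M N) :
    ∃ b : Fin (M.relfinrank N) → Ω, (∀ i, b i ∈ N) ∧ (∀ i, ‖b i‖ ≤ 1) ∧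
      LinearIndependent (residueSubfield M) (fun i => res (b i)) ∧ Spans M N b := by
  obtain ⟨r, hr, hl, -⟩ := h.1.residue.exists_basis
  obtain ⟨b, hb, h1, rfl⟩ := exists_lift_residues hr
  rw [← h.eq]
  exact ⟨b, hb, h1, hl, h.spans hb h1 hl (by simp [h.eq])⟩

theorem spans_residue {ι : Type*} [Fintype ι] {b : ι → Ω} (hs : Spans M N b)
    (hb : ∀ i, ‖b i‖ ≤ 1) (hl : LinearIndependent (residueSubfield M) (fun i => res (b i))) :
    Spans (residueSubfield M) (residueSubfield N) (fun i => res (b i)) := by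
  intro y hy
  obtain ⟨x, hx, h1, rfl⟩ := mem_residueSubfield.1 hy
  obtain ⟨a, ha, rfl⟩ := hs x hx
  have hle := fun i => (norm_le_norm_sum hb hl ha i).trans h1
  refine ⟨fun i => res (a i), fun i => res_mem (ha i), ?_⟩
  rw [res_sum _ fun i _ => norm_mul_le_one (hle i) (hb i)]
  exact Finset.sum_congr rfl fun i _ => res_mul (hle i) (hb i)

/-- An extension whose degree is the residue degree has the same values. -/
theorem exists_norm_eq {ι : Type*} [Fintype ι] {b : ι → Ω} (hs : Spans M N b)
    (hb : ∀ i, ‖b i‖ ≤ 1) (hl : LinearIndependent (residueSubfield M) (fun i => res (b i)))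
    {x : Ω} (hx : x ∈ N) (hx0 : x ≠ 0) : ∃ y ∈ M, y ≠ 0 ∧ ‖x‖ = ‖y‖ := by
  obtain ⟨a, ha, rfl⟩ := hs x hx
  have hne : (Finset.univ : Finset ι).Nonempty := by
    by_contra h
    rw [Finset.not_nonempty_iff_eq_empty] at h
    simp [h] at hx0
  obtain ⟨j, -, hj⟩ := Finset.exists_max_image Finset.univ (fun i => ‖a i‖) hne
  have h : ‖∑ i, a i * b i‖ = ‖a j‖ := by
    refine le_antisymm ?_ (norm_le_norm_sum hb hl ha j)
    refine IsUltrametricDist.norm_sum_le_of_forall_le_of_nonneg (norm_nonneg _) fun i _ => ?_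
    rw [norm_mul]
    exact (mul_le_of_le_one_right (norm_nonneg _) (hb i)).trans (hj i (Finset.mem_univ i))
  refine ⟨a j, ha j, ?_, h⟩
  intro h0
  rw [h0, norm_zero] at h
  exact hx0 (norm_eq_zero.1 h)

theorem IsResidual.exists_norm_eq (h : IsResidual M N) {x : Ω} (hx : x ∈ N) (hx0 : x ≠ 0) :
    ∃ y ∈ M, y ≠ 0 ∧ ‖x‖ = ‖y‖ := by
  obtain ⟨b, -, h1, hl, hs⟩ := h.exists_basis
  exact RamTheory.exists_norm_eq hs h1 hl hx hx0

/-- Terms of pairwise distinct norms do not cancel. -/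
theorem norm_le_norm_sum_of_ne {ι : Type*} [Fintype ι] {f : ι → Ω}
    (hf : ∀ i j, i ≠ j → f i ≠ 0 → ‖f i‖ ≠ ‖f j‖) (i : ι) : ‖f i‖ ≤ ‖∑ i, f i‖ := by
  classical
  by_cases h0 : f i = 0
  · rw [h0, norm_zero]; exact norm_nonneg _
  have hsum : ∑ j, f j = ∑ j ∈ Finset.univ.filter (fun j => f j ≠ 0), f j :=
    (Finset.sum_filter_ne_zero _).symm
  have hmem : i ∈ Finset.univ.filter (fun j => f j ≠ 0) := by simp [h0]
  rw [hsum, IsUltrametricDist.norm_sum_eq_sup'_of_pairwise_ne ⟨i, hmem⟩ ?_]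
  · exact Finset.le_sup' (fun j => ‖f j‖) hmem
  · intro a ha b hb hab
    rw [Finset.mem_coe, Finset.mem_filter] at ha
    exact hf a b hab ha.2

end Residues

/-! ### Discretely valued subfields and successive approximation -/

section Discrete

variable {Ω : Type*} [NormedField Ω] [IsUltrametricDist Ω]

/-- The element `s` of `M` is a uniformizer: the values of `M` are the powers of `‖s‖ < 1`. -/
structure IsUniformizer (M : Subfield Ω) (s : Ω) : Prop where
  mem : s ∈ M
  ne_zero : s ≠ 0
  norm_lt : ‖s‖ < 1
  exists_zpow : ∀ x ∈ M, x ≠ 0 → ∃ n : ℤ, ‖x‖ = ‖s‖ ^ n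

variable {M N : Subfield Ω} {s : Ω}

theorem IsUniformizer.norm_pos (h : IsUniformizer M s) : 0 < ‖s‖ := norm_pos_iff.2 h.ne_zero

theorem IsUniformizer.zpow_lt_iff (h : IsUniformizer M s) {m n : ℤ} :
    ‖s‖ ^ m < ‖s‖ ^ n ↔ n < m := zpow_lt_zpow_iff_right_of_lt_one₀ h.norm_pos h.norm_lt

theorem IsUniformizer.zpow_le_iff (h : IsUniformizer M s) {m n : ℤ} :
    ‖s‖ ^ m ≤ ‖s‖ ^ n ↔ n ≤ m := zpow_le_zpow_iff_right_of_lt_one₀ h.norm_pos h.norm_lt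

theorem IsUniformizer.zpow_inj (h : IsUniformizer M s) {m n : ℤ} :
    ‖s‖ ^ m = ‖s‖ ^ n ↔ m = n := by
  constructor
  · intro h1
    exact le_antisymm (h.zpow_le_iff.1 h1.ge) (h.zpow_le_iff.1 h1.le)
  · rintro rfl; rfl

theorem IsUniformizer.le_zpow_succ (h : IsUniformizer M s) {x : Ω} (hx : x ∈ M) {n : ℤ}
    (hn : ‖x‖ < ‖s‖ ^ n) : ‖x‖ ≤ ‖s‖ ^ (n + 1) := by
  by_cases h0 : x = 0
  · rw [h0, norm_zero]; exact zpow_nonneg (norm_nonneg _) _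
  obtain ⟨m, hm⟩ := h.exists_zpow x hx h0
  rw [hm] at hn ⊢
  exact h.zpow_le_iff.2 (h.zpow_lt_iff.1 hn)

theorem IsUniformizer.le_of_lt_one (h : IsUniformizer M s) {x : Ω} (hx : x ∈ M) (hn : ‖x‖ < 1) :
    ‖x‖ ≤ ‖s‖ := by
  have := h.le_zpow_succ hx (n := 0) (by simpa using hn)
  simpa using this

/-- In a discretely valued field an element with `q ^ n`-th roots for all `n` is zero or a unit. -/
theorem IsUniformizer.norm_eq_one_of_roots (h : IsUniformizer M s) {q : ℕ} (hq : 1 < q) {x : Ω}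
    (h0 : x ≠ 0) (hx : ∀ n : ℕ, ∃ z ∈ M, z ^ q ^ n = x) : ‖x‖ = 1 := by
  have hxM : x ∈ M := by
    obtain ⟨z, hz, rfl⟩ := hx 0
    exact M.pow_mem hz _
  obtain ⟨m, hm⟩ := h.exists_zpow x hxM h0
  have hdvd : ∀ n : ℕ, ((q ^ n : ℕ) : ℤ) ∣ m := by
    intro n
    obtain ⟨z, hz, rfl⟩ := hx n
    have hz0 : z ≠ 0 := by
      rintro rfl
      exact h0 (zero_pow (pow_pos (by omega) n).ne')
    obtain ⟨k, hk⟩ := h.exists_zpow z hz hz0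
    refine ⟨k, ?_⟩
    rw [norm_pow, hk, ← zpow_natCast, ← zpow_mul, h.zpow_inj] at hm
    rw [← hm, mul_comm]
  have : m = 0 := by
    by_contra hm0
    have h1 := Int.le_of_dvd (abs_pos.2 hm0) ((dvd_abs _ _).2 (hdvd m.natAbs))
    have h2 : m.natAbs < q ^ m.natAbs := Nat.lt_pow_self hq
    rw [Int.abs_eq_natAbs] at h1
    exact absurd (Int.ofNat_le.1 h1) (not_le.2 h2)
  rw [hm, this, zpow_zero]

theorem norm_sum_mul_le_one {ι : Type*} [Fintype ι] {a b : ι → Ω} (ha : ∀ i, ‖a i‖ ≤ 1)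
    (hb : ∀ i, ‖b i‖ ≤ 1) : ‖∑ i, a i * b i‖ ≤ 1 :=
  norm_sum_le_one _ fun i _ => norm_mul_le_one (ha i) (hb i)

/-- Successive approximation: if every integral element of `N` is, modulo `s ^ p ^ m`, a
combination of the `b i` whose coefficients are `p ^ m`-th powers of integral elements of the
complete field `M`, then every integral element of `N` is such a combination. -/
theorem exists_eq_sum_pow (p : ℕ) [Fact p.Prime] [CharP Ω p] (m : ℕ)
    (hM : IsComplete (M : Set Ω)) (hs : s ∈ M) (hs0 : s ≠ 0) (hs1 : ‖s‖ < 1) (hMN : M ≤ N)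
    {ι : Type*} [Fintype ι] {b : ι → Ω} (hb : ∀ i, b i ∈ N)
    (H : ∀ x ∈ N, ‖x‖ ≤ 1 → ∃ a : ι → Ω, (∀ i, a i ∈ M) ∧ (∀ i, ‖a i‖ ≤ 1) ∧
      ‖x - ∑ i, a i ^ p ^ m * b i‖ ≤ ‖s‖ ^ p ^ m)
    {x : Ω} (hx : x ∈ N) (hx1 : ‖x‖ ≤ 1) :
    ∃ a : ι → Ω, (∀ i, a i ∈ M) ∧ (∀ i, ‖a i‖ ≤ 1) ∧ x = ∑ i, a i ^ p ^ m * b i := by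
  have hspos : 0 < ‖s‖ := norm_pos_iff.2 hs0
  choose! A hA hA1 hA2 using H
  let step : Ω → Ω := fun y => (y - ∑ i, A y i ^ p ^ m * b i) / s ^ p ^ m
  let X : ℕ → Ω := fun n => step^[n] x
  have hX : ∀ n, X n ∈ N ∧ ‖X n‖ ≤ 1 := by
    intro n
    induction n with
    | zero => exact ⟨hx, hx1⟩
    | succ n ih =>
      have e : X (n + 1) = step (X n) := Function.iterate_succ_apply' step n x
      rw [e]
      refine ⟨N.div_mem (N.sub_mem ih.1 (N.sum_mem fun i _ => N.mul_mem (N.pow_mem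
        (hMN (hA _ ih.1 ih.2 i)) _) (hb i))) (N.pow_mem (hMN hs) _), ?_⟩
      rw [norm_div, norm_pow]
      exact (div_le_one (pow_pos hspos _)).2 (hA2 _ ih.1 ih.2)
  have hstep : ∀ n, X n = ∑ i, A (X n) i ^ p ^ m * b i + s ^ p ^ m * X (n + 1) := by
    intro n
    have e : X (n + 1) = step (X n) := Function.iterate_succ_apply' step n x
    rw [e]
    simp only [step]
    rw [mul_div_cancel₀ _ (pow_ne_zero _ hs0)]
    ring
  let S : ι → ℕ → Ω := fun i n => ∑ k ∈ Finset.range n, s ^ k * A (X k) i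
  have hS : ∀ n, x = ∑ i, S i n ^ p ^ m * b i + s ^ (n * p ^ m) * X n := by
    intro n
    induction n with
    | zero =>
      have : p ^ m ≠ 0 := (pow_pos (Fact.out : p.Prime).pos m).ne'
      simp [S, X, zero_pow this]
    | succ n ih =>
      have e : ∀ i, S i (n + 1) ^ p ^ m =
          S i n ^ p ^ m + s ^ (n * p ^ m) * A (X n) i ^ p ^ m := by
        intro i
        simp only [S]
        rw [Finset.sum_range_succ, add_pow_char_pow, mul_pow, ← pow_mul]
      simp only [e]
      conv_lhs => rw [ih, hstep n]
      simp only [add_mul, Finset.sum_add_distrib, mul_add, Finset.mul_sum]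
      ring_nf
  have hSM : ∀ i n, S i n ∈ M := fun i n => M.sum_mem fun k _ =>
    M.mul_mem (M.pow_mem hs k) (hA _ (hX k).1 (hX k).2 i)
  have hS1 : ∀ i n, ‖S i n‖ ≤ 1 := fun i n => norm_sum_le_one _ fun k _ =>
    norm_mul_le_one (norm_pow_le_one hs1.le k) (hA1 _ (hX k).1 (hX k).2 i)
  have hcau : ∀ i, CauchySeq (S i) := by
    intro i
    refine cauchySeq_of_le_geometric ‖s‖ 1 hs1 fun n => ?_
    rw [dist_comm, dist_eq_norm]
    simp only [S]
    rw [Finset.sum_range_succ, add_sub_cancel_left, norm_mul, norm_pow, one_mul]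
    exact mul_le_of_le_one_right (pow_nonneg hspos.le _) (hA1 _ (hX n).1 (hX n).2 i)
  choose a haM ha using fun i => cauchySeq_tendsto_of_isComplete hM (hSM i) (hcau i)
  refine ⟨a, haM, fun i => le_of_tendsto (ha i).norm (Filter.Eventually.of_forall (hS1 i)), ?_⟩
  have hlim1 : Filter.Tendsto (fun n => ∑ i, S i n ^ p ^ m * b i + s ^ (n * p ^ m) * X n)
      Filter.atTop (nhds (∑ i, a i ^ p ^ m * b i + 0)) := by
    refine Filter.Tendsto.add (tendsto_finsetSum _ fun i _ =>
      ((ha i).pow _).mul tendsto_const_nhds) ?_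
    have h1 : Filter.Tendsto (fun n => ‖s‖ ^ n) Filter.atTop (nhds 0) :=
      tendsto_pow_atTop_nhds_zero_of_lt_one hspos.le hs1
    refine squeeze_zero_norm (fun n => ?_) h1
    rw [norm_mul, norm_pow]
    refine (mul_le_of_le_one_right (pow_nonneg hspos.le _) (hX n).2).trans ?_
    exact pow_le_pow_of_le_one hspos.le hs1.le
      (Nat.le_mul_of_pos_right n (pow_pos (Fact.out : p.Prime).pos m))
  have hlim2 : Filter.Tendsto (fun n => ∑ i, S i n ^ p ^ m * b i + s ^ (n * p ^ m) * X n)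
      Filter.atTop (nhds x) := by
    simp only [← hS]
    exact tendsto_const_nhds
  have := tendsto_nhds_unique hlim2 hlim1
  rwa [add_zero] at this

/-- Over a complete field `M`, a family that generates the integral elements of `N` modulo an
element `s` of `M` with `‖s‖ < 1` spans `N`. -/
theorem spans_of_approx (p : ℕ) [Fact p.Prime] [CharP Ω p]
    (hM : IsComplete (M : Set Ω)) (hs : s ∈ M) (hs0 : s ≠ 0) (hs1 : ‖s‖ < 1) (hMN : M ≤ N)
    {ι : Type*} [Fintype ι] {b : ι → Ω} (hb : ∀ i, b i ∈ N)
    (H : ∀ x ∈ N, ‖x‖ ≤ 1 → ∃ a : ι → Ω, (∀ i, a i ∈ M) ∧ (∀ i, ‖a i‖ ≤ 1) ∧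
      ‖x - ∑ i, a i * b i‖ ≤ ‖s‖) : Spans M N b := by
  intro x hx
  have hspos : 0 < ‖s‖ := norm_pos_iff.2 hs0
  obtain ⟨n, hn⟩ : ∃ n : ℕ, ‖s ^ n * x‖ ≤ 1 := by
    have h1 : Filter.Tendsto (fun n => ‖s‖ ^ n * ‖x‖) Filter.atTop (nhds (0 * ‖x‖)) :=
      (tendsto_pow_atTop_nhds_zero_of_lt_one hspos.le hs1).mul_const _
    rw [zero_mul] at h1
    obtain ⟨n, hn⟩ := (h1.eventually (gt_mem_nhds zero_lt_one)).exists
    exact ⟨n, by rw [norm_mul, norm_pow]; exact hn.le⟩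
  obtain ⟨a, ha, -, h⟩ := exists_eq_sum_pow p 0 hM hs hs0 hs1 hMN hb (by simpa using H)
    (N.mul_mem (N.pow_mem (hMN hs) n) hx) hn
  refine ⟨fun i => a i / s ^ n, fun i => M.div_mem (ha i) (M.pow_mem hs n), ?_⟩
  have hsn : s ^ n ≠ 0 := pow_ne_zero _ hs0
  simp only [pow_zero, pow_one] at h
  simp only [div_mul_eq_mul_div, ← Finset.sum_div, ← h]
  rw [mul_div_cancel_left₀ _ hsn]

/-- A finite extension of a complete field is complete. -/
theorem FiniteOver.isComplete (h : FiniteOver M N) (hM : IsComplete (M : Set Ω))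
    (hnt : ∃ x ∈ M, x ≠ 0 ∧ ‖x‖ < 1) : IsComplete (N : Set Ω) := by
  obtain ⟨x, hx, hx0, hx1⟩ := hnt
  let _ : NontriviallyNormedField M :=
    { (inferInstance : NormedField M) with
      non_trivial := ⟨⟨x⁻¹, M.inv_mem hx⟩, by
        change 1 < ‖x⁻¹‖
        rw [norm_inv]
        exact (one_lt_inv₀ (norm_pos_iff.2 hx0)).2 hx1⟩ }
  have hMc : CompleteSpace M := hM.completeSpace_coe
  have hf := (finiteOver_iff h.1).1 h
  let _ : NormedSpace M Ω :=
    { norm_smul_le := fun a b => by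
        rw [Algebra.smul_def, norm_mul]; exact le_rfl }
  have hc : CompleteSpace (Subfield.extendScalars h.1) :=
    FiniteDimensional.complete M _
  exact completeSpace_coe_iff_isComplete.1 hc

/-- A finite extension of a discretely valued field is discretely valued: for `r` the degree, the
`r !`-th powers of the values of `N` are values of `M`, because two terms of an equation of degree
at most `r` have the same norm. -/
theorem FiniteOver.exists_isUniformizer (h : FiniteOver M N) (hs : IsUniformizer M s) :
    ∃ t, IsUniformizer N t := by
  set r := M.relfinrank N with hr
  have hpow : ∀ x ∈ N, x ≠ 0 → ∃ n : ℤ, ‖x‖ ^ r.factorial = ‖s‖ ^ n := by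
    intro x hx hx0
    have hdep : ¬ LinearIndependent M (fun i : Fin (r + 1) => x ^ (i : ℕ)) := by
      intro hl
      have := h.card_le (fun i => N.pow_mem hx _) hl
      rw [Fintype.card_fin] at this
      omega
    rw [linearIndependent_subfield_iff] at hdep
    push Not at hdep
    obtain ⟨a, ha, hsum, i0, hi0⟩ := hdep
    obtain ⟨i, j, hij, hi, he⟩ : ∃ i j : Fin (r + 1), i ≠ j ∧ a i * x ^ (i : ℕ) ≠ 0 ∧
        ‖a i * x ^ (i : ℕ)‖ = ‖a j * x ^ (j : ℕ)‖ := by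
      by_contra hcon
      push Not at hcon
      have := norm_le_norm_sum_of_ne (f := fun i : Fin (r + 1) => a i * x ^ (i : ℕ)) hcon i0
      rw [hsum, norm_zero, norm_le_zero_iff] at this
      exact mul_ne_zero hi0 (pow_ne_zero _ hx0) this
    have key : ∀ i j : Fin (r + 1), (i : ℕ) < j → a i * x ^ (i : ℕ) ≠ 0 →
        a j * x ^ (j : ℕ) ≠ 0 → ‖a i * x ^ (i : ℕ)‖ = ‖a j * x ^ (j : ℕ)‖ →
        ∃ n : ℤ, ‖x‖ ^ r.factorial = ‖s‖ ^ n := by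
      intro i j hlt hi hj he
      obtain ⟨m, hm⟩ := hs.exists_zpow _ (M.div_mem (ha i) (ha j))
        (div_ne_zero (left_ne_zero_of_mul hi) (left_ne_zero_of_mul hj))
      have hd : ‖x‖ ^ ((j : ℕ) - i) = ‖s‖ ^ m := by
        rw [← hm, norm_div]
        have hx' : ‖x‖ ≠ 0 := norm_ne_zero_iff.2 hx0
        have hj' : ‖a j‖ ≠ 0 := norm_ne_zero_iff.2 (left_ne_zero_of_mul hj)
        rw [norm_mul, norm_mul, norm_pow, norm_pow] at he
        rw [eq_div_iff hj', ← mul_left_inj' (pow_ne_zero (i : ℕ) hx'), he]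
        rw [mul_right_comm, ← pow_add, Nat.sub_add_cancel hlt.le, mul_comm]
      have hdvd : (j : ℕ) - i ∣ r.factorial :=
        Nat.dvd_factorial (by omega) (by have := j.2; omega)
      obtain ⟨c, hc⟩ := hdvd
      exact ⟨m * c, by rw [hc, pow_mul, hd, zpow_mul, zpow_natCast]⟩
    have hj : a j * x ^ (j : ℕ) ≠ 0 := by
      rw [← norm_ne_zero_iff, ← he, norm_ne_zero_iff]; exact hi
    rcases lt_or_gt_of_ne (fun hh => hij (Fin.ext hh)) with hlt | hlt
    · exact key i j hlt hi hj he
    · exact key j i hlt hj hi he.symm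
  have hR : r.factorial ≠ 0 := Nat.factorial_ne_zero r
  have hex : ∃ n : ℕ, 0 < n ∧ ∃ x ∈ N, x ≠ 0 ∧ ‖x‖ ^ r.factorial = ‖s‖ ^ n :=
    ⟨r.factorial, Nat.pos_of_ne_zero hR, s, h.1 hs.mem, hs.ne_zero, rfl⟩
  classical
  -- `t` has the smallest positive exponent
  obtain ⟨hn0, t, ht, ht0, htn⟩ := Nat.find_spec hex
  set n := Nat.find hex with hn
  have ht1 : ‖t‖ < 1 := by
    by_contra hge
    have : 1 ≤ ‖t‖ ^ r.factorial := one_le_pow₀ (not_lt.1 hge)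
    rw [htn] at this
    exact absurd (pow_lt_one₀ (norm_nonneg _) hs.norm_lt hn0.ne') (not_lt.2 this)
  refine ⟨t, ht, ht0, ht1, fun x hx hx0 => ?_⟩
  obtain ⟨m, hm⟩ := hpow x hx hx0
  have hnZ : (0 : ℤ) < n := by exact_mod_cast hn0
  refine ⟨m / n, ?_⟩
  set y := x / t ^ (m / n) with hy
  have hyr : ‖y‖ ^ r.factorial = ‖s‖ ^ (m % n) := by
    rw [hy, norm_div, norm_zpow, div_pow, hm, ← zpow_natCast (‖t‖ ^ (m / n)), zpow_comm,
      zpow_natCast, htn, ← zpow_natCast, ← zpow_mul, ← zpow_sub₀ hs.norm_pos.ne']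
    congr 1
    have := Int.emod_add_mul_ediv m n
    linarith
  have hmod : m % n = 0 := by
    by_contra hne
    have h0 := Int.emod_nonneg m hnZ.ne'
    have h1 := Int.emod_lt_of_pos m hnZ
    obtain ⟨k, hk⟩ := Int.eq_ofNat_of_zero_le h0
    have hk0 : 0 < k := by omega
    have hkn : k < n := by omega
    refine Nat.find_min hex hkn ⟨hk0, y, N.div_mem hx (N.zpow_mem ht _),
      div_ne_zero hx0 (zpow_ne_zero _ ht0), ?_⟩
    rw [hyr, hk, zpow_natCast]
  rw [hmod, zpow_zero] at hyr
  have hy1 : ‖y‖ = 1 := (pow_eq_one_iff_of_nonneg (norm_nonneg _) hR).1 hyr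
  rw [hy, norm_div, norm_zpow, div_eq_one_iff_eq
    (zpow_ne_zero _ (norm_ne_zero_iff.2 ht0))] at hy1
  exact hy1

/-- The field `Ω` is algebraic over `E`, and conjugate elements over `E` have the same norm. -/
structure IsNormBase (E : Subfield Ω) : Prop where
  isAlgebraic : ∀ x : Ω, IsAlgebraic E x
  norm_eq : ∀ x y : Ω, minpoly E x = minpoly E y → ‖x‖ = ‖y‖

theorem isNormBase_of_isComplete (hM : IsComplete (M : Set Ω))
    (hnt : ∃ x ∈ M, x ≠ 0 ∧ ‖x‖ < 1) (hal : ∀ x : Ω, IsAlgebraic M x) : IsNormBase M := by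
  obtain ⟨x, hx, hx0, hx1⟩ := hnt
  let _ : NontriviallyNormedField M :=
    { (inferInstance : NormedField M) with
      non_trivial := ⟨⟨x⁻¹, M.inv_mem hx⟩, by
        change 1 < ‖x⁻¹‖
        rw [norm_inv]
        exact (one_lt_inv₀ (norm_pos_iff.2 hx0)).2 hx1⟩ }
  have hMc : CompleteSpace M := hM.completeSpace_coe
  have : Algebra.IsAlgebraic M Ω := ⟨hal⟩
  let _ : NormedAlgebra M Ω :=
    { norm_smul_le := fun a b => by
        rw [Algebra.smul_def, norm_mul]; exact le_rfl }
  refine ⟨hal, fun x y hxy => ?_⟩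
  rw [NormedAlgebra.norm_eq_spectralNorm M x, NormedAlgebra.norm_eq_spectralNorm M y,
    spectralNorm, spectralNorm, hxy]

theorem minpoly_eq_of_minpoly_eq (h : M ≤ N) {x y : Ω} (hx : IsAlgebraic M x)
    (hxy : minpoly N x = minpoly N y) : minpoly M x = minpoly M y := by
  let _ := (Subfield.inclusion h).toAlgebra
  have : IsScalarTower M N Ω := IsScalarTower.of_algebraMap_eq fun _ => rfl
  refine minpoly.eq_of_irreducible_of_monic (minpoly.irreducible hx.isIntegral) ?_
    (minpoly.monic hx.isIntegral)
  have h1 : minpoly N x ∣ (minpoly M x).map (algebraMap M N) :=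
      minpoly.dvd_map_of_isScalarTower M N x
  rw [hxy] at h1
  obtain ⟨q, hq⟩ := h1
  have := congrArg (Polynomial.aeval y) hq
  rw [map_mul, minpoly.aeval, zero_mul, Polynomial.aeval_map_algebraMap] at this
  exact this

theorem IsNormBase.mono (hM : IsNormBase M) (h : M ≤ N) : IsNormBase N :=
  ⟨fun x => isAlgebraic_mono h (hM.isAlgebraic x), fun x y hxy =>
    hM.norm_eq x y (minpoly_eq_of_minpoly_eq h (hM.isAlgebraic x) hxy)⟩

theorem IsNormBase.norm_algEquiv (hM : IsNormBase M) (σ : Ω ≃ₐ[M] Ω) (x : Ω) : ‖σ x‖ = ‖x‖ :=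
  hM.norm_eq _ _ (minpoly.algEquiv_eq σ x)

end Discrete

/-! ### Coefficient fields -/

section CoefficientFields

/-- The powers below `p` of an element outside `M` with `p`-th power in `M` are independent. -/
theorem linearIndependent_pow_of_pow_mem {F : Type*} [Field F] {M : Subfield F} {p : ℕ}
    [Fact p.Prime] [CharP F p] {x : F} (hx : x ∉ M) (hxp : x ^ p ∈ M) :
    LinearIndependent M (fun i : Fin p => x ^ (i : ℕ)) := by
  have hirr : Irreducible (Polynomial.X ^ p - Polynomial.C (⟨x ^ p, hxp⟩ : M)) := by
    refine X_pow_sub_C_irreducible_of_prime Fact.out fun b hb => hx ?_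
    have h1 : (b : F) ^ p = x ^ p := congrArg Subtype.val hb
    have h2 : (b : F) = x := frobenius_inj F p h1
    rw [← h2]
    exact b.2
  have hmin := minpoly.eq_of_irreducible_of_monic hirr (x := x)
    (by simp [Subfield.algebraMap_ofSubfield])
    (Polynomial.monic_X_pow_sub_C _ (Fact.out : p.Prime).ne_zero)
  have hd : (minpoly M x).natDegree = p := by rw [← hmin, Polynomial.natDegree_X_pow_sub_C]
  have := linearIndependent_pow (K := M) x
  rwa [hd] at this

variable {Ω : Type*} [NormedField Ω] [IsUltrametricDist Ω]

/-- A maximal subfield of `D` among those with values in the `p`-th powers of the values of `D`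
has the same residue field as `D`. -/
theorem exists_subfield_pow_values (p : ℕ) [Fact p.Prime] [CharP Ω p] (D : Subfield Ω) : ∃ E ≤ D,
    (∀ y ∈ E, y ≠ 0 → ∃ x ∈ D, ‖y‖ = ‖x‖ ^ p) ∧ (∀ x ∈ D, ‖x‖ ≤ 1 → ∃ y ∈ E, ‖x - y‖ < 1) := by
  have hp : p.Prime := Fact.out
  let S : Set (Subfield Ω) := {E | E ≤ D ∧ (∀ x ∈ D, x ^ p ∈ E) ∧
    ∀ y ∈ E, y ≠ 0 → ∃ x ∈ D, ‖y‖ = ‖x‖ ^ p}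
  have h0 : D.map (frobenius Ω p) ∈ S := by
    refine ⟨?_, fun x hx => ⟨x, hx, rfl⟩, ?_⟩
    · rintro _ ⟨x, hx, rfl⟩
      exact D.pow_mem hx p
    · rintro _ ⟨x, hx, rfl⟩ -
      exact ⟨x, hx, by rw [frobenius_def, norm_pow]⟩
  obtain ⟨E, -, hE⟩ := zorn_le_nonempty₀ S (fun c hcS hc E0 hE0 => by
    refine ⟨sSup c, ⟨sSup_le fun E hE => (hcS hE).1, fun x hx =>
      (le_sSup hE0 : E0 ≤ sSup c) ((hcS hE0).2.1 x hx), ?_⟩, fun E hE => le_sSup hE⟩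
    intro y hy hy0
    rw [← SetLike.mem_coe, Subfield.coe_sSup_of_directedOn ⟨E0, hE0⟩ hc.directedOn] at hy
    obtain ⟨E, hE, hyE⟩ := Set.mem_iUnion₂.1 hy
    exact (hcS hE).2.2 y hyE hy0) _ h0
  obtain ⟨hED, hEp, hEv⟩ := hE.prop
  refine ⟨E, hED, hEv, fun x hx hx1 => ?_⟩
  rw [← res_mem_iff hx1]
  by_contra hres
  have : CharP (BigResidue Ω) p := charP_bigResidue p
  have hl := linearIndependent_pow_of_pow_mem (p := p) hres
    (by rw [← res_pow hx1]; exact res_mem (hEp x hx))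
  have hs : Spans E (adj E {x}) (fun i : Fin p => x ^ (i : ℕ)) := by
    have := spans_powers (Polynomial.X ^ p - Polynomial.C (⟨x ^ p, hEp x hx⟩ : E))
      (Polynomial.monic_X_pow_sub_C _ hp.ne_zero) (y := x)
      (by simp [Subfield.algebraMap_ofSubfield])
    rwa [Polynomial.natDegree_X_pow_sub_C] at this
  have hE' : adj E {x} ∈ S := by
    refine ⟨adj_le hED (by simpa using hx), fun y hy => le_adj _ _ (hEp y hy), ?_⟩
    intro y hy hy0
    obtain ⟨z, hz, hz0, hyz⟩ := exists_norm_eq (b := fun i : Fin p => x ^ (i : ℕ)) hs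
      (fun i => norm_pow_le_one hx1 _)
      (by simp only [res_pow hx1]; exact hl) hy hy0
    rw [hyz]
    exact hEv z hz hz0
  have hxE := hE.le_of_ge hE' (le_adj _ _) (subset_adj E {x} rfl)
  exact hres (res_mem hxE)

theorem isComplete_of_isClosed_subset {s t : Set Ω} (ht : IsComplete t) (hs : IsClosed s)
    (hst : s ⊆ t) : IsComplete s := by
  intro f hf hfs
  obtain ⟨x, -, hx⟩ := ht f hf (hfs.trans (Filter.principal_mono.2 hst))
  refine ⟨x, isClosed_iff_clusterPt.1 hs x ?_, hx⟩
  have := hf.1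
  exact Filter.neBot_of_le (le_inf hx hfs)

/-- A complete discretely valued field of characteristic `p` has a coefficient field.  There is a
decreasing sequence of subfields `D n` of `K` with the residue field of `K` and with values in the
`p ^ n`-th powers of the values of `K`.  An integral element of `D n` is determined by its residue
up to an error of norm at most `‖t‖ ^ p ^ n`, and the limits of such elements form the coefficient
field. -/
theorem exists_coefficientField (p : ℕ) [Fact p.Prime] [CharP Ω p]
    {K : Subfield Ω} (hK : IsComplete (K : Set Ω)) {t : Ω}
    (ht : IsUniformizer K t) : ∃ C ≤ K, (∀ c ∈ C, c ≠ 0 → ‖c‖ = 1) ∧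
      ∀ x ∈ K, ‖x‖ ≤ 1 → ∃ c ∈ C, ‖x - c‖ < 1 := by
  have hp1 : 1 < p := (Fact.out : p.Prime).one_lt
  choose next hnext_le hnext_val hnext_res using exists_subfield_pow_values (Ω := Ω) p
  let D : ℕ → Subfield Ω := fun n => next^[n] K
  have hDs : ∀ n, D (n + 1) = next (D n) := fun n => Function.iterate_succ_apply' next n K
  have hDK : ∀ n, D n ≤ K := by
    intro n
    induction n with
    | zero => exact le_rfl
    | succ n ih => rw [hDs]; exact (hnext_le _).trans ih
  have hDval : ∀ n, ∀ y ∈ D n, y ≠ 0 → ∃ x ∈ K, ‖y‖ = ‖x‖ ^ p ^ n := by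
    intro n
    induction n with
    | zero => exact fun y hy _ => ⟨y, hy, by simp⟩
    | succ n ih =>
      intro y hy hy0
      rw [hDs] at hy
      obtain ⟨x, hx, hyx⟩ := hnext_val _ y hy hy0
      have hx0 : x ≠ 0 := by
        rintro rfl
        rw [norm_zero, zero_pow (by omega), norm_eq_zero] at hyx
        exact hy0 hyx
      obtain ⟨z, hz, hxz⟩ := ih x hx hx0
      exact ⟨z, hz, by rw [hyx, hxz, ← pow_mul, pow_succ]⟩
  have hDsmall : ∀ n, ∀ y ∈ D n, ‖y‖ < 1 → ‖y‖ ≤ ‖t‖ ^ p ^ n := by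
    intro n y hy hy1
    by_cases hy0 : y = 0
    · rw [hy0, norm_zero]; exact pow_nonneg (norm_nonneg _) _
    obtain ⟨x, hx, hyx⟩ := hDval n y hy hy0
    rw [hyx] at hy1 ⊢
    refine pow_le_pow_left₀ (norm_nonneg _) (ht.le_of_lt_one hx ?_) _
    by_contra hge
    exact absurd hy1 (not_lt.2 (one_le_pow₀ (not_lt.1 hge)))
  have hDres : ∀ n, ∀ x ∈ K, ‖x‖ ≤ 1 → ∃ y ∈ D n, ‖x - y‖ < 1 := by
    intro n
    induction n with
    | zero => exact fun x hx _ => ⟨x, hx, by simp⟩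
    | succ n ih =>
      intro x hx hx1
      obtain ⟨y, hy, hxy⟩ := ih x hx hx1
      have hy1 : ‖y‖ ≤ 1 := by
        have : y = x - (x - y) := by ring
        rw [this]; exact norm_sub_le hx1 hxy.le
      obtain ⟨z, hz, hyz⟩ := hnext_res _ y hy hy1
      refine ⟨z, by rw [hDs]; exact hz, ?_⟩
      have : x - z = (x - y) + (y - z) := by ring
      rw [this]; exact norm_add_lt hxy hyz
  have htp : ∀ n, ‖t‖ ^ p ^ n ≤ ‖t‖ ^ n := fun n =>
    pow_le_pow_of_le_one ht.norm_pos.le ht.norm_lt.le (Nat.lt_pow_self hp1).le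
  have htlim : Filter.Tendsto (fun n => ‖t‖ ^ n) Filter.atTop (nhds 0) :=
    tendsto_pow_atTop_nhds_zero_of_lt_one ht.norm_pos.le ht.norm_lt
  have htp1 : ∀ n, ‖t‖ ^ p ^ n < 1 := fun n =>
    pow_lt_one₀ ht.norm_pos.le ht.norm_lt (pow_pos (by omega) n).ne'
  let Q : Ω → Prop := fun x => x ∈ K ∧ ∀ n, ∃ d ∈ D n, ‖d‖ ≤ 1 ∧ ‖x - d‖ ≤ ‖t‖ ^ p ^ n
  have hQ1 : ∀ x, Q x → ‖x‖ ≤ 1 := by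
    rintro x ⟨-, hx⟩
    obtain ⟨d, -, hd1, hd⟩ := hx 0
    have : x = (x - d) + d := by ring
    rw [this]
    exact norm_add_le_one (hd.trans (htp1 0).le) hd1
  have hQunit : ∀ x, Q x → x ≠ 0 → ‖x‖ = 1 := by
    intro x hx hx0
    by_contra hne
    have hlt := lt_of_le_of_ne (hQ1 x hx) hne
    have hle : ∀ n, ‖x‖ ≤ ‖t‖ ^ n := by
      intro n
      obtain ⟨d, hdD, hd1, hd⟩ := hx.2 n
      have hdlt : ‖d‖ < 1 := by
        have : d = x - (x - d) := by ring
        rw [this]; exact norm_sub_lt hlt (hd.trans_lt (htp1 n))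
      have : x = (x - d) + d := by ring
      rw [this]
      exact ((IsUltrametricDist.norm_add_le_max _ _).trans
        (max_le hd (hDsmall n d hdD hdlt))).trans (htp n)
    exact hx0 (norm_le_zero_iff.1 (ge_of_tendsto' htlim hle))
  -- the coefficient field: the elements approximated by `D n` up to `‖t‖ ^ p ^ n`, for all `n`
  let C : Subfield Ω :=
    { carrier := {x | Q x}
      zero_mem' := ⟨K.zero_mem, fun n => ⟨0, zero_mem _, by simp, by simp [ht.norm_pos.le]⟩⟩
      one_mem' := ⟨K.one_mem, fun n => ⟨1, one_mem _, by simp, by simp [ht.norm_pos.le]⟩⟩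
      add_mem' := by
        rintro x y ⟨hx, hx'⟩ ⟨hy, hy'⟩
        refine ⟨K.add_mem hx hy, fun n => ?_⟩
        obtain ⟨d, hd, hd1, hxd⟩ := hx' n
        obtain ⟨e, he, he1, hye⟩ := hy' n
        refine ⟨d + e, add_mem hd he, norm_add_le_one hd1 he1, ?_⟩
        have : x + y - (d + e) = (x - d) + (y - e) := by ring
        rw [this]
        exact (IsUltrametricDist.norm_add_le_max _ _).trans (max_le hxd hye)
      mul_mem' := by
        intro x y hx hy
        refine ⟨K.mul_mem hx.1 hy.1, fun n => ?_⟩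
        obtain ⟨d, hd, hd1, hxd⟩ := hx.2 n
        obtain ⟨e, he, he1, hye⟩ := hy.2 n
        refine ⟨d * e, mul_mem hd he, norm_mul_le_one hd1 he1, ?_⟩
        have : x * y - d * e = (x - d) * y + d * (y - e) := by ring
        rw [this]
        refine (IsUltrametricDist.norm_add_le_max _ _).trans (max_le ?_ ?_)
        · rw [norm_mul]
          exact (mul_le_of_le_one_right (norm_nonneg _) (hQ1 y hy)).trans hxd
        · rw [norm_mul]
          exact (mul_le_of_le_one_left (norm_nonneg _) hd1).trans hye
      neg_mem' := by
        rintro x ⟨hx, hx'⟩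
        refine ⟨K.neg_mem hx, fun n => ?_⟩
        obtain ⟨d, hd, hd1, hxd⟩ := hx' n
        refine ⟨-d, neg_mem hd, by rwa [norm_neg], ?_⟩
        have : -x - -d = -(x - d) := by ring
        rwa [this, norm_neg]
      inv_mem' := by
        intro x hx
        by_cases hx0 : x = 0
        · rw [hx0, inv_zero]
          exact ⟨K.zero_mem, fun n => ⟨0, zero_mem _, by simp, by simp [ht.norm_pos.le]⟩⟩
        refine ⟨K.inv_mem hx.1, fun n => ?_⟩
        obtain ⟨d, hd, -, hxd⟩ := hx.2 n
        have hx1 := hQunit x hx hx0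
        have hd1 : ‖d‖ = 1 := by
          rw [← hx1]
          exact norm_eq_of_norm_sub_lt (by rw [hx1]; exact hxd.trans_lt (htp1 n))
        have hd0 : d ≠ 0 := by
          rw [← norm_ne_zero_iff, hd1]; exact one_ne_zero
        refine ⟨d⁻¹, inv_mem hd, by rw [norm_inv, hd1, inv_one], ?_⟩
        have : x⁻¹ - d⁻¹ = -(x - d) / (x * d) := by field_simp; ring
        rw [this, norm_div, norm_neg, norm_mul, hx1, hd1, mul_one, div_one]
        exact hxd }
  refine ⟨C, fun x hx => hx.1, hQunit, fun x hx hx1 => ?_⟩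
  -- lifts of the residue of `x` to the fields `D n` converge
  choose d hdD hxd using fun n => hDres n x hx hx1
  have hd1 : ∀ n, ‖d n‖ ≤ 1 := fun n => by
    have : d n = x - (x - d n) := by ring
    rw [this]; exact norm_sub_le hx1 (hxd n).le
  have hDanti : ∀ n, D (n + 1) ≤ D n := fun n => by rw [hDs]; exact hnext_le _
  have hstep : ∀ n, ‖d (n + 1) - d n‖ ≤ ‖t‖ ^ p ^ n := by
    intro n
    refine hDsmall n _ (sub_mem (hDanti n (hdD _)) (hdD n)) ?_
    have : d (n + 1) - d n = (x - d n) - (x - d (n + 1)) := by ring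
    rw [this]; exact norm_sub_lt (hxd _) (hxd _)
  have hcau : CauchySeq d := by
    refine cauchySeq_of_le_geometric ‖t‖ 1 ht.norm_lt fun n => ?_
    rw [dist_comm, dist_eq_norm, one_mul]
    exact (hstep n).trans (htp n)
  obtain ⟨c, hcK, hc⟩ := cauchySeq_tendsto_of_isComplete hK (fun n => hDK n (hdD n)) hcau
  have hdiff : ∀ n k, ‖d (n + k) - d n‖ ≤ ‖t‖ ^ p ^ n := by
    intro n k
    induction k with
    | zero => simp [ht.norm_pos.le]
    | succ k ih =>
      have : d (n + (k + 1)) - d n = (d (n + k + 1) - d (n + k)) + (d (n + k) - d n) := by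
        rw [← add_assoc]; ring
      rw [this]
      refine (IsUltrametricDist.norm_add_le_max _ _).trans (max_le ((hstep _).trans ?_) ih)
      exact pow_le_pow_of_le_one ht.norm_pos.le ht.norm_lt.le
        (Nat.pow_le_pow_right (by omega) (by omega))
  have hcd : ∀ n, ‖c - d n‖ ≤ ‖t‖ ^ p ^ n := by
    intro n
    have h1 : Filter.Tendsto (fun k => ‖d (n + k) - d n‖) Filter.atTop (nhds ‖c - d n‖) := by
      refine (Filter.Tendsto.sub_const ?_ _).norm
      exact (Filter.tendsto_add_atTop_iff_nat n).2 hc |>.congr fun k => by rw [add_comm]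
    exact le_of_tendsto' h1 (hdiff n)
  refine ⟨c, ⟨hcK, fun n => ⟨d n, hdD n, hd1 n, hcd n⟩⟩, ?_⟩
  have : x - c = (x - d 0) - (c - d 0) := by ring
  rw [this]
  exact norm_sub_lt (hxd 0) ((hcd 0).trans_lt (htp1 0))

end CoefficientFields

/-! ### Fields of Laurent series -/

section Laurent

variable {Ω : Type*} [NormedField Ω] [IsUltrametricDist Ω] {C M N : Subfield Ω} {s t : Ω}

/-- The closure of `C(s)`.  If the norm is trivial on `C` and `0 < ‖s‖ < 1`, and if the closure
lies in a complete subfield, this is the field of Laurent series in `s` over `C`. -/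
def laurent (C : Subfield Ω) (s : Ω) : Subfield Ω := (adj C {s}).topologicalClosure

theorem le_laurent : C ≤ laurent C s := (le_adj _ _).trans (Subfield.le_topologicalClosure _)

theorem mem_laurent : s ∈ laurent C s :=
  Subfield.le_topologicalClosure _ (subset_adj C {s} rfl)

theorem laurent_le (hN : IsClosed (N : Set Ω)) (hC : C ≤ N) (hs : s ∈ N) : laurent C s ≤ N :=
  Subfield.topologicalClosure_minimal _ (adj_le hC (by simpa using hs)) hN

theorem laurent_isComplete (hN : IsComplete (N : Set Ω)) (hC : C ≤ N) (hs : s ∈ N) :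
    IsComplete (laurent C s : Set Ω) :=
  isComplete_of_isClosed_subset hN (Subfield.isClosed_topologicalClosure _)
    (laurent_le hN.isClosed hC hs)

theorem norm_aeval_le_one (hC : ∀ c ∈ C, c ≠ 0 → ‖c‖ = 1) (hs1 : ‖s‖ < 1)
    (q : Polynomial C) : ‖Polynomial.aeval s q‖ ≤ 1 := by
  rw [Polynomial.aeval_eq_sum_range]
  refine norm_sum_le_one _ fun i _ => ?_
  rw [Algebra.smul_def]
  refine norm_mul_le_one ?_ (norm_pow_le_one hs1.le _)
  by_cases h : (q.coeff i : Ω) = 0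
  · exact (congrArg norm h).le.trans (by simp)
  · exact (hC _ (q.coeff i).2 h).le

theorem exists_leading_term_aeval (hC : ∀ c ∈ C, c ≠ 0 → ‖c‖ = 1) (hs0 : s ≠ 0) (hs1 : ‖s‖ < 1)
    (d : ℕ) (q : Polynomial C) (hd : q.natDegree ≤ d) (hq : q ≠ 0) :
    ∃ n : ℕ, ∃ c ∈ C, c ≠ 0 ∧ ‖Polynomial.aeval s q - c * s ^ n‖ < ‖s‖ ^ n := by
  have hpos : 0 < ‖s‖ := norm_pos_iff.2 hs0
  have hdec : Polynomial.aeval s q = Polynomial.aeval s q.divX * s + (q.coeff 0 : Ω) := by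
    conv_lhs => rw [← Polynomial.divX_mul_X_add q]
    simp only [map_add, map_mul, Polynomial.aeval_X, Polynomial.aeval_C]
    rfl
  induction d generalizing q with
  | zero =>
    rw [Polynomial.eq_C_of_natDegree_le_zero hd] at hq ⊢
    refine ⟨0, (q.coeff 0 : Ω), (q.coeff 0).2, ?_, ?_⟩
    · intro h
      exact hq (by rw [Subtype.ext h (a2 := (0 : C)), Polynomial.C_0])
    · rw [Polynomial.aeval_C, pow_zero, pow_zero, mul_one]
      have : algebraMap C Ω (q.coeff 0) = (q.coeff 0 : Ω) := rfl
      rw [this, sub_self, norm_zero]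
      exact one_pos
  | succ d ih =>
    by_cases h0 : (q.coeff 0 : Ω) = 0
    · have hX : q.divX ≠ 0 := by
        intro hX
        have := Polynomial.divX_mul_X_add q
        rw [hX, Subtype.ext h0 (a2 := (0 : C)), Polynomial.C_0, zero_mul, zero_add] at this
        exact hq this.symm
      have hdX : q.divX.natDegree ≤ d := by
        rw [Polynomial.natDegree_divX_eq_natDegree_tsub_one]; omega
      have hdec' : Polynomial.aeval s q.divX = Polynomial.aeval s q.divX.divX * s +
          (q.divX.coeff 0 : Ω) := by
        conv_lhs => rw [← Polynomial.divX_mul_X_add q.divX]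
        simp only [map_add, map_mul, Polynomial.aeval_X, Polynomial.aeval_C]
        rfl
      obtain ⟨n, c, hc, hc0, h⟩ := ih q.divX hdX hX hdec'
      refine ⟨n + 1, c, hc, hc0, ?_⟩
      have : Polynomial.aeval s q - c * s ^ (n + 1) =
          (Polynomial.aeval s q.divX - c * s ^ n) * s := by rw [hdec, h0]; ring
      rw [this, norm_mul, pow_succ]
      exact mul_lt_mul_of_pos_right h hpos
    · refine ⟨0, _, (q.coeff 0).2, h0, ?_⟩
      rw [hdec, pow_zero, mul_one, add_sub_cancel_right, norm_mul, pow_zero]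
      exact (mul_le_of_le_one_left hpos.le (norm_aeval_le_one hC hs1 _)).trans_lt hs1

/-- Elements of the Laurent series field have a leading term. -/
theorem exists_leading_term (hC : ∀ c ∈ C, c ≠ 0 → ‖c‖ = 1) (hs0 : s ≠ 0) (hs1 : ‖s‖ < 1)
    {x : Ω} (hx : x ∈ laurent C s) (hx0 : x ≠ 0) :
    ∃ n : ℤ, ∃ c ∈ C, c ≠ 0 ∧ ‖x - c * s ^ n‖ < ‖s‖ ^ n := by
  have hpos : 0 < ‖s‖ := norm_pos_iff.2 hs0
  have key : ∀ y ∈ adj C {s}, y ≠ 0 → ∃ n : ℤ, ∃ c ∈ C, c ≠ 0 ∧ ‖y - c * s ^ n‖ < ‖s‖ ^ n := by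
    intro y hy hy0
    rw [mem_adj_iff, IntermediateField.mem_adjoin_simple_iff] at hy
    obtain ⟨f, g, rfl⟩ := hy
    have hf : f ≠ 0 := by rintro rfl; simp at hy0
    have hg : g ≠ 0 := by rintro rfl; simp at hy0
    obtain ⟨n, c, hc, hc0, hn⟩ := exists_leading_term_aeval hC hs0 hs1 _ f le_rfl hf
    obtain ⟨m, d, hd, hd0, hm⟩ := exists_leading_term_aeval hC hs0 hs1 _ g le_rfl hg
    set a := Polynomial.aeval s f
    set b := Polynomial.aeval s g
    have hb : ‖b‖ = ‖s‖ ^ m := by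
      have h1 : ‖d * s ^ m‖ = ‖s‖ ^ m := by rw [norm_mul, hC d hd hd0, one_mul, norm_pow]
      rw [← h1]
      refine norm_eq_of_norm_sub_lt ?_
      rw [h1, norm_sub_rev]; exact hm
    have hb0 : b ≠ 0 := by
      intro h
      exact hy0 (by rw [h, div_zero])
    refine ⟨n - m, c / d, C.div_mem hc hd, div_ne_zero hc0 hd0, ?_⟩
    rw [zpow_sub₀ hs0, zpow_sub₀ hpos.ne', zpow_natCast, zpow_natCast, zpow_natCast, zpow_natCast]
    have e : a / b - c / d * (s ^ n / s ^ m) =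
        ((a - c * s ^ n) * (d * s ^ m) - (c * s ^ n) * (b - d * s ^ m)) / (b * (d * s ^ m)) := by
      field_simp; ring
    have hdm : ‖d * s ^ m‖ = ‖s‖ ^ m := by rw [norm_mul, hC d hd hd0, one_mul, norm_pow]
    have hcn : ‖c * s ^ n‖ = ‖s‖ ^ n := by rw [norm_mul, hC c hc hc0, one_mul, norm_pow]
    rw [e, norm_div, norm_mul, hb, hdm, div_lt_iff₀ (by positivity)]
    have e2 : ‖s‖ ^ n / ‖s‖ ^ m * (‖s‖ ^ m * ‖s‖ ^ m) = ‖s‖ ^ n * ‖s‖ ^ m := by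
      field_simp
    rw [e2]
    refine norm_sub_lt ?_ ?_
    · rw [norm_mul, hdm]
      exact mul_lt_mul_of_pos_right hn (by positivity)
    · rw [norm_mul, hcn]
      exact mul_lt_mul_of_pos_left hm (by positivity)
  have hx' : x ∈ closure (adj C {s} : Set Ω) := hx
  obtain ⟨y, hy, hxy⟩ := Metric.mem_closure_iff.1 hx' ‖x‖ (norm_pos_iff.2 hx0)
  rw [dist_eq_norm] at hxy
  have hn := norm_eq_of_norm_sub_lt hxy
  have hy0 : y ≠ 0 := by
    rw [← norm_ne_zero_iff, hn, norm_ne_zero_iff]; exact hx0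
  obtain ⟨n, c, hc, hc0, h⟩ := key y hy hy0
  have hcn : ‖c * s ^ n‖ = ‖s‖ ^ n := by rw [norm_mul, hC c hc hc0, one_mul, norm_zpow]
  have hyn : ‖y‖ = ‖s‖ ^ n := by
    rw [← hcn]
    refine norm_eq_of_norm_sub_lt ?_
    rw [hcn, norm_sub_rev]; exact h
  refine ⟨n, c, hc, hc0, ?_⟩
  have : x - c * s ^ n = (x - y) + (y - c * s ^ n) := by ring
  rw [this]
  exact norm_add_lt (by rw [← hyn, hn]; exact hxy) h

theorem laurent_isUniformizer (hC : ∀ c ∈ C, c ≠ 0 → ‖c‖ = 1) (hs0 : s ≠ 0) (hs1 : ‖s‖ < 1) :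
    IsUniformizer (laurent C s) s := by
  refine ⟨mem_laurent, hs0, hs1, fun x hx hx0 => ?_⟩
  obtain ⟨n, c, hc, hc0, h⟩ := exists_leading_term hC hs0 hs1 hx hx0
  have hcn : ‖c * s ^ n‖ = ‖s‖ ^ n := by rw [norm_mul, hC c hc hc0, one_mul, norm_zpow]
  refine ⟨n, ?_⟩
  rw [← hcn]
  refine norm_eq_of_norm_sub_lt ?_
  rw [hcn, norm_sub_rev]; exact h

theorem laurent_residue (hC : ∀ c ∈ C, c ≠ 0 → ‖c‖ = 1) (hs0 : s ≠ 0) (hs1 : ‖s‖ < 1)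
    {x : Ω} (hx : x ∈ laurent C s) (hx1 : ‖x‖ ≤ 1) : ∃ c ∈ C, ‖x - c‖ < 1 := by
  by_cases hlt : ‖x‖ < 1
  · exact ⟨0, C.zero_mem, by rwa [sub_zero]⟩
  have hx1 : ‖x‖ = 1 := le_antisymm hx1 (not_lt.1 hlt)
  have hx0 : x ≠ 0 := by rw [← norm_ne_zero_iff, hx1]; exact one_ne_zero
  obtain ⟨n, c, hc, hc0, h⟩ := exists_leading_term hC hs0 hs1 hx hx0
  have hcn : ‖c * s ^ n‖ = ‖s‖ ^ n := by rw [norm_mul, hC c hc hc0, one_mul, norm_zpow]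
  have hxn : ‖x‖ = ‖s‖ ^ n := by
    rw [← hcn]
    refine norm_eq_of_norm_sub_lt ?_
    rw [hcn, norm_sub_rev]; exact h
  have hn : n = 0 := by
    rw [hx1] at hxn
    have := (laurent_isUniformizer hC hs0 hs1).zpow_inj (m := 0) (n := n)
    rw [zpow_zero] at this
    exact (this.1 hxn).symm
  rw [hn, zpow_zero, zpow_zero, mul_one] at h
  exact ⟨c, hc, h⟩

/-- Truncated expansions in a uniformizer with digits in a set of representatives. -/
theorem exists_expansion (ht : IsUniformizer N t) {S : Set Ω} (hSN : S ⊆ N)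
    (hS : ∀ x ∈ N, ‖x‖ ≤ 1 → ∃ c ∈ S, ‖x - c‖ < 1) (e : ℕ) {x : Ω} (hx : x ∈ N)
    (hx1 : ‖x‖ ≤ 1) :
    ∃ a : Fin e → Ω, (∀ i, a i ∈ S) ∧ ‖x - ∑ i, a i * t ^ (i : ℕ)‖ ≤ ‖t‖ ^ e := by
  induction e generalizing x with
  | zero => exact ⟨Fin.elim0, fun i => i.elim0, by simpa using hx1⟩
  | succ e ih =>
    obtain ⟨c, hc, hxc⟩ := hS x hx hx1
    have hle := ht.le_of_lt_one (N.sub_mem hx (hSN hc)) hxc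
    obtain ⟨a, ha, h⟩ := ih (x := (x - c) / t) (N.div_mem (N.sub_mem hx (hSN hc)) ht.mem)
      (by rw [norm_div]; exact (div_le_one ht.norm_pos).2 hle)
    refine ⟨Fin.cons c a, fun i => ?_, ?_⟩
    · refine Fin.cases ?_ (fun i => ?_) i
      · simpa using hc
      · simpa using ha i
    · rw [Fin.sum_univ_succ]
      simp only [Fin.cons_zero, Fin.cons_succ, Fin.val_zero, pow_zero, mul_one, Fin.val_succ]
      have : x - (c + ∑ i, a i * t ^ ((i : ℕ) + 1)) =
          t * ((x - c) / t - ∑ i, a i * t ^ (i : ℕ)) := by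
        rw [mul_sub, mul_div_cancel₀ _ ht.ne_zero, Finset.mul_sum, sub_sub]
        congr 2
        exact Finset.sum_congr rfl fun i _ => by ring
      rw [this, norm_mul, pow_succ']
      exact mul_le_mul_of_nonneg_left h (norm_nonneg _)

end Laurent

/-! ### Unramified elements -/

section Etale

open Polynomial

variable {Ω : Type*} [NormedField Ω] [IsUltrametricDist Ω] {E X N : Subfield Ω}

/-- The integral element `b` is a simple root, modulo the maximal ideal, of a polynomial with
integral coefficients in `E`: it generates an unramified extension of `E`. -/
def IsEtaleElement (E : Subfield Ω) (b : Ω) : Prop :=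
  ∃ (b' : bigRing Ω) (H : (bigRing Ω)[X]), (b' : Ω) = b ∧ (∀ i, (H.coeff i : Ω) ∈ E) ∧
    H.eval b' = 0 ∧ IsUnit (H.derivative.eval b')

theorem IsEtaleElement.mono {b : Ω} (hb : IsEtaleElement E b) (h : E ≤ X) :
    IsEtaleElement X b := by
  obtain ⟨b', H, h1, h2, h3⟩ := hb
  exact ⟨b', H, h1, fun i => h (h2 i), h3⟩

theorem IsEtaleElement.norm_le {b : Ω} (hb : IsEtaleElement E b) : ‖b‖ ≤ 1 := by
  obtain ⟨b', H, rfl, -⟩ := hb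
  exact mem_bigRing.1 b'.2

theorem isUnit_iff_norm {x : bigRing Ω} : IsUnit x ↔ ‖(x : Ω)‖ = 1 := by
  have h1 := mem_bigRing.1 x.2
  have h2 := res_eq_zero h1
  rw [res_coe, IsLocalRing.residue_eq_zero_iff, IsLocalRing.mem_maximalIdeal, mem_nonunits_iff]
    at h2
  constructor
  · intro h
    exact le_antisymm h1 (not_lt.1 fun h3 => (h2.2 h3) h)
  · intro h
    by_contra h3
    exact absurd (h2.1 h3) (by rw [h]; exact lt_irrefl _)

theorem coe_eval (H : (bigRing Ω)[X]) (b : bigRing Ω) : ((H.eval b : bigRing Ω) : Ω) =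
    ∑ i ∈ Finset.range (H.natDegree + 1), (H.coeff i : Ω) * (b : Ω) ^ i := by
  rw [eval_eq_sum_range]
  exact map_sum (bigRing Ω).subtype _ _

theorem coe_eval_mem {H : (bigRing Ω)[X]} (hH : ∀ i, (H.coeff i : Ω) ∈ E) {b : bigRing Ω}
    (hb : (b : Ω) ∈ E) : ((H.eval b : bigRing Ω) : Ω) ∈ E := by
  rw [coe_eval]
  exact E.sum_mem fun i _ => E.mul_mem (hH i) (E.pow_mem hb i)

theorem derivative_coeff_mem {H : (bigRing Ω)[X]} (hH : ∀ i, (H.coeff i : Ω) ∈ E) (i : ℕ) :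
    (H.derivative.coeff i : Ω) ∈ E := by
  rw [coeff_derivative]
  have : ((H.coeff (i + 1) * ((i : bigRing Ω) + 1) : bigRing Ω) : Ω) =
      (H.coeff (i + 1) : Ω) * ((i : Ω) + 1) := by
    push_cast
    rfl
  rw [this]
  exact E.mul_mem (hH _) (E.add_mem (natCast_mem E i) E.one_mem)

/-- A polynomial over the valuation ring with coefficients in `E`, as a polynomial over `E`. -/
theorem exists_polynomial_subfield {H : (bigRing Ω)[X]} (hH : ∀ i, (H.coeff i : Ω) ∈ E) :
    ∃ G : E[X], G.map E.subtype = H.map (bigRing Ω).subtype := by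
  have : H.map (bigRing Ω).subtype ∈ Polynomial.lifts E.subtype := by
    rw [Polynomial.lifts_iff_coeff_lifts]
    intro i
    rw [coeff_map]
    exact ⟨⟨_, hH i⟩, rfl⟩
  obtain ⟨G, hG⟩ := this
  exact ⟨G, hG⟩

theorem aeval_eq_of_map_eq {H : (bigRing Ω)[X]} {G : E[X]}
    (h : G.map E.subtype = H.map (bigRing Ω).subtype) (b : bigRing Ω) :
    aeval (b : Ω) G = ((H.eval b : bigRing Ω) : Ω) := by
  have h1 : aeval (b : Ω) G = (G.map E.subtype).eval (b : Ω) := by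
    rw [aeval_def, eval_map]; rfl
  rw [h1, h]
  exact eval_map_apply (bigRing Ω).subtype b

theorem sepOver_of_root {F : Type*} [Field F] {M : Subfield F} {b : F} (G : M[X])
    (h : aeval b G = 0) (h' : aeval b (derivative G) ≠ 0) : SepOver M b := by
  have hG : G ≠ 0 := by rintro rfl; simp at h'
  have hb : IsIntegral M b := IsAlgebraic.isIntegral ⟨G, hG, h⟩
  obtain ⟨q, hq⟩ := minpoly.dvd M b h
  refine (separable_iff_derivative_ne_zero (minpoly.irreducible hb)).2 fun h0 => h' ?_
  rw [hq, derivative_mul, h0]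
  simp

theorem IsEtaleElement.sepOver {b : Ω} (hb : IsEtaleElement E b) : SepOver E b := by
  obtain ⟨b', H, rfl, hH, h0, h1⟩ := hb
  obtain ⟨G, hG⟩ := exists_polynomial_subfield hH
  refine sepOver_of_root G (by rw [aeval_eq_of_map_eq hG, h0]; rfl) ?_
  have hG' : G.derivative.map E.subtype = H.derivative.map (bigRing Ω).subtype := by
    rw [← derivative_map, hG, derivative_map]
  rw [aeval_eq_of_map_eq hG', ← norm_ne_zero_iff, isUnit_iff_norm.1 h1]
  exact one_ne_zero

/-- The roots of `H` near a root `b` with `H' b` a unit are equal to `b`. -/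
theorem eq_of_root_of_norm_lt {H : (bigRing Ω)[X]} {b c : bigRing Ω} (hb : H.eval b = 0)
    (hb' : IsUnit (H.derivative.eval b)) (hc : H.eval c = 0) (h : ‖(c : Ω) - b‖ < 1) :
    c = b := by
  obtain ⟨k, hk⟩ := H.binomExpansion b (c - b)
  rw [add_sub_cancel, hc, hb, zero_add] at hk
  have h1 : (c - b) * (H.derivative.eval b + k * (c - b)) = 0 := by rw [hk]; ring
  rcases mul_eq_zero.1 h1 with h2 | h2
  · exact sub_eq_zero.1 h2
  exfalso
  have h3 : ((H.derivative.eval b : bigRing Ω) : Ω) = -((k : Ω) * ((c : Ω) - b)) := by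
    have := congrArg (fun z : bigRing Ω => (z : Ω)) (eq_neg_of_add_eq_zero_left h2)
    exact this
  have h4 := isUnit_iff_norm.1 hb'
  rw [h3, norm_neg, norm_mul] at h4
  have h5 : ‖(k : Ω)‖ * ‖(c : Ω) - b‖ ≤ ‖(c : Ω) - b‖ :=
    mul_le_of_le_one_left (norm_nonneg _) (mem_bigRing.1 k.2)
  linarith

/-- Hensel's lemma: an étale element close to an element of a closed subfield lies in it.  The
approximations are obtained by Newton's method with the fixed denominator `H' x`. -/
theorem IsEtaleElement.mem_of_isComplete {b x : Ω} (hb : IsEtaleElement E b) (hEN : E ≤ N)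
    (hN : IsClosed (N : Set Ω)) (hx : x ∈ N) (hbx : ‖b - x‖ < 1) : b ∈ N := by
  obtain ⟨b, H, rfl, hH, h0, h1⟩ := hb
  have hb1 := mem_bigRing.1 b.2
  have hx1 : ‖x‖ ≤ 1 := by
    have : x = (b : Ω) - (b - x) := by ring
    rw [this]; exact norm_sub_le hb1 hbx.le
  let x0 : bigRing Ω := ⟨x, mem_bigRing.2 hx1⟩
  set r : ℝ := ‖(b : Ω) - x‖ with hr
  have hr0 : 0 ≤ r := norm_nonneg _
  set d := H.derivative.eval x0 with hd
  have hdN : (d : Ω) ∈ N := coe_eval_mem (fun i => hEN (derivative_coeff_mem hH i)) hx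
  obtain ⟨q, hq⟩ := sub_dvd_eval_sub b x0 H.derivative
  have hdd : ‖((H.derivative.eval b : bigRing Ω) : Ω) - d‖ ≤ r := by
    have : ((H.derivative.eval b : bigRing Ω) : Ω) - d = ((b : Ω) - x) * q :=
      congrArg (fun z : bigRing Ω => (z : Ω)) hq
    rw [this, norm_mul]
    exact mul_le_of_le_one_right hr0 (mem_bigRing.1 q.2)
  have hb' := isUnit_iff_norm.1 h1
  have hd1 : ‖(d : Ω)‖ = 1 := by
    rw [← hb']
    exact norm_eq_of_norm_sub_lt (by rw [hb']; exact hdd.trans_lt hbx)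
  have hd0 : (d : Ω) ≠ 0 := by rw [← norm_ne_zero_iff, hd1]; exact one_ne_zero
  have key : ∀ n : ℕ, ∃ y : bigRing Ω, (y : Ω) ∈ N ∧ ‖(y : Ω) - b‖ ≤ r ^ (n + 1) := by
    intro n
    induction n with
    | zero => exact ⟨x0, hx, by rw [norm_sub_rev, zero_add, pow_one]⟩
    | succ n ih =>
      obtain ⟨y, hy, hyb⟩ := ih
      have hyr : ‖(y : Ω) - b‖ ≤ r :=
        hyb.trans (by rw [pow_succ]; exact mul_le_of_le_one_left hr0 (pow_le_one₀ hr0 hbx.le))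
      obtain ⟨k, hk⟩ := H.binomExpansion b (y - b)
      rw [add_sub_cancel, h0, zero_add] at hk
      have hk' : ((H.eval y : bigRing Ω) : Ω) =
          ((H.derivative.eval b : bigRing Ω) : Ω) * ((y : Ω) - b) + k * ((y : Ω) - b) ^ 2 :=
        congrArg (fun z : bigRing Ω => (z : Ω)) hk
      have hz1 : ‖(y : Ω) - (H.eval y : bigRing Ω) / d‖ ≤ 1 := by
        refine norm_sub_le (mem_bigRing.1 y.2) ?_
        rw [norm_div, hd1, div_one]
        exact mem_bigRing.1 (H.eval y).2
      refine ⟨⟨(y : Ω) - (H.eval y : bigRing Ω) / d, mem_bigRing.2 hz1⟩,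
        N.sub_mem hy (N.div_mem (coe_eval_mem (fun i => hEN (hH i)) hy) hdN), ?_⟩
      change ‖(y : Ω) - (H.eval y : bigRing Ω) / d - b‖ ≤ _
      have e : (y : Ω) - (H.eval y : bigRing Ω) / d - b = ((y : Ω) - b) *
          (-(((H.derivative.eval b : bigRing Ω) : Ω) - d + k * ((y : Ω) - b)) / d) := by
        rw [hk']
        field_simp
        ring
      rw [e, norm_mul, norm_div, hd1, div_one, norm_neg, pow_succ]
      refine mul_le_mul hyb ?_ (norm_nonneg _) (pow_nonneg hr0 _)
      refine (IsUltrametricDist.norm_add_le_max _ _).trans (max_le hdd ?_)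
      rw [norm_mul]
      exact (mul_le_of_le_one_left (norm_nonneg _) (mem_bigRing.1 k.2)).trans hyr
  have : (b : Ω) ∈ closure (N : Set Ω) := by
    rw [Metric.mem_closure_iff]
    intro ε hε
    have hlim := tendsto_pow_atTop_nhds_zero_of_lt_one hr0 hbx
    obtain ⟨n, hn⟩ := (hlim.eventually (gt_mem_nhds hε)).exists
    obtain ⟨y, hy, hyb⟩ := key n
    refine ⟨y, hy, ?_⟩
    rw [dist_eq_norm, norm_sub_rev]
    refine (hyb.trans ?_).trans_lt hn
    exact pow_le_pow_of_le_one hr0 hbx.le (Nat.le_succ n)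
  rwa [hN.closure_eq] at this

/-- Lifting of monic polynomials over the residue field. -/
theorem exists_lift_polynomial (g : (residueSubfield X)[X]) (hg : g.Monic) :
    ∃ G : (bigRing Ω)[X], G.Monic ∧ (∀ i, (G.coeff i : Ω) ∈ X) ∧
      G.map (IsLocalRing.residue (bigRing Ω)) = g.map (residueSubfield X).subtype := by
  choose h hX hres using fun c : residueSubfield X => c.2
  set d := g.natDegree with hd
  let G : (bigRing Ω)[X] := Polynomial.X ^ d +
    ∑ i ∈ Finset.range d, Polynomial.C (h (g.coeff i)) * Polynomial.X ^ i
  have hdeg : (∑ i ∈ Finset.range d, Polynomial.C (h (g.coeff i)) * Polynomial.X ^ i).degree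
      < (d : WithBot ℕ) := by
    refine (degree_sum_le _ _).trans_lt ?_
    refine (Finset.sup_lt_iff (WithBot.bot_lt_coe d)).2 fun i hi => ?_
    exact (degree_C_mul_X_pow_le _ _).trans_lt
      (by exact WithBot.coe_lt_coe.2 (Finset.mem_range.1 hi))
  refine ⟨G, monic_X_pow_add hdeg, fun i => ?_, ?_⟩
  · simp only [G, coeff_add, coeff_X_pow, finsetSum_coeff, coeff_C_mul]
    change (((if i = d then 1 else 0 : bigRing Ω) : Ω) +
      ((∑ x ∈ Finset.range d, h (g.coeff x) * if i = x then 1 else 0 : bigRing Ω) : Ω)) ∈ X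
    refine X.add_mem ?_ ?_
    · split_ifs
      · exact X.one_mem
      · exact X.zero_mem
    · have : ((∑ x ∈ Finset.range d, h (g.coeff x) * if i = x then 1 else 0 : bigRing Ω) : Ω)
          = ∑ x ∈ Finset.range d, ((h (g.coeff x) * if i = x then 1 else 0 : bigRing Ω) : Ω) :=
        map_sum (bigRing Ω).subtype _ _
      rw [this]
      refine X.sum_mem fun x _ => ?_
      split_ifs
      · rw [mul_one]; exact hX _
      · rw [mul_zero]; exact X.zero_mem
  · conv_rhs => rw [hg.as_sum]
    simp only [G, Polynomial.map_add, Polynomial.map_pow, map_X, Polynomial.map_sum,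
      Polynomial.map_mul, map_C]
    congr 1
    exact Finset.sum_congr rfl fun i _ => by rw [hres]; rfl

theorem res_eval_eq_zero_iff {G : (bigRing Ω)[X]} {g : (residueSubfield X)[X]}
    (hG : G.map (IsLocalRing.residue (bigRing Ω)) = g.map (residueSubfield X).subtype)
    (b : bigRing Ω) : ‖((G.eval b : bigRing Ω) : Ω)‖ < 1 ↔ aeval (res (b : Ω)) g = 0 := by
  rw [← res_eq_zero (mem_bigRing.1 (G.eval b).2), res_coe, res_coe]
  have h1 : aeval (IsLocalRing.residue (bigRing Ω) b) g =
      (g.map (residueSubfield X).subtype).eval (IsLocalRing.residue (bigRing Ω) b) := by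
    rw [aeval_def, eval_map]; rfl
  rw [h1, ← hG, eval_map_apply]

theorem IsEtaleElement.sepOver_res {b : Ω} (hb : IsEtaleElement E b) :
    SepOver (residueSubfield E) (res b) := by
  obtain ⟨b, H, rfl, hH, h0, h1⟩ := hb
  have : H.map (IsLocalRing.residue (bigRing Ω)) ∈
      Polynomial.lifts (residueSubfield E).subtype := by
    rw [Polynomial.lifts_iff_coeff_lifts]
    intro i
    rw [coeff_map]
    exact ⟨⟨_, ⟨H.coeff i, hH i, rfl⟩⟩, rfl⟩
  obtain ⟨g, hg⟩ := this
  have hg : H.map (IsLocalRing.residue (bigRing Ω)) = g.map (residueSubfield E).subtype := hg.symm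
  have hg' : H.derivative.map (IsLocalRing.residue (bigRing Ω)) =
      g.derivative.map (residueSubfield E).subtype := by
    rw [← derivative_map, hg, derivative_map]
  refine sepOver_of_root g ((res_eval_eq_zero_iff hg b).1 ?_) fun h =>
    lt_irrefl (1 : ℝ) ?_
  · rw [h0]; simp
  · have := (res_eval_eq_zero_iff hg' b).2 h
    rwa [isUnit_iff_norm.1 h1] at this

/-- Separable residues lift to étale elements. -/
theorem exists_isEtaleElement [IsAlgClosed Ω] {β : BigResidue Ω}
    (hβ : SepOver (residueSubfield E) β) : ∃ b, IsEtaleElement E b ∧ res b = β := by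
  obtain ⟨H, hHm, hHE, hH⟩ := exists_lift_polynomial _ (minpoly.monic hβ.isIntegral)
  obtain ⟨x, hx1, rfl⟩ := exists_res_eq β
  let x0 : bigRing Ω := ⟨x, mem_bigRing.2 hx1⟩
  have h0 : ‖((H.eval x0 : bigRing Ω) : Ω)‖ < 1 :=
    (res_eval_eq_zero_iff hH x0).2 (minpoly.aeval _ _)
  have hH' : H.derivative.map (IsLocalRing.residue (bigRing Ω)) =
      (minpoly (residueSubfield E) (res x)).derivative.map (residueSubfield E).subtype := by
    rw [← derivative_map, hH, derivative_map]
  obtain ⟨b, hbroot, hbx⟩ : ∃ b : Ω, (H.map (bigRing Ω).subtype).eval b = 0 ∧ ‖x - b‖ < 1 := by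
    by_contra hcon
    push Not at hcon
    have hm := hHm.map (bigRing Ω).subtype
    have hsp := IsAlgClosed.splits (H.map (bigRing Ω).subtype)
    have he : ((H.eval x0 : bigRing Ω) : Ω) = (H.map (bigRing Ω).subtype).eval x :=
      (eval_map_apply (bigRing Ω).subtype x0).symm
    rw [he, hsp.eval_eq_prod_roots, hm.leadingCoeff, one_mul] at h0
    have : ∀ s : Multiset Ω, (∀ r ∈ s, 1 ≤ ‖x - r‖) → 1 ≤ ‖(s.map (fun r => x - r)).prod‖ := by
      intro s
      induction s using Multiset.induction_on with
      | empty => intro _; simp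
      | cons r s ih =>
        intro h
        rw [Multiset.map_cons, Multiset.prod_cons, norm_mul]
        exact one_le_mul_of_one_le_of_one_le (h r (Multiset.mem_cons_self _ _))
          (ih fun y hy => h y (Multiset.mem_cons_of_mem hy))
    exact absurd h0 (not_lt.2 (this _ fun r hr => hcon r (isRoot_of_mem_roots hr)))
  have hb1 : ‖b‖ ≤ 1 := by
    have : b = x - (x - b) := by ring
    rw [this]; exact norm_sub_le hx1 hbx.le
  have hres : res x = res b := (res_eq_iff hx1 hb1).2 hbx
  let b0 : bigRing Ω := ⟨b, mem_bigRing.2 hb1⟩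
  refine ⟨b, ⟨b0, H, rfl, hHE, ?_, ?_⟩, hres.symm⟩
  · refine Subtype.ext ?_
    have : ((H.eval b0 : bigRing Ω) : Ω) = (H.map (bigRing Ω).subtype).eval b :=
      (eval_map_apply (bigRing Ω).subtype b0).symm
    rw [this, hbroot]; rfl
  · rw [isUnit_iff_norm]
    refine le_antisymm (mem_bigRing.1 (H.derivative.eval b0).2) (not_lt.1 fun hlt => ?_)
    have := (res_eval_eq_zero_iff hH' b0).1 hlt
    change aeval (res b) _ = 0 at this
    rw [← hres] at this
    exact Polynomial.Separable.aeval_derivative_ne_zero hβ (minpoly.aeval _ _) this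

/-- Conjugates over `X` have evaluations of equal norm. -/
theorem eval_algEquiv {H : (bigRing Ω)[X]} (hH : ∀ i, (H.coeff i : Ω) ∈ X) (σ : Ω ≃ₐ[X] Ω)
    {b c : bigRing Ω} (h : (c : Ω) = σ b) :
    ((H.eval c : bigRing Ω) : Ω) = σ (H.eval b : bigRing Ω) := by
  rw [coe_eval, coe_eval, map_sum]
  refine Finset.sum_congr rfl fun i _ => ?_
  rw [map_mul, map_pow, h]
  congr 1
  exact (σ.commutes ⟨_, hH i⟩).symm

theorem IsEtaleElement.algEquiv {b : Ω} (hb : IsEtaleElement E b) (hX : IsNormBase X)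
    (hEX : E ≤ X) (σ : Ω ≃ₐ[X] Ω) : IsEtaleElement E (σ b) := by
  obtain ⟨b, H, rfl, hH, h0, h1⟩ := hb
  let c : bigRing Ω := ⟨σ b, mem_bigRing.2 (by rw [hX.norm_algEquiv]; exact mem_bigRing.1 b.2)⟩
  refine ⟨c, H, rfl, hH, Subtype.ext ?_, ?_⟩
  · rw [eval_algEquiv (fun i => hEX (hH i)) σ (b := b) (c := c) rfl, h0]
    exact map_zero σ
  · rw [isUnit_iff_norm, eval_algEquiv (fun i => hEX (derivative_coeff_mem hH i)) σ
      (b := b) (c := c) rfl, hX.norm_algEquiv]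
    exact isUnit_iff_norm.1 h1

theorem exists_algEquiv_of_root [IsAlgClosed Ω] (hX : ∀ x : Ω, IsAlgebraic X x) {b c : Ω}
    (h : aeval c (minpoly X b) = 0) : ∃ σ : Ω ≃ₐ[X] Ω, σ b = c := by
  have : Algebra.IsAlgebraic X Ω := ⟨hX⟩
  have : IsAlgClosure X Ω := ⟨inferInstance, inferInstance⟩
  have : Normal X Ω := IsAlgClosure.normal X Ω
  have hconj : IsConjRoot X c b := by
    refine (isConjRoot_iff_aeval_eq_zero (hX b).isIntegral).2 ?_ |>.symm
    exact h
  exact isConjRoot_iff_exists_algEquiv.1 hconj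

/-- The degree of an étale element is at most the degree of its residue: its conjugates have
distinct residues, which are conjugate to each other. -/
theorem IsEtaleElement.natDegree_le [IsAlgClosed Ω] {b : Ω} (hb : IsEtaleElement X b)
    (hX : IsNormBase X) :
    (minpoly X b).natDegree ≤ (minpoly (residueSubfield X) (res b)).natDegree := by
  have hbsep := hb.sepOver
  have hsepres := hb.sepOver_res
  have hb1 := hb.norm_le
  set f := minpoly X b with hf
  set g := minpoly (residueSubfield X) (res b) with hg
  have hgm : g.Monic := minpoly.monic hsepres.isIntegral
  obtain ⟨G, -, hGX, hG⟩ := exists_lift_polynomial g hgm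
  obtain ⟨b', H, hb', hH, h0, h1⟩ := hb
  have hconj : ∀ c ∈ f.rootSet Ω, ∃ σ : Ω ≃ₐ[X] Ω, σ b = c := fun c hc =>
    exists_algEquiv_of_root hX.isAlgebraic (aeval_eq_zero_of_mem_rootSet hc)
  have hint : ∀ c ∈ f.rootSet Ω, ∃ c' : bigRing Ω, ∃ σ : Ω ≃ₐ[X] Ω, (c' : Ω) = c ∧
      (c' : Ω) = σ b' := by
    intro c hc
    obtain ⟨σ, rfl⟩ := hconj c hc
    exact ⟨⟨σ b, mem_bigRing.2 (by rwa [hX.norm_algEquiv])⟩, σ, rfl, by rw [hb']⟩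
  have hmaps : Set.MapsTo (res : Ω → BigResidue Ω) (f.rootSet Ω)
      (g.rootSet (BigResidue Ω)) := by
    intro c hc
    obtain ⟨c', σ, rfl, hσ⟩ := hint c hc
    refine (mem_rootSet_of_ne hgm.ne_zero).2 ((res_eval_eq_zero_iff hG c').1 ?_)
    rw [eval_algEquiv hGX σ hσ, hX.norm_algEquiv, res_eval_eq_zero_iff hG, hb']
    exact minpoly.aeval _ _
  have hinj : Set.InjOn (res : Ω → BigResidue Ω) (f.rootSet Ω) := by
    intro c hc d hd hcd
    obtain ⟨c', σ, rfl, hσ⟩ := hint c hc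
    obtain ⟨d', τ, rfl, hτ⟩ := hint d hd
    rw [res_eq_iff (mem_bigRing.1 c'.2) (mem_bigRing.1 d'.2)] at hcd
    refine congrArg Subtype.val (eq_of_root_of_norm_lt (H := H) (b := d') (c := c') ?_ ?_ ?_ hcd)
    · refine Subtype.ext ?_
      rw [eval_algEquiv hH τ hτ, h0]
      exact map_zero τ
    · rw [isUnit_iff_norm, eval_algEquiv (derivative_coeff_mem hH) τ hτ, hX.norm_algEquiv]
      exact isUnit_iff_norm.1 h1
    · refine Subtype.ext ?_
      rw [eval_algEquiv hH σ hσ, h0]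
      exact map_zero σ
  have hfcard : (f.rootSet Ω).ncard = f.natDegree := by
    rw [← Nat.card_coe_set_eq, Nat.card_eq_fintype_card,
      card_rootSet_eq_natDegree hbsep (IsAlgClosed.splits _)]
  have hgcard : (g.rootSet (BigResidue Ω)).ncard ≤ g.natDegree := by
    classical
    rw [rootSet, Set.ncard_coe_finset]
    exact (Multiset.toFinset_card_le _).trans ((card_roots' _).trans natDegree_map_le)
  rw [← hfcard]
  exact (Set.ncard_le_ncard_of_injOn _ hmaps hinj (rootSet_finite _ _)).trans hgcard

/-- An étale element generates a residual extension with separable residue extension. -/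
theorem IsEtaleElement.isResidual [IsAlgClosed Ω] {b : Ω} (hb : IsEtaleElement X b)
    (hX : IsNormBase X) : IsResidual X (adj X {b}) ∧
      ∀ y ∈ residueSubfield (adj X {b}), SepOver (residueSubfield X) y := by
  have hsepres := hb.sepOver_res
  have hb1 := hb.norm_le
  have hdeg := hb.natDegree_le hX
  obtain ⟨n, hn, hspan⟩ : ∃ n ≤ (minpoly (residueSubfield X) (res b)).natDegree,
      Spans X (adj X {b}) (fun i : Fin n => b ^ (i : ℕ)) :=
    ⟨_, hdeg, spans_powers _ (minpoly.monic hb.sepOver.isIntegral) (minpoly.aeval _ _)⟩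
  have hl : LinearIndependent (residueSubfield X) (fun i : Fin n => res (b ^ (i : ℕ))) := by
    have h1 : (fun i : Fin n => res (b ^ (i : ℕ))) =
        (fun i : Fin (minpoly (residueSubfield X) (res b)).natDegree => res b ^ (i : ℕ)) ∘
          Fin.castLE hn := funext fun i => res_pow hb1 _
    rw [h1]
    exact (linearIndependent_pow (K := residueSubfield X) (res b)).comp _
      (Fin.castLE_injective hn)
  refine ⟨isResidual_of_spans (le_adj _ _) hspan
    (fun i => (adj X {b}).pow_mem (subset_adj _ _ (Set.mem_singleton _)) _) hl, fun y hy => ?_⟩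
  have hle := (spans_residue hspan (fun i => norm_pow_le_one hb1 _) hl).le
    (le_adj (residueSubfield X) {res b}) fun i => by
      rw [res_pow hb1]
      exact Subfield.pow_mem _ (subset_adj _ _ (Set.mem_singleton _)) _
  exact sepOver_of_mem_adj (fun c hc => by rw [Set.mem_singleton_iff.1 hc]; exact hsepres)
    (hle hy)

/-- A finite set of étale elements generates a residual extension with separable residue
extension. -/
theorem isResidual_adj [IsAlgClosed Ω] (hX : IsNormBase X) (S : Finset Ω)
    (hS : ∀ b ∈ S, IsEtaleElement X b) : IsResidual X (adj X S) ∧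
      ∀ y ∈ residueSubfield (adj X S), SepOver (residueSubfield X) y := by
  classical
  induction S using Finset.induction_on with
  | empty =>
    have : adj X ((∅ : Finset Ω) : Set Ω) = X := adj_eq_self (by simp)
    rw [this]
    exact ⟨IsResidual.refl X, fun y hy => sepOver_of_mem hy⟩
  | insert b S hbS ih =>
    obtain ⟨h1, h2⟩ := ih fun c hc => hS c (Finset.mem_insert_of_mem hc)
    have hle := le_adj X (S : Set Ω)
    have heq : adj X ((insert b S : Finset Ω) : Set Ω) = adj (adj X S) {b} := by
      rw [adj_adj, Finset.coe_insert, Set.union_comm]; rfl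
    obtain ⟨h3, h4⟩ := ((hS b (Finset.mem_insert_self _ _)).mono hle).isResidual (hX.mono hle)
    rw [heq]
    exact ⟨h1.trans h3, fun y hy => sepOver_trans h2 (residueSubfield_mono hle) (h4 y hy)⟩

end Etale

/-! ### Largest perfect subfields -/

section PerfectCore

open Polynomial

variable {F : Type*} [Field F] {M N : Subfield F}

/-- The largest perfect subfield of `M`: the elements with `p ^ n`-th roots in `M` for all `n`. -/
def perfectCore (p : ℕ) [Fact p.Prime] [CharP F p] (M : Subfield F) : Subfield F where
  carrier := {x | ∀ n : ℕ, ∃ z ∈ M, z ^ p ^ n = x}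
  zero_mem' n := ⟨0, M.zero_mem, zero_pow (pow_pos (Fact.out : p.Prime).pos n).ne'⟩
  one_mem' n := ⟨1, M.one_mem, one_pow _⟩
  add_mem' := by
    intro x y hx hy n
    obtain ⟨a, ha, rfl⟩ := hx n
    obtain ⟨b, hb, rfl⟩ := hy n
    exact ⟨a + b, M.add_mem ha hb, add_pow_char_pow ..⟩
  mul_mem' := by
    intro x y hx hy n
    obtain ⟨a, ha, rfl⟩ := hx n
    obtain ⟨b, hb, rfl⟩ := hy n
    exact ⟨a * b, M.mul_mem ha hb, mul_pow _ _ _⟩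
  neg_mem' := by
    intro x hx n
    obtain ⟨a, ha, rfl⟩ := hx n
    refine ⟨-a, M.neg_mem ha, ?_⟩
    have h := add_pow_char_pow (p := p) (n := n) (-a) a
    rw [neg_add_cancel, zero_pow (pow_pos (Fact.out : p.Prime).pos n).ne'] at h
    exact eq_neg_of_add_eq_zero_left h.symm
  inv_mem' := by
    intro x hx n
    obtain ⟨a, ha, rfl⟩ := hx n
    exact ⟨a⁻¹, M.inv_mem ha, inv_pow _ _⟩

variable (p : ℕ) [Fact p.Prime] [CharP F p]

theorem perfectCore_le : perfectCore p M ≤ M := by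
  intro x hx
  obtain ⟨z, hz, rfl⟩ := hx 0
  exact M.pow_mem hz _

theorem pow_p_injective (n : ℕ) : Function.Injective (fun x : F => x ^ p ^ n) :=
  iterateFrobenius_inj F p n

theorem charP_subfield (M : Subfield F) : CharP M p :=
  (M.subtype.charP_iff M.subtype_injective p).2 inferInstance

/-- A root of `p`-th order in the perfect core lies in the perfect core. -/
theorem exists_root_perfectCore {x : F} (hx : x ∈ perfectCore p M) :
    ∃ z ∈ perfectCore p M, z ^ p = x := by
  obtain ⟨z, hz, hzx⟩ := hx 1
  rw [pow_one] at hzx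
  refine ⟨z, fun n => ?_, hzx⟩
  obtain ⟨y, hy, hyx⟩ := hx (n + 1)
  refine ⟨y, hy, ?_⟩
  have : (y ^ p ^ n) ^ p ^ 1 = z ^ p ^ 1 := by
    rw [← pow_mul, ← pow_add, hyx, pow_one, hzx]
  exact pow_p_injective p 1 this

theorem FiniteOver.natDegree_minpoly_le (h : FiniteOver M N) {x : F} (hx : x ∈ N) :
    (minpoly M x).natDegree ≤ M.relfinrank N := by
  have := h.card_le (b := fun i : Fin (minpoly M x).natDegree => x ^ (i : ℕ))
    (fun i => N.pow_mem hx _) (linearIndependent_pow x)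
  simpa using this

/-- The perfect core of a finite extension is algebraic over the perfect core: the minimal
polynomials of the iterated roots eventually have constant degree, and then their coefficients
are the iterated roots of the coefficients of the first one. -/
theorem isAlgebraic_perfectCore (h : FiniteOver M N) {x : F} (hx : x ∈ perfectCore p N) :
    IsAlgebraic (perfectCore p M) x := by
  have hp : p.Prime := Fact.out
  choose z hzN hzx using hx
  have hz : ∀ n, z (n + 1) ^ p = z n := fun n => pow_p_injective p n (by
    change (z (n + 1) ^ p) ^ p ^ n = z n ^ p ^ n
    rw [← pow_mul, ← pow_succ', hzx, hzx])
  have hint : ∀ n, IsIntegral M (z n) := fun n => (h.isAlgebraic (hzN n)).isIntegral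
  let g : ℕ → M[X] := fun n => (minpoly M (z (n + 1))).map (frobenius M p)
  have hgm : ∀ n, (g n).Monic := fun n => (minpoly.monic (hint _)).map _
  have hg0 : ∀ n, aeval (z n) (g n) = 0 := by
    intro n
    have h1 : expand M p (g n) = minpoly M (z (n + 1)) ^ p := by
      rw [← map_frobenius_expand]
      exact (map_expand ..).symm
    rw [← hz n, ← expand_aeval, h1, map_pow, minpoly.aeval, zero_pow hp.ne_zero]
  have hgd : ∀ n, (g n).natDegree = (minpoly M (z (n + 1))).natDegree := fun n =>
    (minpoly.monic (hint _)).natDegree_map _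
  have hdvd : ∀ n, minpoly M (z n) ∣ g n := fun n => minpoly.dvd M _ (hg0 n)
  let d : ℕ → ℕ := fun n => (minpoly M (z n)).natDegree
  have hmono : Monotone d := monotone_nat_of_le_succ fun n => by
    change (minpoly M (z n)).natDegree ≤ (minpoly M (z (n + 1))).natDegree
    rw [← hgd n]
    exact natDegree_le_of_dvd (hdvd n) (hgm n).ne_zero
  obtain ⟨n₀, hn₀⟩ : ∃ n₀, ∀ n, d n ≤ d n₀ := by
    have hb : BddAbove (Set.range d) :=
      ⟨M.relfinrank N, by rintro _ ⟨n, rfl⟩; exact h.natDegree_minpoly_le (hzN n)⟩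
    obtain ⟨n₀, hn₀⟩ := Nat.sSup_mem ⟨d 0, Set.mem_range_self 0⟩ hb
    exact ⟨n₀, fun n => by rw [hn₀]; exact le_csSup hb (Set.mem_range_self n)⟩
  have hgeq : ∀ n, n₀ ≤ n → g n = minpoly M (z n) := by
    intro n hn
    refine eq_of_monic_of_dvd_of_natDegree_le (minpoly.monic (hint _)) (hgm n) (hdvd n) ?_
    rw [hgd]
    exact (hn₀ (n + 1)).trans (hmono hn)
  have hcoeff : ∀ i m, (minpoly M (z n₀)).coeff i = (minpoly M (z (n₀ + m))).coeff i ^ p ^ m := by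
    intro i m
    induction m with
    | zero => simp
    | succ m ih =>
      have : (minpoly M (z (n₀ + m))).coeff i = (minpoly M (z (n₀ + (m + 1)))).coeff i ^ p := by
        rw [← hgeq (n₀ + m) (Nat.le_add_right _ _), coeff_map]
        rfl
      rw [ih, this, ← pow_mul, ← pow_succ']
  have hlift : (minpoly M (z n₀)).map M.subtype ∈ lifts (perfectCore p M).subtype := by
    rw [lifts_iff_coeff_lifts]
    intro i
    rw [coeff_map]
    refine ⟨⟨M.subtype ((minpoly M (z n₀)).coeff i), fun m => ?_⟩, rfl⟩
    refine ⟨_, ((minpoly M (z (n₀ + m))).coeff i).2, ?_⟩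
    rw [hcoeff i m]
    rfl
  obtain ⟨q, hq⟩ := hlift
  have hq : q.map (perfectCore p M).subtype = (minpoly M (z n₀)).map M.subtype := hq
  have hz0 : IsAlgebraic (perfectCore p M) (z n₀) := by
    refine ⟨q, ?_, ?_⟩
    · rintro rfl
      rw [Polynomial.map_zero] at hq
      exact ((minpoly.monic (hint n₀)).map M.subtype).ne_zero hq.symm
    · have h1 : aeval (z n₀) q = (q.map (perfectCore p M).subtype).eval (z n₀) := by
        rw [aeval_def, eval_map]; rfl
      rw [h1, hq, eval_map]
      exact minpoly.aeval M (z n₀)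
  rw [← hzx n₀]
  exact hz0.pow _

end PerfectCore

/-! ### Fields with constant uniformizers -/

section StandardFields

variable {Ω : Type*} [NormedField Ω] [IsUltrametricDist Ω] {κ A M N : Subfield Ω} {s : Ω}
variable (p : ℕ) [Fact p.Prime] [CharP Ω p]

theorem sub_pow_p (x y : Ω) (n : ℕ) : (x - y) ^ p ^ n = x ^ p ^ n - y ^ p ^ n :=
  sub_pow_char_pow ..

theorem sub_pow_p_one (x y : Ω) : (x - y) ^ p = x ^ p - y ^ p := by
  simpa using sub_pow_p p x y 1

theorem add_pow_p_one (x y : Ω) : (x + y) ^ p = x ^ p + y ^ p := add_pow_char ..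

theorem norm_lt_one_of_pow {x : Ω} {n : ℕ} (h : ‖x ^ n‖ < 1) : ‖x‖ < 1 := by
  rw [norm_pow] at h
  by_contra hge
  exact absurd h (not_lt.2 (one_le_pow₀ (not_lt.1 hge)))

theorem norm_le_one_of_sub {x y : Ω} (hx : ‖x‖ ≤ 1) (h : ‖x - y‖ < 1) : ‖y‖ ≤ 1 := by
  have : y = x - (x - y) := by ring
  rw [this]; exact norm_sub_le hx h.le

theorem norm_le_one_of_pow {x : Ω} {n : ℕ} (hn : n ≠ 0) (h : ‖x ^ n‖ ≤ 1) : ‖x‖ ≤ 1 := by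
  rw [norm_pow] at h
  exact (pow_le_one_iff_of_nonneg (norm_nonneg _) hn).1 h

/-- Existence of Teichmüller representatives.  If `y n` lifts the root `γ n` of order `p ^ n` of
`β`, then `y (n + m) ^ p ^ n` converges for `n → ∞` to a root of order `p ^ m` of the
representative. -/
theorem exists_teichmuller (hM : IsComplete (M : Set Ω)) (hs : IsUniformizer M s)
    {β : BigResidue Ω} (hβ : ∀ n : ℕ, ∃ γ ∈ residueSubfield M, γ ^ p ^ n = β) :
    ∃ f ∈ perfectCore p M, ‖f‖ ≤ 1 ∧ res f = β := by
  have hp : p.Prime := Fact.out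
  have : CharP (BigResidue Ω) p := charP_bigResidue p
  choose γ hγ hγβ using hβ
  choose y hyM hy1 hyγ using fun n => mem_residueSubfield.1 (hγ n)
  have hstep : ∀ n, ‖y (n + 1) ^ p - y n‖ ≤ ‖s‖ := by
    intro n
    refine hs.le_of_lt_one (M.sub_mem (M.pow_mem (hyM _) _) (hyM n)) ?_
    rw [← res_eq_iff (norm_pow_le_one (hy1 _) _) (hy1 _), res_pow (hy1 _), hyγ, hyγ]
    refine pow_p_injective p n ?_
    change (γ (n + 1) ^ p) ^ p ^ n = γ n ^ p ^ n
    rw [← pow_mul, ← pow_succ', hγβ, hγβ]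
  have hpn : ∀ n, n ≤ p ^ n := fun n => (Nat.lt_pow_self hp.one_lt).le
  have hcau : ∀ m, CauchySeq fun n => y (n + m) ^ p ^ n := by
    intro m
    refine cauchySeq_of_le_geometric ‖s‖ 1 hs.norm_lt fun n => ?_
    rw [dist_comm, dist_eq_norm, one_mul]
    have e : y (n + 1 + m) ^ p ^ (n + 1) - y (n + m) ^ p ^ n =
        (y (n + m + 1) ^ p - y (n + m)) ^ p ^ n := by
      rw [sub_pow_p, ← pow_mul, ← pow_succ', add_right_comm]
    rw [e, norm_pow]
    exact (pow_le_pow_left₀ (norm_nonneg _) (hstep _) _).trans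
      (pow_le_pow_of_le_one hs.norm_pos.le hs.norm_lt.le (hpn n))
  choose f hfM hf using fun m =>
    cauchySeq_tendsto_of_isComplete hM (fun n => M.pow_mem (hyM (n + m)) _) (hcau m)
  have hroot : ∀ m, f m ^ p ^ m = f 0 := by
    intro m
    have h1 := (hf m).pow (p ^ m)
    have h2 := (Filter.tendsto_add_atTop_iff_nat m).2 (hf 0)
    refine tendsto_nhds_unique h1 (h2.congr fun n => ?_)
    rw [add_zero, ← pow_mul, ← pow_add]
  have hclose : ∀ n, ‖y n ^ p ^ n - y 0‖ ≤ ‖s‖ := by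
    intro n
    induction n with
    | zero => simp [hs.norm_pos.le]
    | succ n ih =>
      have e : y (n + 1) ^ p ^ (n + 1) - y 0 =
          (y (n + 1) ^ p - y n) ^ p ^ n + (y n ^ p ^ n - y 0) := by
        rw [sub_pow_p, ← pow_mul, ← pow_succ']; ring
      rw [e]
      refine (IsUltrametricDist.norm_add_le_max _ _).trans (max_le ?_ ih)
      rw [norm_pow]
      refine (pow_le_of_le_one (norm_nonneg _) ((hstep n).trans hs.norm_lt.le)
        (pow_pos hp.pos n).ne').trans (hstep n)
  have hf0 : ‖f 0 - y 0‖ ≤ ‖s‖ := by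
    have h1 : Filter.Tendsto (fun n => ‖y (n + 0) ^ p ^ n - y 0‖) Filter.atTop
        (nhds ‖f 0 - y 0‖) := ((hf 0).sub_const _).norm
    exact le_of_tendsto' h1 hclose
  have hf1 : ‖f 0‖ ≤ 1 := by
    have : f 0 = (f 0 - y 0) + y 0 := by ring
    rw [this]
    exact norm_add_le_one (hf0.trans hs.norm_lt.le) (hy1 0)
  refine ⟨f 0, fun m => ⟨f m, hfM m, hroot m⟩, hf1, ?_⟩
  rw [(res_eq_iff hf1 (hy1 0)).2 (hf0.trans_lt hs.norm_lt), hyγ]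
  have := hγβ 0
  rwa [pow_zero, pow_one] at this

/-- A complete discretely valued field `M` which has a uniformizer and a largest perfect subfield
in the field `κ` of constants. -/
structure StdField (κ M : Subfield Ω) (s : Ω) : Prop where
  isComplete : IsComplete (M : Set Ω)
  isUniformizer : IsUniformizer M s
  mem : s ∈ κ
  core_le : perfectCore p M ≤ κ

/-- A field which contains the constants `κ`, whose residue field is separably closed up to
purely inseparable extensions, and which is a union of fields `StdField` over whose residue fields
its own residue field is separable. -/
structure IsConstantClosed (κ A : Subfield Ω) : Prop where
  le : κ ≤ A
  exists_pow_mem : ∀ y : BigResidue Ω, ∃ n : ℕ, y ^ p ^ n ∈ residueSubfield A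
  exists_stdField : ∀ T : Finset Ω, (T : Set Ω) ⊆ A → ∃ M s, StdField p κ M s ∧
    (T : Set Ω) ⊆ M ∧ M ≤ A ∧ ∀ y ∈ residueSubfield A, SepOver (residueSubfield M) y

variable {p}

theorem exists_pow_eq_of_isAlgClosed [IsAlgClosed κ] {x : Ω} (hx : x ∈ κ) {n : ℕ} (hn : 0 < n) :
    ∃ y ∈ κ, y ^ n = x := by
  obtain ⟨y, hy⟩ := IsAlgClosed.exists_pow_nat_eq (⟨x, hx⟩ : κ) hn
  exact ⟨y, y.2, congrArg Subtype.val hy⟩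

theorem mem_of_isAlgebraic_of_isAlgClosed [IsAlgClosed κ] {x : Ω} (hx : IsAlgebraic κ x) :
    x ∈ κ := by
  have h1 := IsAlgClosed.degree_eq_one_of_irreducible κ (minpoly.irreducible hx.isIntegral)
  obtain ⟨y, hy⟩ := minpoly.mem_range_of_degree_eq_one κ x h1
  rw [← hy]
  exact y.2

theorem exists_artinSchreier_of_isAlgClosed [IsAlgClosed κ] {x : Ω} (hx : x ∈ κ) :
    ∃ y ∈ κ, y ^ p - y = x := by
  have hp1 := (Fact.out : p.Prime).one_lt
  let f : Polynomial κ := Polynomial.X ^ p - (Polynomial.X + Polynomial.C ⟨x, hx⟩)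
  have hdeg : f.degree ≠ 0 := by
    have : f.degree = p := by
      have h1 : (Polynomial.X + Polynomial.C (⟨x, hx⟩ : κ)).degree <
          (Polynomial.X ^ p : Polynomial κ).degree := by
        rw [Polynomial.degree_X_add_C, Polynomial.degree_X_pow]
        exact_mod_cast hp1
      rw [Polynomial.degree_sub_eq_left_of_degree_lt h1, Polynomial.degree_X_pow]
    rw [this]
    exact_mod_cast (by omega : p ≠ 0)
  obtain ⟨y, hy⟩ := IsAlgClosed.exists_root f hdeg
  refine ⟨y, y.2, ?_⟩
  have h2 : y ^ p - (y + ⟨x, hx⟩) = 0 := by simpa [f, Polynomial.IsRoot] using hy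
  have h3 := congrArg Subtype.val h2
  change (y : Ω) ^ p - ((y : Ω) + x) = 0 at h3
  linear_combination h3

theorem pow_sub_mem {x : Ω} (h : x ^ p - x ∈ M) (n : ℕ) : x ^ p ^ n - x ∈ M := by
  induction n with
  | zero => simp
  | succ n ih =>
    have e : x ^ p ^ (n + 1) - x = (x ^ p ^ n - x) ^ p + (x ^ p - x) := by
      rw [sub_pow_p_one, ← pow_mul, ← pow_succ]; ring
    rw [e]
    exact M.add_mem (M.pow_mem ih p) h

theorem exists_pow_sub_eq_pow_sub {x : Ω} (hx : x ∈ A) (n : ℕ) :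
    ∃ z ∈ A, x ^ p ^ n - x = z ^ p - z := by
  induction n with
  | zero => exact ⟨0, A.zero_mem, by simp [(Fact.out : p.Prime).ne_zero]⟩
  | succ n ih =>
    obtain ⟨z, hz, h⟩ := ih
    refine ⟨z + x ^ p ^ n, A.add_mem hz (A.pow_mem hx _), ?_⟩
    rw [add_pow_p_one, ← pow_mul, ← pow_succ]
    linear_combination h

/-- By separability of the residue extension, `p`-power roots of residues of `M` which exist
in `A` exist in `M`. -/
theorem exists_mem_norm_sub_pow_lt (hsep : ∀ y ∈ residueSubfield A, SepOver (residueSubfield M) y)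
    {u w : Ω} (hu : u ∈ M) (hu1 : ‖u‖ ≤ 1) (hw : w ∈ A) {n : ℕ} (h : ‖u - w ^ p ^ n‖ < 1) :
    ∃ w' ∈ M, ‖w'‖ ≤ 1 ∧ ‖w - w'‖ < 1 ∧ ‖u - w' ^ p ^ n‖ < 1 := by
  have hpn : p ^ n ≠ 0 := (pow_pos (Fact.out : p.Prime).pos n).ne'
  have : CharP (BigResidue Ω) p := charP_bigResidue p
  have : ExpChar (BigResidue Ω) p := ExpChar.prime Fact.out
  have hw1 : ‖w‖ ≤ 1 := norm_le_one_of_pow hpn (norm_le_one_of_sub hu1 h)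
  have h1 : res w ∈ residueSubfield M := by
    refine mem_of_sepOver_of_pow_mem p (hsep _ (res_mem hw)) (n := n) ?_
    rw [← res_pow hw1, ← (res_eq_iff hu1 (norm_pow_le_one hw1 _)).2 h]
    exact res_mem hu
  obtain ⟨w', hw', hww⟩ := (res_mem_iff hw1).1 h1
  refine ⟨w', hw', norm_le_one_of_sub hw1 hww, hww, ?_⟩
  have e : u - w' ^ p ^ n = (u - w ^ p ^ n) + (w - w') ^ p ^ n := by rw [sub_pow_p]; ring
  rw [e]
  refine norm_add_lt h ?_
  rw [norm_pow]
  exact pow_lt_one₀ (norm_nonneg _) hww hpn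

theorem one_le_norm_sub_pow_of_norm_sub_lt {x y : Ω} (h : ∀ w ∈ A, 1 ≤ ‖x - w ^ p‖)
    (hxy : ‖x - y‖ < 1) : ∀ w ∈ A, 1 ≤ ‖y - w ^ p‖ := by
  intro w hw
  by_contra hlt
  refine absurd (h w hw) (not_le.2 ?_)
  have : x - w ^ p = (x - y) + (y - w ^ p) := by ring
  rw [this]
  exact norm_add_lt hxy (not_le.1 hlt)

end StandardFields

/-! ### Reduction of Artin-Schreier and radical equations -/

section Reduction

variable {Ω : Type*} [NormedField Ω] [IsUltrametricDist Ω] {κ A M N : Subfield Ω} {s : Ω}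
variable {p : ℕ} [Fact p.Prime] [CharP Ω p]

theorem IsUniformizer.norm_inv_gt (h : IsUniformizer M s) : 1 < ‖s⁻¹‖ := by
  rw [norm_inv]; exact (one_lt_inv₀ h.norm_pos).2 h.norm_lt

theorem IsUniformizer.le_inv_pow (h : IsUniformizer M s) {x : Ω} (hx : x ∈ M) {n : ℕ}
    (hn : ‖x‖ < ‖s⁻¹‖ ^ (n + 1)) : ‖x‖ ≤ ‖s⁻¹‖ ^ n := by
  have := h.le_zpow_succ hx (n := -((n : ℤ) + 1)) (by
    rw [zpow_neg, ← inv_zpow, ← norm_inv]; exact_mod_cast hn)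
  rw [show (-((n : ℤ) + 1) + 1) = -(n : ℤ) by ring, zpow_neg, ← inv_zpow, ← norm_inv] at this
  exact_mod_cast this

theorem IsUniformizer.exists_le_inv_pow (h : IsUniformizer M s) (x : Ω) :
    ∃ n : ℕ, ‖x‖ ≤ ‖s⁻¹‖ ^ n := by
  obtain ⟨n, hn⟩ := pow_unbounded_of_one_lt ‖x‖ h.norm_inv_gt
  exact ⟨n, hn.le⟩

/-- Reduction of Artin-Schreier equations: modulo `z ^ p - z`, an element of `A` is integral or has
a leading coefficient which is not a `p`-th power in the residue field.  The exact form of the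
norm, `‖s‖ ^ (-j / p ^ n)` with `n = 0` or `j` prime to `p`, keeps the leading terms that occur
for different pole orders `j` apart. -/
theorem exists_artinSchreier_reduction [IsAlgClosed κ] (hA : IsConstantClosed p κ A)
    (hM : StdField p κ M s) (hMA : M ≤ A)
    (hsep : ∀ y ∈ residueSubfield A, SepOver (residueSubfield M) y) (N : ℕ) :
    ∀ a ∈ M, ‖a‖ ≤ ‖s⁻¹‖ ^ N → ∃ z ∈ A, ‖a - (z ^ p - z)‖ ≤ 1 ∨
      ∃ (j n : ℕ) (σ : Ω), σ ∈ κ ∧ 1 ≤ j ∧ j ≤ N ∧ (n = 0 ∨ ¬ p ∣ j) ∧ σ ^ p ^ n = s⁻¹ ^ j ∧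
        ‖a - (z ^ p - z)‖ = ‖σ‖ ∧ ∀ w ∈ A, 1 ≤ ‖(a - (z ^ p - z)) / σ - w ^ p‖ := by
  have hp : p.Prime := Fact.out
  have hs := hM.isUniformizer
  have hS1 := hs.norm_inv_gt
  have hSM : s⁻¹ ∈ M := M.inv_mem hs.mem
  have hSκ : s⁻¹ ∈ κ := κ.inv_mem hM.mem
  have hS0 : s⁻¹ ≠ 0 := inv_ne_zero hs.ne_zero
  set S := s⁻¹
  have hz0 : (0 : Ω) ^ p - 0 = 0 := by rw [zero_pow hp.ne_zero, sub_zero]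
  induction N with
  | zero => exact fun a _ ha => ⟨0, A.zero_mem, Or.inl (by rw [hz0, sub_zero]; simpa using ha)⟩
  | succ N ih =>
    intro a ha haN
    -- the induction hypothesis, applied after the subtraction of `z ^ p - z`
    have step : ∀ z ∈ A, a - (z ^ p - z) ∈ M → ‖a - (z ^ p - z)‖ < ‖S‖ ^ (N + 1) → ∃ z ∈ A,
        ‖a - (z ^ p - z)‖ ≤ 1 ∨
        ∃ (j n : ℕ) (σ : Ω), σ ∈ κ ∧ 1 ≤ j ∧ j ≤ N + 1 ∧ (n = 0 ∨ ¬ p ∣ j) ∧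
          σ ^ p ^ n = S ^ j ∧ ‖a - (z ^ p - z)‖ = ‖σ‖ ∧
          ∀ w ∈ A, 1 ≤ ‖(a - (z ^ p - z)) / σ - w ^ p‖ := by
      intro z₀ hz₀ hmem hlt
      obtain ⟨z, hz, h⟩ := ih _ hmem (hs.le_inv_pow hmem hlt)
      have e : a - ((z₀ + z) ^ p - (z₀ + z)) = a - (z₀ ^ p - z₀) - (z ^ p - z) := by
        rw [add_pow_p_one]; ring
      refine ⟨z₀ + z, A.add_mem hz₀ hz, ?_⟩
      rw [e]
      rcases h with h | ⟨j, n, σ, h1, h2, h3, h4⟩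
      · exact Or.inl h
      · exact Or.inr ⟨j, n, σ, h1, h2, h3.trans (Nat.le_succ N), h4⟩
    by_cases hlt : ‖a‖ < ‖S‖ ^ (N + 1)
    · exact step 0 A.zero_mem (by rwa [hz0, sub_zero]) (by rwa [hz0, sub_zero])
    set J := N + 1 with hJ
    have hnorm : ‖a‖ = ‖S‖ ^ J := le_antisymm haN (not_lt.1 hlt)
    have hSJ : S ^ J ≠ 0 := pow_ne_zero _ hS0
    have hSJ1 : 1 < ‖S‖ ^ J := one_lt_pow₀ hS1 (by omega)
    obtain ⟨u, huM, hu1, hau⟩ : ∃ u ∈ M, ‖u‖ = 1 ∧ a = S ^ J * u := by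
      refine ⟨a / S ^ J, M.div_mem ha (M.pow_mem hSM _), ?_, (mul_div_cancel₀ _ hSJ).symm⟩
      rw [norm_div, norm_pow, hnorm, div_self (pow_pos (norm_pos_iff.2 hS0) _).ne']
    have hsmall : ∀ v, ‖u - v‖ < 1 → ‖S ^ J * u - S ^ J * v‖ < ‖S‖ ^ J := by
      intro v hv
      rw [← mul_sub, norm_mul, norm_pow]
      exact mul_lt_of_lt_one_right (by positivity) hv
    by_cases h : ∃ w ∈ A, ‖u - w ^ p‖ < 1
    swap
    · push Not at h
      refine ⟨0, A.zero_mem, Or.inr ⟨J, 0, S ^ J, κ.pow_mem hSκ _, by omega, le_rfl, Or.inl rfl,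
        by simp, by rw [hz0, sub_zero, hnorm, norm_pow], fun w hw => ?_⟩⟩
      rw [hz0, sub_zero, hau, mul_div_cancel_left₀ _ hSJ]
      exact h w hw
    obtain ⟨w₁, hw₁A, hw₁⟩ := h
    obtain ⟨w, hwM, hw1, -, hw⟩ := exists_mem_norm_sub_pow_lt (p := p) (n := 1) hsep huM hu1.le
      hw₁A (by rwa [pow_one])
    rw [pow_one] at hw
    by_cases hdvd : p ∣ J
    · -- a pole of order divisible by `p` whose leading coefficient is a `p`-th power
      obtain ⟨m, hm⟩ := hdvd
      have hzM : S ^ m * w ∈ M := M.mul_mem (M.pow_mem hSM _) hwM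
      have hzp : (S ^ m * w) ^ p = S ^ J * w ^ p := by rw [mul_pow, ← pow_mul, mul_comm m p, ← hm]
      refine step (S ^ m * w) (hMA hzM)
        (M.sub_mem ha (M.sub_mem (M.pow_mem hzM p) hzM)) ?_
      have e : a - ((S ^ m * w) ^ p - S ^ m * w) = (S ^ J * u - S ^ J * w ^ p) + S ^ m * w := by
        rw [hzp, hau]; ring
      rw [e]
      refine norm_add_lt (hsmall _ hw) ?_
      rw [norm_mul, norm_pow]
      refine (mul_le_of_le_one_right (by positivity) hw1).trans_lt (pow_lt_pow_right₀ hS1 ?_)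
      have := hp.two_le
      nlinarith
    by_cases hall : ∀ n : ℕ, ∃ w ∈ A, ‖u - w ^ p ^ n‖ < 1
    · -- the leading coefficient is constant
      obtain ⟨f, hf, hf1, hfu⟩ := exists_teichmuller p hM.isComplete hs (β := res u) fun n => by
        obtain ⟨w, hwA, hw⟩ := hall n
        obtain ⟨v, hvM, hv1, -, hv⟩ := exists_mem_norm_sub_pow_lt hsep huM hu1.le hwA hw
        exact ⟨res v, res_mem hvM, by
          rw [← res_pow hv1]
          exact ((res_eq_iff hu1.le (norm_pow_le_one hv1 _)).2 hv).symm⟩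
      obtain ⟨z, hz, hzf⟩ := exists_artinSchreier_of_isAlgClosed (p := p)
        (κ.mul_mem (κ.pow_mem hSκ J) (hM.core_le hf))
      refine step z (hA.le hz) ?_ ?_
      · rw [hzf]
        exact M.sub_mem ha (M.mul_mem (M.pow_mem hSM _) (perfectCore_le p hf))
      · rw [hzf, hau]
        exact hsmall f ((res_eq_iff hu1.le hf1).1 hfu.symm)
    push Not at hall
    classical
    have hmin := fun n => Nat.find_min (m := n) hall
    have hspec := Nat.find_spec hall
    -- the leading coefficient is a `p ^ n`-th power in the residue field for a largest `n`; the
    -- replacement of `(σ v) ^ p ^ n` by `σ v` changes `a` only by some `z ^ p - z`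
    set n₁ := Nat.find hall with hn₁
    have hn₁0 : n₁ ≠ 0 := by
      intro h0
      rw [h0] at hspec
      have := hspec u (hMA huM)
      simp only [pow_zero, pow_one, sub_self, norm_zero] at this
      exact absurd this (by norm_num)
    have hn₁1 : n₁ ≠ 1 := by
      intro h0
      rw [h0] at hspec
      exact absurd hw (not_lt.2 (by simpa using hspec w (hMA hwM)))
    obtain ⟨n, hn⟩ : ∃ n, n₁ = n + 1 := Nat.exists_eq_succ_of_ne_zero hn₁0
    have hmn := hmin n (by omega)
    push Not at hmn
    obtain ⟨v₁, hv₁A, hv₁⟩ := hmn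
    -- `v` is a `p ^ n`-th root of the leading coefficient without a further `p`-th root
    obtain ⟨v, hvM, hv1, -, hv⟩ := exists_mem_norm_sub_pow_lt hsep huM hu1.le hv₁A hv₁
    have hpn : p ^ n ≠ 0 := (pow_pos hp.pos n).ne'
    have hvroot : ∀ t ∈ A, 1 ≤ ‖v - t ^ p‖ := by
      intro t ht
      by_contra hlt
      refine absurd (hspec t ht) (not_le.2 ?_)
      have e : u - t ^ p ^ n₁ = (u - v ^ p ^ n) + (v - t ^ p) ^ p ^ n := by
        rw [sub_pow_p, ← pow_mul, ← pow_succ', hn]; ring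
      rw [e]
      refine norm_add_lt hv ?_
      rw [norm_pow]
      exact pow_lt_one₀ (norm_nonneg _) (not_le.1 hlt) hpn
    have hvn : ‖v‖ = 1 := by
      have := norm_eq_of_norm_sub_lt (by rwa [hu1] : ‖u - v ^ p ^ n‖ < ‖u‖)
      rw [hu1, norm_pow] at this
      exact (pow_eq_one_iff_of_nonneg (norm_nonneg _) hpn).1 this
    obtain ⟨σ, hσκ, hσ⟩ := exists_pow_eq_of_isAlgClosed (κ.pow_mem hSκ J) (n := p ^ n)
      (Nat.pos_of_ne_zero hpn)
    have hσ0 : σ ≠ 0 := by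
      rintro rfl
      rw [zero_pow hpn] at hσ
      exact hSJ hσ.symm
    have hσpos : 0 < ‖σ‖ := norm_pos_iff.2 hσ0
    have hσ1 : 1 < ‖σ‖ := by
      by_contra hle
      have h1 : ‖σ ^ p ^ n‖ ≤ 1 := norm_pow_le_one (not_lt.1 hle) _
      rw [hσ, norm_pow] at h1
      exact absurd hSJ1 (not_lt.2 h1)
    have hσvA : σ * v ∈ A := A.mul_mem (hA.le hσκ) (hMA hvM)
    obtain ⟨z₀, hz₀A, hz₀⟩ := exists_pow_sub_eq_pow_sub (p := p) hσvA n
    have hσv : (σ * v) ^ p ^ n = S ^ J * v ^ p ^ n := by rw [mul_pow, hσ]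
    have ha₁M : a - (σ * v) ^ p ^ n ∈ M := by
      rw [hσv]
      exact M.sub_mem ha (M.mul_mem (M.pow_mem hSM _) (M.pow_mem hvM _))
    obtain ⟨z₁, hz₁A, h₁⟩ := ih _ ha₁M (hs.le_inv_pow ha₁M (by
      rw [hσv, hau]; exact hsmall _ hv))
    set a' := a - (σ * v) ^ p ^ n - (z₁ ^ p - z₁) with ha'
    have e : a - ((z₀ + z₁) ^ p - (z₀ + z₁)) = σ * v + a' := by
      rw [ha', add_pow_p_one]
      linear_combination hz₀
    refine ⟨z₀ + z₁, A.add_mem hz₀A hz₁A, Or.inr ?_⟩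
    rw [e]
    have hσvn : ‖σ * v‖ = ‖σ‖ := by rw [norm_mul, hvn, mul_one]
    have main : ‖a'‖ < ‖σ‖ → ‖σ * v + a'‖ = ‖σ‖ ∧
        ∀ w ∈ A, 1 ≤ ‖(σ * v + a') / σ - w ^ p‖ := by
      intro hlt
      refine ⟨by rw [norm_add_eq_left (by rwa [hσvn]), hσvn],
        one_le_norm_sub_pow_of_norm_sub_lt hvroot ?_⟩
      have e2 : v - (σ * v + a') / σ = -(a' / σ) := by field_simp; ring
      rw [e2, norm_neg, norm_div]
      exact (div_lt_one hσpos).2 hlt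
    rcases h₁ with h₁ | ⟨j, m, τ, hτκ, hj1, hjN, hmj, hτ, hτn, hτw⟩
    · exact ⟨J, n, σ, hσκ, by omega, le_rfl, Or.inr hdvd, hσ, main (h₁.trans_lt hσ1)⟩
    rcases lt_trichotomy ‖a'‖ ‖σ‖ with hlt' | heq | hgt
    · exact ⟨J, n, σ, hσκ, by omega, le_rfl, Or.inr hdvd, hσ, main hlt'⟩
    · -- the exponents `J / p ^ n` and `j / p ^ m` are different
      exfalso
      have h1 : ‖S‖ ^ (J * p ^ m) = ‖S‖ ^ (j * p ^ n) := by
        have e1 : ‖S‖ ^ J = ‖σ‖ ^ p ^ n := by rw [← norm_pow, ← hσ, norm_pow]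
        have e2 : ‖S‖ ^ j = ‖τ‖ ^ p ^ m := by rw [← norm_pow, ← hτ, norm_pow]
        rw [pow_mul, pow_mul, e1, e2, ← heq, hτn, ← pow_mul, ← pow_mul, mul_comm]
      have h2 : J * p ^ m = j * p ^ n := pow_right_injective₀ (by positivity) hS1.ne' h1
      rcases le_total n m with hnm | hnm
      · obtain ⟨k, rfl⟩ := Nat.exists_eq_add_of_le hnm
        rw [pow_add, mul_comm (p ^ n), ← mul_assoc] at h2
        have h3 := Nat.eq_of_mul_eq_mul_right (Nat.pos_of_ne_zero hpn) h2
        have : 0 < p ^ k := pow_pos hp.pos k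
        nlinarith
      · obtain ⟨k, hk⟩ := Nat.exists_eq_add_of_le hnm
        rw [hk, pow_add, mul_comm (p ^ m), ← mul_assoc] at h2
        have h3 := Nat.eq_of_mul_eq_mul_right (pow_pos hp.pos m) h2
        rcases Nat.eq_zero_or_pos k with hk0 | hk0
        · rw [hk0, pow_zero, mul_one] at h3
          omega
        · exact hdvd (h3 ▸ (dvd_pow_self p hk0.ne').mul_left j)
    · have hτpos : 0 < ‖τ‖ := by rw [← hτn]; exact hσpos.trans hgt
      refine ⟨j, m, τ, hτκ, hj1, hjN.trans (Nat.le_succ N), hmj, hτ, ?_, ?_⟩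
      · rw [add_comm, norm_add_eq_left (by rwa [hσvn]), hτn]
      · refine one_le_norm_sub_pow_of_norm_sub_lt hτw ?_
        have e2 : a' / τ - (σ * v + a') / τ = -(σ * v / τ) := by field_simp; ring
        rw [e2, norm_neg, norm_div, hσvn]
        exact (div_lt_one hτpos).2 (by rwa [← hτn])

/-- An element `b` with `b ^ p - c * b = u` whose residue is a new `p`-th root generates a
residual extension. -/
theorem isResidual_adj_root {b c u : Ω} (hc : c ∈ M) (hu : u ∈ M) (hb : b ^ p - c * b = u)
    (hc1 : ‖c‖ < 1) (hu1 : ‖u‖ ≤ 1) (hroot : ∀ w ∈ M, 1 ≤ ‖u - w ^ p‖) :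
    ‖b‖ ≤ 1 ∧ Spans M (adj M {b}) (fun i : Fin p => b ^ (i : ℕ)) ∧
      LinearIndependent (residueSubfield M) (fun i : Fin p => res (b ^ (i : ℕ))) := by
  have hp : p.Prime := Fact.out
  have : CharP (BigResidue Ω) p := charP_bigResidue p
  have hb1 : ‖b‖ ≤ 1 := by
    by_contra hgt
    have hgt := not_le.1 hgt
    have h1 : ‖c * b‖ < ‖b ^ p‖ := by
      rw [norm_mul, norm_pow]
      calc ‖c‖ * ‖b‖ < 1 * ‖b‖ := mul_lt_mul_of_pos_right hc1 (by linarith)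
        _ = ‖b‖ ^ 1 := by rw [one_mul, pow_one]
        _ ≤ ‖b‖ ^ p := pow_le_pow_right₀ hgt.le hp.one_le
    have h2 : ‖u‖ = ‖b ^ p‖ := by
      rw [← hb, sub_eq_add_neg, norm_add_eq_left (by rwa [norm_neg])]
    rw [h2, norm_pow] at hu1
    exact absurd (one_lt_pow₀ hgt hp.ne_zero) (not_lt.2 hu1)
  have hcb : ‖b ^ p - u‖ < 1 := by
    have : b ^ p - u = c * b := by rw [← hb]; ring
    rw [this, norm_mul]
    exact mul_lt_one_of_nonneg_of_lt_one_left (norm_nonneg _) hc1 hb1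
  have hres : res b ^ p = res u := by
    rw [← res_pow hb1]
    exact (res_eq_iff (norm_pow_le_one hb1 _) hu1).2 hcb
  have hnot : res b ∉ residueSubfield M := by
    intro h
    obtain ⟨w, hw, hbw⟩ := (res_mem_iff hb1).1 h
    refine absurd (hroot w hw) (not_le.2 ?_)
    have e : u - w ^ p = (b - w) ^ p - (b ^ p - u) := by rw [sub_pow_p_one]; ring
    rw [e]
    refine norm_sub_lt ?_ hcb
    rw [norm_pow]
    exact pow_lt_one₀ (norm_nonneg _) hbw hp.ne_zero
  refine ⟨hb1, ?_, ?_⟩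
  · let f : Polynomial M := Polynomial.X ^ p +
      (-(Polynomial.C ⟨c, hc⟩ * Polynomial.X) - Polynomial.C ⟨u, hu⟩)
    have hdeg : (-(Polynomial.C (⟨c, hc⟩ : M) * Polynomial.X) - Polynomial.C (⟨u, hu⟩ : M)).degree
        < (p : WithBot ℕ) := by
      refine (Polynomial.degree_sub_le _ _).trans_lt (max_lt ?_ ?_)
      · rw [Polynomial.degree_neg]
        exact (Polynomial.degree_C_mul_X_le _).trans_lt (by exact_mod_cast hp.one_lt)
      · exact Polynomial.degree_C_le.trans_lt (by exact_mod_cast hp.pos)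
    have hm : f.Monic := Polynomial.monic_X_pow_add hdeg
    have hn : f.natDegree = p := by
      refine Polynomial.natDegree_eq_of_degree_eq_some ?_
      rw [Polynomial.degree_add_eq_left_of_degree_lt (by rwa [Polynomial.degree_X_pow]),
        Polynomial.degree_X_pow]
    have h0 : Polynomial.aeval b f = 0 := by
      simp only [f, map_add, map_sub, map_neg, map_mul, map_pow, Polynomial.aeval_X,
        Polynomial.aeval_C]
      change b ^ p + (-(c * b) - u) = 0
      rw [← hb]; ring
    have := spans_powers f hm h0
    rwa [hn] at this
  · simp only [res_pow hb1]
    refine linearIndependent_pow_of_pow_mem hnot ?_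
    rw [hres]
    exact res_mem hu

/-- The property `IsConstantClosed` is inherited by the extension generated by an element `b` with
`b ^ p - c * b = u`, if the residue of `u` is not a `p`-th power.  The fields which exhaust the
extension are generated by `b` over such fields for `A`. -/
theorem IsConstantClosed.adj_root [IsAlgClosed κ] (hA : IsConstantClosed p κ A) {b c u : Ω}
    (hc : c ∈ A) (hu : u ∈ A)
    (hb : b ^ p - c * b = u) (hc1 : ‖c‖ < 1) (hu1 : ‖u‖ ≤ 1)
    (hroot : ∀ w ∈ A, 1 ≤ ‖u - w ^ p‖) :
    IsResidual A (adj A {b}) ∧ IsConstantClosed p κ (adj A {b}) := by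
  classical
  obtain ⟨hb1, hspan, hl⟩ := isResidual_adj_root hc hu hb hc1 hu1 hroot
  have hbmem : b ∈ adj A {b} := subset_adj _ _ (Set.mem_singleton _)
  refine ⟨isResidual_of_spans (le_adj _ _) hspan (fun i => Subfield.pow_mem _ hbmem _) hl,
    hA.le.trans (le_adj _ _), fun y => ?_, fun T hT => ?_⟩
  · obtain ⟨n, hn⟩ := hA.exists_pow_mem y
    exact ⟨n, residueSubfield_mono (le_adj _ _) hn⟩
  have hle : adj A {b} ≤ adj ⊥ ((A : Set Ω) ∪ {b}) :=
    adj_le (fun x hx => subset_adj _ _ (Or.inl hx)) fun x hx => subset_adj _ _ (Or.inr hx)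
  obtain ⟨T₀, hT₀, hTT₀⟩ := exists_finset_subset_adj T (fun x hx => hle (hT hx))
  obtain ⟨M, s, hM, hTM, hMA, hsep⟩ := hA.exists_stdField
    (T₀.filter (· ∈ A) ∪ {c, u}) (by
      intro x hx
      simp only [Finset.coe_union, Set.mem_union, Finset.mem_coe, Finset.mem_filter,
        Finset.mem_insert, Finset.mem_singleton] at hx
      rcases hx with ⟨-, hx⟩ | rfl | rfl
      · exact hx
      · exact hc
      · exact hu)
  have hcM : c ∈ M := hTM (by simp)
  have huM : u ∈ M := hTM (by simp)
  obtain ⟨-, hspanM, hlM⟩ := isResidual_adj_root hcM huM hb hc1 hu1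
    fun w hw => hroot w (hMA hw)
  have hbM : b ∈ adj M {b} := subset_adj _ _ (Set.mem_singleton _)
  have hresM : IsResidual M (adj M {b}) := isResidual_of_spans (le_adj _ _) hspanM
    (fun i => Subfield.pow_mem _ hbM _) hlM
  refine ⟨adj M {b}, s, ⟨?_, ?_, hM.mem, ?_⟩, ?_, adj_mono hMA le_rfl, ?_⟩
  · exact hresM.1.isComplete hM.isComplete
      ⟨s, hM.isUniformizer.mem, hM.isUniformizer.ne_zero, hM.isUniformizer.norm_lt⟩
  · refine ⟨le_adj _ _ hM.isUniformizer.mem, hM.isUniformizer.ne_zero,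
      hM.isUniformizer.norm_lt, fun x hx hx0 => ?_⟩
    obtain ⟨y, hy, hy0, hxy⟩ := hresM.exists_norm_eq hx hx0
    rw [hxy]
    exact hM.isUniformizer.exists_zpow y hy hy0
  · intro x hx
    exact mem_of_isAlgebraic_of_isAlgClosed
      (isAlgebraic_mono hM.core_le (isAlgebraic_perfectCore p hresM.1 hx))
  · refine hTT₀.trans (adj_le bot_le fun x hx => ?_)
    rcases hT₀ hx with h | h
    · exact le_adj _ _ (hTM (by
        rw [Finset.coe_union]
        exact Or.inl (Finset.mem_filter.2 ⟨hx, h⟩)))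
    · rw [Set.mem_singleton_iff.1 h]
      exact hbM
  · intro y hy
    have h1 : residueSubfield (adj A {b}) ≤
        adj (residueSubfield (adj M {b})) (residueSubfield A) :=
      (spans_residue hspan (fun i => norm_pow_le_one hb1 _) hl).le
        (fun x hx => subset_adj _ _ hx)
        fun i => le_adj _ _ (res_mem (Subfield.pow_mem _ hbM _))
    exact sepOver_of_mem_adj (fun x hx => (hsep x hx).mono (residueSubfield_mono (le_adj _ _)))
      (h1 hy)

theorem adj_div_sub {y z ω : Ω} (hz : z ∈ A) (hω : ω ∈ A) (hω0 : ω ≠ 0) :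
    adj A {(y - z) / ω} = adj A {y} := by
  have hy : y ∈ adj A {y} := subset_adj _ _ (Set.mem_singleton _)
  have hb : (y - z) / ω ∈ adj A {(y - z) / ω} := subset_adj _ _ (Set.mem_singleton _)
  refine le_antisymm (adj_le (le_adj _ _) ?_) (adj_le (le_adj _ _) ?_)
  · rw [Set.singleton_subset_iff]
    exact Subfield.div_mem _ (Subfield.sub_mem _ hy (le_adj _ _ hz)) (le_adj _ _ hω)
  · rw [Set.singleton_subset_iff]
    have e : (y - z) / ω * ω + z = y := by field_simp; ring
    have := Subfield.add_mem _ (Subfield.mul_mem _ hb (le_adj _ _ hω)) (le_adj A _ hz)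
    rwa [e] at this

/-- An Artin-Schreier equation with integral right hand side has its solutions in `A`. -/
theorem IsConstantClosed.mem_of_norm_le_one (hA : IsConstantClosed p κ A) {b : Ω}
    (hb : b ^ p - b ∈ A) (hb1 : ‖b ^ p - b‖ ≤ 1) : b ∈ A := by
  have hp : p.Prime := Fact.out
  have hnb : ‖b‖ ≤ 1 := by
    by_contra hgt
    have hgt := not_le.1 hgt
    have h1 : ‖b‖ < ‖b ^ p‖ := by
      rw [norm_pow]
      exact lt_self_pow₀ hgt hp.one_lt
    have h2 : ‖b ^ p - b‖ = ‖b ^ p‖ := by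
      rw [sub_eq_add_neg, norm_add_eq_left (by rwa [norm_neg])]
    rw [h2] at hb1
    linarith
  obtain ⟨n, hn⟩ := hA.exists_pow_mem (res b)
  rw [← res_pow hnb, res_mem_iff (norm_pow_le_one hnb _)] at hn
  obtain ⟨w, hw, hbw⟩ := hn
  -- translation by an element of `A` gives a solution `d` with `‖d‖ < 1`, for which
  -- `d ^ p ^ n - d` tends to `-d`
  set v := w - (b ^ p ^ n - b) with hv
  have hvA : v ∈ A := A.sub_mem hw (pow_sub_mem hb n)
  have hbv : ‖b - v‖ < 1 := by
    have : b - v = b ^ p ^ n - w := by rw [hv]; ring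
    rwa [this]
  set d := b - v with hd
  have hdA : d ^ p - d ∈ A := by
    have : d ^ p - d = (b ^ p - b) - (v ^ p - v) := by rw [hd, sub_pow_p_one]; ring
    rw [this]
    exact A.sub_mem hb (A.sub_mem (A.pow_mem hvA p) hvA)
  obtain ⟨M, s, hM, hT, hMA, -⟩ := hA.exists_stdField {d ^ p - d} (by simpa using hdA)
  have hdM : d ^ p - d ∈ M := hT (by simp)
  have hlim : Filter.Tendsto (fun n => d ^ p ^ n - d) Filter.atTop (nhds (0 - d)) := by
    refine Filter.Tendsto.sub_const ?_ d
    refine squeeze_zero_norm (fun n => ?_)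
      (tendsto_pow_atTop_nhds_zero_of_lt_one (norm_nonneg d) hbv)
    rw [norm_pow]
    exact pow_le_pow_of_le_one (norm_nonneg _) hbv.le (Nat.lt_pow_self hp.one_lt).le
  have h0 := hM.isComplete.isClosed.mem_of_tendsto hlim
    (Filter.Eventually.of_forall fun n => pow_sub_mem hdM n)
  rw [zero_sub] at h0
  have h1 : d ∈ A := hMA (by simpa using M.neg_mem h0)
  have : b = d + v := by rw [hd]; ring
  rw [this]
  exact A.add_mem h1 hvA

/-- An Artin-Schreier extension is generated by `(y - z) / ω`, where `z` reduces the equation to one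
with a leading coefficient which is not a `p`-th power, and `ω` is a constant of the norm
of `y - z`. -/
theorem IsConstantClosed.adj_artinSchreier [IsAlgClosed κ] (hA : IsConstantClosed p κ A) {y : Ω}
    (hyA : y ∉ A) (hy : y ^ p - y ∈ A) :
    IsResidual A (adj A {y}) ∧ IsConstantClosed p κ (adj A {y}) := by
  have hp : p.Prime := Fact.out
  set a := y ^ p - y with ha
  obtain ⟨M, s, hM, hT, hMA, hsep⟩ := hA.exists_stdField {a} (by simpa using hy)
  have haM : a ∈ M := hT (by simp)
  obtain ⟨N, hN⟩ := hM.isUniformizer.exists_le_inv_pow a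
  obtain ⟨z, hz, h⟩ := exists_artinSchreier_reduction hA hM hMA hsep N a haM hN
  have hyz : (y - z) ^ p - (y - z) = a - (z ^ p - z) := by rw [sub_pow_p_one, ha]; ring
  have hzA : a - (z ^ p - z) ∈ A := A.sub_mem hy (A.sub_mem (A.pow_mem hz p) hz)
  rcases h with h | ⟨j, n, σ, hσκ, hj, -, -, hσ, hσn, hσw⟩
  · refine absurd ?_ hyA
    have h1 := hA.mem_of_norm_le_one (b := y - z) (by rwa [hyz]) (by rwa [hyz])
    have : y = (y - z) + z := by ring
    rw [this]
    exact A.add_mem h1 hz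
  obtain ⟨ω, hωκ, hω⟩ := exists_pow_eq_of_isAlgClosed hσκ hp.pos
  have hσ1 : 1 < ‖σ‖ := by
    by_contra hle
    have h1 : ‖σ ^ p ^ n‖ ≤ 1 := norm_pow_le_one (not_lt.1 hle) _
    rw [hσ, norm_pow] at h1
    exact absurd (one_lt_pow₀ hM.isUniformizer.norm_inv_gt (by omega)) (not_lt.2 h1)
  have hω1 : 1 < ‖ω‖ := by
    by_contra hle
    have h1 : ‖ω ^ p‖ ≤ 1 := norm_pow_le_one (not_lt.1 hle) _
    rw [hω] at h1
    linarith
  have hω0 : ω ≠ 0 := norm_pos_iff.1 (by linarith)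
  rw [← adj_div_sub hz (hA.le hωκ) hω0]
  refine hA.adj_root (c := ω / σ) (u := (a - (z ^ p - z)) / σ)
    (A.div_mem (hA.le hωκ) (hA.le hσκ)) (A.div_mem hzA (hA.le hσκ)) ?_ ?_ ?_ hσw
  · rw [← hyz, div_pow, hω]
    field_simp
  · rw [norm_div, div_lt_one (by linarith), ← hω, norm_pow]
    exact lt_self_pow₀ hω1 hp.one_lt
  · rw [norm_div, hσn, div_self (by linarith)]

/-- A purely inseparable extension of degree `p` is generated by `(y - z) / ω`, where `z` is an
approximation of `y` after which the leading coefficient of `y ^ p - z ^ p` is not a `p`-th power,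
and `ω` is a constant of the norm of `y - z`. -/
theorem IsConstantClosed.adj_pow [IsAlgClosed κ] (hA : IsConstantClosed p κ A) {y : Ω}
    (hyA : y ∉ A) (hy : y ^ p ∈ A) :
    IsResidual A (adj A {y}) ∧ IsConstantClosed p κ (adj A {y}) := by
  have hp : p.Prime := Fact.out
  obtain ⟨M, s, hM, hT, hMA, hsep⟩ := hA.exists_stdField {y ^ p} (by simpa using hy)
  have haM : y ^ p ∈ M := hT (by simp)
  have hs := hM.isUniformizer
  obtain ⟨r, hrκ, hr⟩ := exists_pow_eq_of_isAlgClosed hM.mem hp.pos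
  have hr0 : r ≠ 0 := by
    rintro rfl
    rw [zero_pow hp.ne_zero] at hr
    exact hs.ne_zero hr.symm
  have hrp : ∀ n : ℤ, (r ^ n) ^ p = s ^ n := fun n => by
    rw [← zpow_natCast, ← zpow_mul, mul_comm n, zpow_mul, zpow_natCast, hr]
  set Q := adj M {r} with hQ
  have hQA : Q ≤ A := adj_le hMA (by simpa using hA.le hrκ)
  have hrQ : r ∈ Q := subset_adj _ _ (Set.mem_singleton _)
  have hQc : IsComplete (Q : Set Ω) := by
    refine FiniteOver.isComplete (M := M) ?_ hM.isComplete ⟨s, hs.mem, hs.ne_zero, hs.norm_lt⟩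
    refine finiteOver_adj (Set.finite_singleton r) fun x hx => ?_
    rw [Set.mem_singleton_iff.1 hx]
    refine IsAlgebraic.of_pow hp.pos ?_
    rw [hr]
    exact isAlgebraic_algebraMap (⟨s, hs.mem⟩ : M)
  -- otherwise `y ^ p` would be a limit of `p`-th powers of elements of the complete field `Q`
  obtain ⟨z, hzQ, n, hn, hroot⟩ : ∃ z ∈ Q, ∃ n : ℤ, ‖y ^ p - z ^ p‖ = ‖s‖ ^ n ∧
      ∀ w ∈ A, 1 ≤ ‖(y ^ p - z ^ p) / s ^ n - w ^ p‖ := by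
    by_contra hcon
    push Not at hcon
    have key : ∀ k : ℕ, ∃ z ∈ Q, z ^ p ∈ M ∧ ‖y ^ p - z ^ p‖ ≤ ‖y ^ p‖ * ‖s‖ ^ k := by
      intro k
      induction k with
      | zero => exact ⟨0, Q.zero_mem, by rw [zero_pow hp.ne_zero]; exact M.zero_mem,
          by rw [zero_pow hp.ne_zero]; simp⟩
      | succ k ih =>
        obtain ⟨z, hz, hzM, h⟩ := ih
        have hdM : y ^ p - z ^ p ∈ M := M.sub_mem haM hzM
        by_cases hd0 : y ^ p - z ^ p = 0
        · exact ⟨z, hz, hzM, by rw [hd0, norm_zero]; positivity⟩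
        obtain ⟨n, hn⟩ := hs.exists_zpow _ hdM hd0
        obtain ⟨w, hwA, hw⟩ := hcon z hz n hn
        have hsn : s ^ n ≠ 0 := zpow_ne_zero _ hs.ne_zero
        have hu1 : ‖(y ^ p - z ^ p) / s ^ n‖ ≤ 1 := by
          rw [norm_div, norm_zpow, hn, div_self (zpow_ne_zero _ hs.norm_pos.ne')]
        obtain ⟨v, hvM, hv1, -, hv⟩ := exists_mem_norm_sub_pow_lt (p := p) (n := 1) hsep
          (M.div_mem hdM (M.zpow_mem hs.mem n)) hu1 hwA (by rwa [pow_one])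
        rw [pow_one] at hv
        have hpow : (r ^ n * v) ^ p = s ^ n * v ^ p := by
          rw [mul_pow, hrp]
        have hzv : (z + r ^ n * v) ^ p = z ^ p + s ^ n * v ^ p := by
          rw [add_pow_p_one, hpow]
        refine ⟨z + r ^ n * v, Q.add_mem hz (Q.mul_mem (Q.zpow_mem hrQ n) (le_adj _ _ hvM)), ?_, ?_⟩
        · rw [hzv]
          exact M.add_mem hzM (M.mul_mem (M.zpow_mem hs.mem n) (M.pow_mem hvM p))
        · have e : y ^ p - (z + r ^ n * v) ^ p =
              s ^ n * ((y ^ p - z ^ p) / s ^ n - v ^ p) := by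
            rw [hzv, mul_sub, mul_div_cancel₀ _ hsn]; ring
          have hvs := hs.le_of_lt_one (M.sub_mem (M.div_mem hdM (M.zpow_mem hs.mem n))
            (M.pow_mem hvM p)) hv
          rw [e, norm_mul, norm_zpow, ← hn, pow_succ, ← mul_assoc]
          exact mul_le_mul h hvs (norm_nonneg _) (by positivity)
    choose z hzQ hzM hz using key
    have hlim0 : Filter.Tendsto (fun k => ‖y ^ p‖ * ‖s‖ ^ k) Filter.atTop (nhds 0) := by
      have := (tendsto_pow_atTop_nhds_zero_of_lt_one hs.norm_pos.le hs.norm_lt).const_mul ‖y ^ p‖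
      rwa [mul_zero] at this
    have hlim : Filter.Tendsto z Filter.atTop (nhds y) := by
      rw [tendsto_iff_norm_sub_tendsto_zero]
      have h1 : Filter.Tendsto (fun k => ‖z k - y‖ ^ p) Filter.atTop (nhds 0) := by
        refine squeeze_zero (fun k => by positivity) (fun k => ?_) hlim0
        rw [← norm_pow, sub_pow_p_one, norm_sub_rev]
        exact hz k
      rw [Metric.tendsto_atTop] at h1 ⊢
      intro ε hε
      obtain ⟨k₀, hk₀⟩ := h1 (ε ^ p) (by positivity)
      refine ⟨k₀, fun k hk => ?_⟩
      have := hk₀ k hk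
      rw [dist_zero_right, Real.norm_of_nonneg (by positivity)] at this ⊢
      exact lt_of_pow_lt_pow_left₀ p hε.le this
    exact hyA (hQA (hQc.isClosed.mem_of_tendsto hlim (Filter.Eventually.of_forall hzQ)))
  have hrn : r ^ n ≠ 0 := zpow_ne_zero _ hr0
  have hzA := hQA hzQ
  rw [← adj_div_sub hzA (A.zpow_mem (hA.le hrκ) n) hrn]
  refine hA.adj_root (c := 0) (u := (y ^ p - z ^ p) / s ^ n) A.zero_mem
    (A.div_mem (A.sub_mem hy (A.pow_mem hzA p)) (A.zpow_mem (hMA hs.mem) n)) ?_ (by simp) ?_ hroot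
  · rw [zero_mul, sub_zero, div_pow, sub_pow_p_one, hrp]
  · rw [norm_div, norm_zpow, hn, div_self (zpow_ne_zero _ hs.norm_pos.ne')]

end Reduction

/-! ### Extensions of degree `p` inside normal extensions -/

section ArtinSchreierTheory

/-- A nontrivial Galois extension of `p`-power degree in characteristic `p` contains an
Artin-Schreier extension: for a nonzero character `χ` of the Galois group with values in the prime
field and an element `t` of trace `1`, take `y = - ∑ χ(σ) σ(t)`. -/
theorem exists_artinSchreier_of_isPGroup (p : ℕ) [Fact p.Prime] {F E : Type*} [Field F] [Field E]
    [Algebra F E] [FiniteDimensional F E] [IsGalois F E] [CharP E p]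
    (hG : IsPGroup p (E ≃ₐ[F] E)) (hne : Nontrivial (E ≃ₐ[F] E)) :
    ∃ y : E, y ∉ Set.range (algebraMap F E) ∧ y ^ p - y ∈ Set.range (algebraMap F E) := by
  have hp : p.Prime := Fact.out
  obtain ⟨n, hn0, hn⟩ := (hG.nontrivial_iff_card).1 hne
  obtain ⟨m, rfl⟩ : ∃ m, n = m + 1 := Nat.exists_eq_succ_of_ne_zero hn0.ne'
  obtain ⟨H, hH⟩ := Sylow.exists_subgroup_card_pow_prime (G := E ≃ₐ[F] E) p (n := m)
    (by rw [hn]; exact pow_dvd_pow p (Nat.le_succ m))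
  have hidx : H.index = p := by
    have := H.card_mul_index
    rw [hH, hn, pow_succ] at this
    exact Nat.eq_of_mul_eq_mul_left (pow_pos hp.pos m) this
  have hN : H.Normal := Subgroup.normal_of_index_eq_minFac_card (by
    rw [hidx, hn, Nat.Prime.pow_minFac hp (Nat.succ_ne_zero m)])
  have hcard : Nat.card ((E ≃ₐ[F] E) ⧸ H) = p := by rw [← Subgroup.index_eq_card, hidx]
  have hcard' : Nat.card (Multiplicative (ZMod p)) = p := by
    rw [Nat.card_congr Multiplicative.toAdd, Nat.card_zmod]
  let e := mulEquivOfPrimeCardEq hcard hcard'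
  let χ : (E ≃ₐ[F] E) → ZMod p := fun σ => Multiplicative.toAdd (e (QuotientGroup.mk' H σ))
  have hχ : ∀ σ τ, χ (σ * τ) = χ σ + χ τ := fun σ τ => by simp [χ]
  obtain ⟨τ, hτ⟩ : ∃ τ, χ τ ≠ 0 := by
    obtain ⟨q, hq⟩ := e.surjective (Multiplicative.ofAdd 1)
    obtain ⟨τ, rfl⟩ := QuotientGroup.mk'_surjective H q
    refine ⟨τ, ?_⟩
    change Multiplicative.toAdd (e (QuotientGroup.mk' H τ)) ≠ 0
    rw [hq]
    exact one_ne_zero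
  let ψ : (E ≃ₐ[F] E) → E := fun σ => ZMod.castHom (dvd_refl p) E (χ σ)
  have hψ : ∀ σ τ, ψ (σ * τ) = ψ σ + ψ τ := fun σ τ => by simp only [ψ, hχ, map_add]
  have hψp : ∀ σ, ψ σ ^ p = ψ σ := fun σ => by simp only [ψ, ← map_pow, ZMod.pow_card]
  have hψfix : ∀ σ (g : E ≃ₐ[F] E), g (ψ σ) = ψ σ := fun σ g => by
    simp only [ψ, ZMod.castHom_apply]
    rw [← ZMod.natCast_zmod_val (χ σ), ZMod.cast_natCast (dvd_refl p), map_natCast]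
  obtain ⟨t, ht⟩ := Algebra.trace_surjective F E 1
  have htr := trace_eq_sum_automorphisms (K := F) t
  rw [ht, map_one] at htr
  let y : E := -∑ σ : E ≃ₐ[F] E, ψ σ * σ t
  have hy : ∀ g : E ≃ₐ[F] E, g y = y + ψ g := by
    intro g
    have h1 : g y = -∑ σ : E ≃ₐ[F] E, ψ σ * (g * σ) t := by
      simp only [y, map_neg, map_sum, map_mul, hψfix, AlgEquiv.mul_apply]
    have h2 : ∑ σ : E ≃ₐ[F] E, ψ σ * (g * σ) t =
        ∑ σ : E ≃ₐ[F] E, (ψ σ - ψ g) * σ t := by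
      refine Fintype.sum_equiv (Equiv.mulLeft g) _ _ fun σ => ?_
      rw [Equiv.coe_mulLeft, hψ]
      ring
    rw [h1, h2]
    simp only [sub_mul, Finset.sum_sub_distrib, ← Finset.mul_sum, ← htr, y]
    ring
  refine ⟨y, ?_, ?_⟩
  · rintro ⟨x, hx⟩
    have h1 := hy τ
    rw [← hx, AlgEquiv.commutes] at h1
    have h2 : ψ τ = 0 := by linear_combination -h1
    exact hτ ((map_eq_zero (ZMod.castHom (dvd_refl p) E)).1 h2)
  · rw [IsGalois.mem_range_algebraMap_iff_fixed]
    intro g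
    rw [map_sub, map_pow, hy, add_pow_char, hψp]
    ring

variable {Ω : Type*} [Field Ω] {A N : Subfield Ω}

/-- The field `N` is stable under the automorphisms of `Ω` that fix `A`. -/
def IsStable (A N : Subfield Ω) : Prop :=
  ∀ σ : Ω ≃+* Ω, (∀ a ∈ A, σ a = a) → ∀ x ∈ N, σ x ∈ N

theorem IsStable.mono {A' : Subfield Ω} (h : IsStable A N) (hA : A ≤ A') : IsStable A' N :=
  fun σ hσ => h σ fun a ha => hσ a (hA ha)

theorem isStable_adj {S : Set Ω} (hS : ∀ σ : Ω ≃+* Ω, (∀ a ∈ A, σ a = a) → ∀ x ∈ S, σ x ∈ S) :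
    IsStable A (adj A S) := by
  intro σ hσ
  have : adj A S ≤ (adj A S).comap (σ : Ω →+* Ω) := by
    refine adj_le (fun a ha => ?_) fun x hx => subset_adj _ _ (hS σ hσ x hx)
    change σ a ∈ adj A S
    rw [hσ a ha]
    exact le_adj _ _ ha
  exact this

/-- A finite normal extension without subextensions of degree prime to `p` contains a root of an
equation `y ^ p = a` or `y ^ p - y = a`. -/
theorem exists_root_of_isStable (p : ℕ) [Fact p.Prime] [CharP Ω p] [IsAlgClosed Ω]
    (hal : ∀ x : Ω, IsAlgebraic A x) (hN : FiniteOver A N) (hst : IsStable A N) (hne : N ≠ A)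
    (hprime : ∀ x : Ω, ¬ p ∣ (minpoly A x).natDegree → x ∈ A) :
    ∃ y ∈ N, y ∉ A ∧ (y ^ p ∈ A ∨ y ^ p - y ∈ A) := by
  have hp : p.Prime := Fact.out
  have : Algebra.IsAlgebraic A Ω := ⟨hal⟩
  have : IsAlgClosure A Ω := ⟨inferInstance, inferInstance⟩
  have hfin := (finiteOver_iff hN.1).1 hN
  set N' := Subfield.extendScalars hN.1 with hN'
  have hN'n : Normal A N' := by
    rw [IntermediateField.normal_iff_forall_map_le']
    rintro σ _ ⟨x, hx, rfl⟩
    exact hst σ.toRingEquiv (fun a ha => σ.commutes ⟨a, ha⟩) x hx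
  have : CharP A p := charP_subfield p A
  have : ExpChar A p := ExpChar.prime hp
  have hle : A ≤ N := hN.1
  obtain ⟨x, hxN, hxA⟩ : ∃ x ∈ N, x ∉ A := by
    by_contra hcon
    push Not at hcon
    exact hne (le_antisymm hcon hle)
  -- a purely inseparable extension contains a `p`-th root; otherwise the maximal separable
  -- subextension is Galois, and its group is a `p`-group, since the fixed field of a Sylow subgroup
  -- contains only elements of degree prime to `p`
  by_cases hsep : separableClosure A N' = ⊥
  · have hpi := separableClosure.eq_bot_iff.1 hsep
    have hex : ∃ n, x ^ p ^ n ∈ A := by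
      obtain ⟨n, z, hz⟩ := (isPurelyInseparable_iff_pow_mem A p).1 hpi ⟨x, hxN⟩
      refine ⟨n, ?_⟩
      have : (z : Ω) = x ^ p ^ n := congrArg Subtype.val hz
      rw [← this]
      exact z.2
    classical
    have h1 := Nat.find_spec hex
    have h2 := fun m => Nat.find_min (m := m) hex
    set n := Nat.find hex
    have hn0 : n ≠ 0 := by
      intro h0
      rw [h0, pow_zero, pow_one] at h1
      exact hxA h1
    obtain ⟨m, hm⟩ := Nat.exists_eq_succ_of_ne_zero hn0
    refine ⟨x ^ p ^ m, N.pow_mem hxN _, h2 m (by omega), Or.inl ?_⟩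
    rw [← pow_mul, ← pow_succ]
    rw [hm] at h1
    exact h1
  · set F := separableClosure A N' with hF
    have hG : IsPGroup p (F ≃ₐ[A] F) := by
      obtain ⟨P⟩ : Nonempty (Sylow p (F ≃ₐ[A] F)) := inferInstance
      have hbot : IntermediateField.fixedField (P : Subgroup (F ≃ₐ[A] F)) = ⊥ := by
        rw [eq_bot_iff]
        intro z hz
        have hdvd : (minpoly A z).natDegree ∣ (P : Subgroup (F ≃ₐ[A] F)).index := by
          have h1 := IntermediateField.finrank_eq_fixingSubgroup_index F
            (IntermediateField.fixedField (P : Subgroup (F ≃ₐ[A] F)))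
          rw [IntermediateField.fixingSubgroup_fixedField] at h1
          rw [← h1]
          have h2 := minpoly.degree_dvd (K := A) (x := (⟨z, hz⟩ :
            IntermediateField.fixedField (P : Subgroup (F ≃ₐ[A] F))))
            (Algebra.IsIntegral.isIntegral _)
          rwa [← minpoly.algebraMap_eq (B' := F) Subtype.val_injective] at h2
        have hzA : ((z : N') : Ω) ∈ A := by
          refine hprime _ fun hpd => P.not_dvd_index (hpd.trans ?_)
          have h3 : minpoly A ((z : N') : Ω) = minpoly A z := by
            have e1 : minpoly A ((z : N') : Ω) = minpoly A (z : N') :=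
              minpoly.algebraMap_eq (A := A) (B := N') (B' := Ω) Subtype.val_injective _
            have e2 : minpoly A (z : N') = minpoly A z :=
              minpoly.algebraMap_eq (A := A) (B := F) (B' := N') Subtype.val_injective _
            rw [e1, e2]
          rw [h3]
          exact hdvd
        exact ⟨⟨_, hzA⟩, Subtype.ext (Subtype.ext rfl)⟩
      have htop : (P : Subgroup (F ≃ₐ[A] F)) = ⊤ := by
        rw [← IntermediateField.fixingSubgroup_fixedField (P : Subgroup (F ≃ₐ[A] F)), hbot,
          IntermediateField.fixingSubgroup_bot]
      have h4 := P.isPGroup'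
      rw [htop] at h4
      exact h4.of_equiv Subgroup.topEquiv
    have hnt : Nontrivial (F ≃ₐ[A] F) := by
      by_contra htriv
      rw [not_nontrivial_iff_subsingleton] at htriv
      apply hsep
      rw [eq_bot_iff]
      intro z hz
      obtain ⟨a, ha⟩ := (IsGalois.mem_range_algebraMap_iff_fixed (F := A) (⟨z, hz⟩ : F)).2
        fun f => by rw [Subsingleton.elim f 1]; rfl
      exact ⟨a, congrArg Subtype.val ha⟩
    have : CharP N' p := (N'.val.toRingHom.charP_iff N'.val.injective p).2 inferInstance
    have : CharP F p := (F.val.toRingHom.charP_iff F.val.injective p).2 inferInstance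
    obtain ⟨y, hy1, a, ha⟩ := exists_artinSchreier_of_isPGroup p hG hnt
    refine ⟨((y : N') : Ω), (y : N').2, fun h => hy1 ⟨⟨_, h⟩, Subtype.ext (Subtype.ext rfl)⟩,
      Or.inr ?_⟩
    have : ((y : N') : Ω) ^ p - ((y : N') : Ω) = a := by
      have := congrArg (fun z : F => ((z : N') : Ω)) ha
      exact this.symm
    rw [this]
    exact a.2

end ArtinSchreierTheory

/-! ### Degrees and residue degrees over constant-closed fields -/

section Defectless

variable {Ω : Type*} [NormedField Ω] [IsUltrametricDist Ω] {κ A N X : Subfield Ω}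
variable {p : ℕ} [Fact p.Prime] [CharP Ω p]

theorem norm_natCast_eq_one {d : ℕ} (hd : ¬ p ∣ d) : ‖(d : Ω)‖ = 1 := by
  have hd0 : (d : ZMod p) ≠ 0 := fun h => hd ((ZMod.natCast_eq_zero_iff d p).1 h)
  obtain ⟨e, he⟩ := ZMod.natCast_zmod_surjective (d : ZMod p)⁻¹
  have h1 : (d : Ω) * (e : Ω) = 1 := by
    have h2 : (d : ZMod p) * (e : ZMod p) = 1 := by rw [he, mul_inv_cancel₀ hd0]
    have := congrArg (ZMod.castHom (dvd_refl p) Ω) h2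
    simpa using this
  have h3 := congrArg norm h1
  rw [norm_mul, norm_one] at h3
  have h4 := IsUltrametricDist.norm_natCast_le_one Ω d
  have h5 := IsUltrametricDist.norm_natCast_le_one Ω e
  nlinarith [norm_nonneg (d : Ω), norm_nonneg (e : Ω)]

/-- Conjugates of an integral element with purely inseparable residue have the same residue. -/
theorem norm_algEquiv_sub_lt (hX : IsNormBase X) {u : Ω} (hu : ‖u‖ ≤ 1) {n : ℕ}
    (hres : res u ^ p ^ n ∈ residueSubfield X) (σ : Ω ≃ₐ[X] Ω) : ‖σ u - u‖ < 1 := by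
  rw [← res_pow hu, res_mem_iff (norm_pow_le_one hu _)] at hres
  obtain ⟨x, hx, h⟩ := hres
  refine norm_lt_one_of_pow (n := p ^ n) ?_
  have e : (σ u - u) ^ p ^ n = σ (u ^ p ^ n - x) - (u ^ p ^ n - x) := by
    rw [sub_pow_p, map_sub, map_pow, show σ x = x from σ.commutes ⟨x, hx⟩]
    ring
  rw [e]
  exact norm_sub_lt (by rwa [hX.norm_algEquiv]) h

theorem exists_algEquiv_of_mem_roots [IsAlgClosed Ω] (hX : IsNormBase X) {x r : Ω}
    (hr : r ∈ ((minpoly X x).map (algebraMap X Ω)).roots) : ∃ σ : Ω ≃ₐ[X] Ω, σ x = r := by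
  refine exists_algEquiv_of_root hX.isAlgebraic ?_
  have := Polynomial.isRoot_of_mem_roots hr
  rwa [Polynomial.IsRoot, Polynomial.eval_map] at this

theorem coeff_zero_minpoly [IsAlgClosed Ω] (hX : IsNormBase X) (x : Ω) :
    (((minpoly X x).coeff 0 : X) : Ω) = (-1) ^ (minpoly X x).natDegree *
      ((minpoly X x).map (algebraMap X Ω)).roots.prod := by
  have hm := (minpoly.monic (hX.isAlgebraic x).isIntegral).map (algebraMap X Ω)
  have h0 := (IsAlgClosed.splits
    ((minpoly X x).map (algebraMap X Ω))).coeff_zero_eq_leadingCoeff_mul_prod_roots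
  rw [Polynomial.coeff_map, hm.leadingCoeff, mul_one, Polynomial.natDegree_map] at h0
  exact h0

theorem norm_coeff_zero_minpoly [IsAlgClosed Ω] (hX : IsNormBase X) (x : Ω) :
    ‖(((minpoly X x).coeff 0 : X) : Ω)‖ = ‖x‖ ^ (minpoly X x).natDegree := by
  have hsp := IsAlgClosed.splits ((minpoly X x).map (algebraMap X Ω))
  have hprod : ∀ s : Multiset Ω, (∀ r ∈ s, ‖r‖ = ‖x‖) → ‖s.prod‖ = ‖x‖ ^ s.card := by
    intro s
    induction s using Multiset.induction_on with
    | empty => intro _; simp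
    | cons r s ih =>
      intro h
      rw [Multiset.prod_cons, norm_mul, h r (Multiset.mem_cons_self _ _),
        ih fun y hy => h y (Multiset.mem_cons_of_mem hy), Multiset.card_cons, pow_succ']
  rw [coeff_zero_minpoly hX, norm_mul, norm_pow, norm_neg, norm_one, one_pow, one_mul,
    hprod _ fun r hr => ?_, ← hsp.natDegree_eq_card_roots, Polynomial.natDegree_map]
  obtain ⟨σ, rfl⟩ := exists_algEquiv_of_mem_roots hX hr
  exact hX.norm_algEquiv σ x

/-- The values of `Ω` are values of constants. -/
theorem IsConstantClosed.exists_norm_eq [IsAlgClosed Ω] [IsAlgClosed κ]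
    (hA : IsConstantClosed p κ A) (hAn : IsNormBase A) {y : Ω} (hy : y ≠ 0) :
    ∃ c ∈ κ, ‖y‖ = ‖c‖ := by
  set f := minpoly A y with hf
  have hint := (hAn.isAlgebraic y).isIntegral
  have h1 : ‖((f.coeff 0 : A) : Ω)‖ = ‖y‖ ^ f.natDegree := norm_coeff_zero_minpoly hAn y
  have hdeg : 0 < f.natDegree := minpoly.natDegree_pos hint
  obtain ⟨M, s, hM, hT, -, -⟩ := hA.exists_stdField {((f.coeff 0 : A) : Ω)}
    (by simp)
  have hc0 : ((f.coeff 0 : A) : Ω) ≠ 0 := by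
    rw [← norm_ne_zero_iff, h1]
    exact pow_ne_zero _ (norm_ne_zero_iff.2 hy)
  obtain ⟨n, hn⟩ := hM.isUniformizer.exists_zpow _ (hT (by simp)) hc0
  obtain ⟨c, hc, hcs⟩ := exists_pow_eq_of_isAlgClosed (κ.zpow_mem hM.mem n) hdeg
  refine ⟨c, hc, ?_⟩
  refine (pow_left_inj₀ (norm_nonneg _) (norm_nonneg _) hdeg.ne').1 ?_
  rw [← h1, hn, ← norm_zpow, ← hcs, norm_pow]

/-- There are no extensions of degree prime to `p`: after a translation the trace of a generator
vanishes, but its conjugates have the same leading term. -/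
theorem IsConstantClosed.mem_of_not_dvd [IsAlgClosed Ω] [IsAlgClosed κ]
    (hA : IsConstantClosed p κ A) (hAn : IsNormBase A) {x : Ω}
    (hx : ¬ p ∣ (minpoly A x).natDegree) : x ∈ A := by
  set f := minpoly A x with hf
  set d := f.natDegree with hd
  have hint := (hAn.isAlgebraic x).isIntegral
  have hm := (minpoly.monic hint).map (algebraMap A Ω)
  have hsp := IsAlgClosed.splits (f.map (algebraMap A Ω))
  have hdn : ‖(d : Ω)‖ = 1 := norm_natCast_eq_one hx
  have hd0 : (d : Ω) ≠ 0 := by rw [← norm_ne_zero_iff, hdn]; exact one_ne_zero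
  set T := (f.map (algebraMap A Ω)).roots.sum with hT
  have hTA : T ∈ A := by
    have h1 := hsp.nextCoeff_eq_neg_sum_roots_of_monic hm
    rw [Polynomial.nextCoeff_map (algebraMap A Ω).injective] at h1
    have : T = -((f.nextCoeff : A) : Ω) := by rw [hT, eq_comm, neg_eq_iff_eq_neg]; exact h1
    rw [this]
    exact A.neg_mem f.nextCoeff.2
  set y := x - T / d with hy
  have hTd : T / (d : Ω) ∈ A := A.div_mem hTA (natCast_mem A d)
  by_contra hxA
  have hy0 : y ≠ 0 := by
    intro h0
    rw [hy, sub_eq_zero] at h0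
    exact hxA (h0 ▸ hTd)
  obtain ⟨c, hc, hyc⟩ := hA.exists_norm_eq hAn hy0
  have hcpos : 0 < ‖c‖ := by rw [← hyc]; exact norm_pos_iff.2 hy0
  have hc0 : c ≠ 0 := norm_pos_iff.1 hcpos
  have hu : ‖y / c‖ = 1 := by rw [norm_div, hyc, div_self hcpos.ne']
  obtain ⟨n, hn⟩ := hA.exists_pow_mem (res (y / c))
  have hconj : ∀ r ∈ (f.map (algebraMap A Ω)).roots, ‖r - x‖ < ‖y‖ := by
    intro r hr
    obtain ⟨σ, rfl⟩ := exists_algEquiv_of_mem_roots hAn hr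
    have h1 := norm_algEquiv_sub_lt hAn hu.le hn σ
    have h2 : σ c = c := σ.commutes ⟨c, hA.le hc⟩
    have h3 : σ (T / d) = T / d := σ.commutes ⟨_, hTd⟩
    have e : σ x - x = c * (σ (y / c) - y / c) := by
      rw [map_div₀, h2, hy, map_sub, h3]
      field_simp
      ring
    rw [e, norm_mul, hyc]
    exact mul_lt_of_lt_one_right hcpos h1
  have hsum : ∀ s : Multiset Ω, (∀ r ∈ s, ‖r - x‖ < ‖y‖) →
      ‖s.sum - (s.card : Ω) * x‖ < ‖y‖ := by
    intro s
    induction s using Multiset.induction_on with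
    | empty => intro _; simpa using hy0
    | cons r s ih =>
      intro h
      have e : (r ::ₘ s).sum - ((r ::ₘ s).card : Ω) * x =
          (r - x) + (s.sum - (s.card : Ω) * x) := by
        rw [Multiset.sum_cons, Multiset.card_cons]; push_cast; ring
      rw [e]
      exact norm_add_lt (h r (Multiset.mem_cons_self _ _))
        (ih fun y hy => h y (Multiset.mem_cons_of_mem hy))
  have h1 := hsum _ hconj
  rw [← hsp.natDegree_eq_card_roots, Polynomial.natDegree_map, ← hT, ← hd] at h1
  have e : T - (d : Ω) * x = -((d : Ω) * y) := by rw [hy]; field_simp; ring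
  rw [e, norm_neg, norm_mul, hdn, one_mul] at h1
  exact lt_irrefl _ h1

/-- For a normal extension, one adjoins successively roots of equations of degree `p`. -/
theorem IsConstantClosed.isResidual_of_isStable [IsAlgClosed Ω] [IsAlgClosed κ]
    (hA : IsConstantClosed p κ A) (hAn : IsNormBase A) (hN : FiniteOver A N)
    (hst : IsStable A N) : IsResidual A N := by
  obtain ⟨n, hn⟩ : ∃ n, A.relfinrank N = n := ⟨_, rfl⟩
  induction n using Nat.strong_induction_on generalizing A with
  | _ n ih =>
  by_cases hne : N = A
  · rw [hne]; exact IsResidual.refl A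
  obtain ⟨y, hyN, hyA, hy⟩ := exists_root_of_isStable p hAn.isAlgebraic hN hst hne
    fun x hx => hA.mem_of_not_dvd hAn hx
  have hle : adj A {y} ≤ N := adj_le hN.1 (by simpa using hyN)
  obtain ⟨h1, h2⟩ : IsResidual A (adj A {y}) ∧ IsConstantClosed p κ (adj A {y}) := by
    rcases hy with hy | hy
    · exact hA.adj_pow hyA hy
    · exact hA.adj_artinSchreier hyA hy
  have hN' := hN.le_top (le_adj A {y}) hle
  refine h1.trans (ih _ ?_ h2 (hAn.mono (le_adj _ _)) hN' (hst.mono (le_adj _ _)) rfl)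
  rw [← hn, ← Subfield.relfinrank_mul_relfinrank (le_adj A {y}) hle]
  have h3 : A.relfinrank (adj A {y}) ≠ 1 := fun h =>
    hyA ((Subfield.relfinrank_eq_one_iff.1 h) (subset_adj _ _ (Set.mem_singleton _)))
  have h4 := h1.1.2
  have h5 := Nat.pos_of_ne_zero hN'.2
  have h6 : 2 ≤ A.relfinrank (adj A {y}) := by omega
  nlinarith

/-- A finite extension of a field `IsConstantClosed` has the same degree as its residue
extension. -/
theorem IsConstantClosed.isResidual [IsAlgClosed Ω] [IsAlgClosed κ]
    (hA : IsConstantClosed p κ A) (hAn : IsNormBase A) (hN : FiniteOver A N) :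
    IsResidual A N := by
  obtain ⟨b, hbN, -, hspan⟩ := hN.exists_basis
  let S : Set Ω := ⋃ i, (minpoly A (b i)).rootSet Ω
  have hS : S.Finite := Set.finite_iUnion fun i => Polynomial.rootSet_finite _ _
  have hfin : FiniteOver A (adj A S) := finiteOver_adj hS fun x _ => hAn.isAlgebraic x
  have hle : N ≤ adj A S := hspan.le (le_adj _ _) fun i => subset_adj _ _
    (Set.mem_iUnion.2 ⟨i, (Polynomial.mem_rootSet_of_ne
      (minpoly.ne_zero (hAn.isAlgebraic _).isIntegral)).2 (minpoly.aeval _ _)⟩)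
  have hst : IsStable A (adj A S) := by
    refine isStable_adj fun σ hσ x hx => ?_
    obtain ⟨i, hi⟩ := Set.mem_iUnion.1 hx
    refine Set.mem_iUnion.2 ⟨i, ?_⟩
    have hne := minpoly.ne_zero (hAn.isAlgebraic (b i)).isIntegral
    rw [Polynomial.mem_rootSet_of_ne hne] at hi ⊢
    let τ : Ω ≃ₐ[A] Ω := AlgEquiv.ofRingEquiv (f := σ) fun a => hσ a a.2
    have : Polynomial.aeval (τ x) (minpoly A (b i)) = 0 := by
      rw [Polynomial.aeval_algHom_apply τ x, hi, map_zero]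
    exact this
  exact ((hA.isResidual_of_isStable hAn hfin hst).of_trans hN.1 hle).1

end Defectless

/-! ### Algebraic closures and perfect fields -/

section PerfectFields

variable {F : Type*} [Field F] {M N : Subfield F}

/-- Algebraic elements over a perfect field are separable. -/
theorem sepOver_of_perfect (p : ℕ) [Fact p.Prime] [CharP F p] (hM : ∀ y ∈ M, ∃ z ∈ M, z ^ p = y)
    {x : F} (hx : IsAlgebraic M x) : SepOver M x := by
  have := charP_subfield p M
  have : PerfectRing M p := PerfectRing.ofSurjective M p fun y => by
    obtain ⟨z, hz, h⟩ := hM y y.2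
    exact ⟨⟨z, hz⟩, Subtype.ext h⟩
  have : PerfectField M := PerfectRing.toPerfectField M p
  exact PerfectField.separable_of_irreducible (minpoly.irreducible hx.isIntegral)

/-- The field of elements which are algebraic over `M`. -/
def algClosure (M : Subfield F) : Subfield F := (algebraicClosure M F).toSubfield

theorem mem_algClosure {x : F} : x ∈ algClosure M ↔ IsAlgebraic M x :=
  mem_algebraicClosure_iff

theorem le_algClosure : M ≤ algClosure M := fun x hx =>
  mem_algClosure.2 (isAlgebraic_algebraMap (⟨x, hx⟩ : M))

instance [IsAlgClosed F] : IsAlgClosed (algClosure M) :=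
  IsAlgClosure.isAlgClosed (R := M) (K := algebraicClosure M F)

end PerfectFields

/-! ### Uniformizers and Laurent series inside the given field -/

section Setting

variable {Ω : Type*} [NormedField Ω] [IsUltrametricDist Ω] {K C E k M : Subfield Ω} {s t : Ω}

theorem mem_valueGroup_iff {u : NNRealˣ} :
    u ∈ MonoidWithZeroHom.valueGroup (.ofClass (val M)) ↔ ∃ x ∈ M, ‖x‖₊ = u := by
  have h := MonoidWithZeroHom.valueGroup_eq_range (f := .ofClass (val M))
  constructor
  · intro hu
    have h1 : (u : NNReal) ∈ Units.val '' (MonoidWithZeroHom.valueGroup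
      (.ofClass (val M)) : Set NNRealˣ) := ⟨u, hu, rfl⟩
    rw [h] at h1
    obtain ⟨⟨x, hx⟩, -⟩ := h1
    exact ⟨x, x.2, hx⟩
  · rintro ⟨x, hx, hxu⟩
    exact MonoidWithZeroHom.mem_valueGroup _ ⟨⟨x, hx⟩, hxu⟩

theorem exists_isUniformizer_of_isRankOneDiscrete (h : (val K).IsRankOneDiscrete) :
    ∃ t, IsUniformizer K t := by
  obtain ⟨γ, hγ, hγ1⟩ := h.exists_generator_lt_one'
  obtain ⟨t, ht, htγ⟩ := mem_valueGroup_iff.1 (hγ ▸ Subgroup.mem_zpowers γ)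
  refine ⟨t, ht, ?_, ?_, fun x hx hx0 => ?_⟩
  · rintro rfl
    exact γ.ne_zero (by rw [← htγ, nnnorm_zero])
  · rw [← coe_nnnorm, htγ]
    exact_mod_cast hγ1
  · have hu : Units.mk0 ‖x‖₊ (nnnorm_ne_zero_iff.2 hx0) ∈ Subgroup.zpowers γ := by
      rw [hγ]
      exact mem_valueGroup_iff.2 ⟨x, hx, rfl⟩
    obtain ⟨n, hn⟩ := Subgroup.mem_zpowers_iff.1 hu
    refine ⟨n, ?_⟩
    have h1 := congrArg (fun v : NNRealˣ => ((v : NNReal) : ℝ)) hn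
    simp only [Units.val_zpow_eq_zpow_val, Units.val_mk0, NNReal.coe_zpow, coe_nnnorm] at h1
    rw [← h1, ← htγ, coe_nnnorm]

theorem ramIndex_eq_one (h : ∀ x ∈ K, x ≠ 0 → ∃ y ∈ M, ‖x‖ = ‖y‖) : ramIndex M K = 1 := by
  refine Subgroup.relIndex_eq_one.2 fun u hu => ?_
  obtain ⟨x, hx, hxu⟩ := mem_valueGroup_iff.1 hu
  obtain ⟨y, hy, hxy⟩ := h x hx (by
    rintro rfl
    exact u.ne_zero (by rw [← hxu, nnnorm_zero]))
  exact mem_valueGroup_iff.2 ⟨y, hy, by rw [← hxu]; exact NNReal.eq hxy.symm⟩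

variable {p : ℕ} [Fact p.Prime] [CharP Ω p]

/-- In a discretely valued field one can extract `p`-th roots of a nonunit only finitely often. -/
theorem exists_pow_eq_of_isUniformizer (ht : IsUniformizer K t) {x : Ω} (hx : x ∈ K) (hx0 : x ≠ 0)
    (hx1 : ‖x‖ < 1) : ∃ y ∈ K, (∃ j : ℕ, y ^ p ^ j = x) ∧ ∀ z ∈ K, z ^ p ≠ y := by
  have hp : p.Prime := Fact.out
  obtain ⟨n, hn⟩ := ht.exists_zpow x hx hx0
  have hn0 : 0 < n := ht.zpow_lt_iff.1 (by rw [← hn, zpow_zero]; exact hx1)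
  lift n to ℕ using hn0.le
  induction n using Nat.strong_induction_on generalizing x with
  | _ n ih =>
    by_cases h : ∀ z ∈ K, z ^ p ≠ x
    · exact ⟨x, hx, ⟨0, by simp⟩, h⟩
    push Not at h
    obtain ⟨z, hz, rfl⟩ := h
    have hz0 : z ≠ 0 := fun h => hx0 (by rw [h, zero_pow hp.ne_zero])
    have hz1 : ‖z‖ < 1 := norm_lt_one_of_pow hx1
    obtain ⟨m, hm⟩ := ht.exists_zpow z hz hz0
    have hm0 : 0 < m := ht.zpow_lt_iff.1 (by rw [← hm, zpow_zero]; exact hz1)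
    lift m to ℕ using hm0.le
    have hmn : (m : ℤ) * p = n := ht.zpow_inj.1 (by
      rw [← hn, norm_pow, hm, zpow_mul, zpow_natCast _ p])
    obtain ⟨y, hy, ⟨j, hj⟩, h⟩ := ih m (by nlinarith [hp.two_le]) hz hz0 hz1 hm hm0
    exact ⟨y, hy, ⟨j + 1, by rw [pow_succ, pow_mul, hj]⟩, h⟩

/-- A coefficient field contains the largest perfect subfield. -/
theorem perfectCore_le_coefficientField (ht : IsUniformizer K t) (hCK : C ≤ K)
    (hC : ∀ c ∈ C, c ≠ 0 → ‖c‖ = 1) (hKC : ∀ x ∈ K, ‖x‖ ≤ 1 → ∃ c ∈ C, ‖x - c‖ < 1) :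
    perfectCore p K ≤ C := by
  have hp : p.Prime := Fact.out
  intro x hx
  by_cases hx0 : x = 0
  · rw [hx0]; exact C.zero_mem
  have hx1 : ‖x‖ = 1 := ht.norm_eq_one_of_roots hp.one_lt hx0 hx
  obtain ⟨c, hc, hxc⟩ := hKC x (perfectCore_le p hx) hx1.le
  have key : ∀ n : ℕ, ‖x - c‖ ≤ ‖t‖ ^ p ^ n := by
    intro n
    obtain ⟨z, hz, hzx⟩ := hx n
    have hz1 : ‖z‖ ≤ 1 := norm_le_one_of_pow (pow_pos hp.pos n).ne' (by rw [hzx]; exact hx1.le)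
    obtain ⟨d, hd, hzd⟩ := hKC z hz hz1
    have h1 := ht.le_of_lt_one (K.sub_mem hz (hCK hd)) hzd
    have h2 : ‖x - d ^ p ^ n‖ ≤ ‖t‖ ^ p ^ n := by
      rw [← hzx, ← sub_pow_p, norm_pow]
      exact pow_le_pow_left₀ (norm_nonneg _) h1 _
    have h3 : ‖c - d ^ p ^ n‖ < 1 := by
      have : c - d ^ p ^ n = (x - d ^ p ^ n) - (x - c) := by ring
      rw [this]
      exact norm_sub_lt (h2.trans_lt (pow_lt_one₀ (norm_nonneg _) ht.norm_lt
        (pow_pos hp.pos n).ne')) hxc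
    have h4 : c = d ^ p ^ n := by
      by_contra hne
      exact h3.ne (hC _ (C.sub_mem hc (C.pow_mem hd _)) (sub_ne_zero.2 hne))
    rwa [h4]
  have hlim : Filter.Tendsto (fun n : ℕ => ‖t‖ ^ p ^ n) Filter.atTop (nhds 0) :=
    (tendsto_pow_atTop_nhds_zero_of_lt_one (norm_nonneg _) ht.norm_lt).comp
      (tendsto_pow_atTop_atTop_of_one_lt hp.one_lt)
  have h0 : ‖x - c‖ ≤ 0 := ge_of_tendsto' hlim key
  rwa [sub_eq_zero.1 (norm_le_zero_iff.1 h0)]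

theorem mem_teichmullerReps {x : Ω} (hx : x ∈ perfectCore p K) (hx1 : ‖x‖ ≤ 1) :
    x ∈ teichmullerReps p K := by
  have hp : p.Prime := Fact.out
  refine ⟨⟨x, mem_bigRing.2 hx1⟩, rfl, perfectCore_le p hx, fun n => ?_, hx⟩
  obtain ⟨z, hz, hzx⟩ := hx n
  have hz1 : ‖z‖ ≤ 1 := norm_le_one_of_pow (pow_pos hp.pos n).ne' (by rw [hzx]; exact hx1)
  refine ⟨res z, res_mem hz, ?_⟩
  rw [← res_pow hz1, hzx, ← res_coe]

/-- A complete discretely valued field with coefficient field `C` is finite over `C((s))`, for each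
nonzero element `s` of its maximal ideal. -/
theorem finiteOver_laurent (p : ℕ) [Fact p.Prime] [CharP Ω p] (hK : IsComplete (K : Set Ω))
    (ht : IsUniformizer K t) (hCK : C ≤ K)
    (hKC : ∀ x ∈ K, ‖x‖ ≤ 1 → ∃ c ∈ C, ‖x - c‖ < 1)
    (hs : s ∈ K) (hs0 : s ≠ 0) (hs1 : ‖s‖ < 1) : FiniteOver (laurent C s) K := by
  obtain ⟨n, hn⟩ := ht.exists_zpow s hs hs0
  have hn0 : 0 < n := ht.zpow_lt_iff.1 (by rw [← hn, zpow_zero]; exact hs1)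
  lift n to ℕ using hn0.le
  have hle : laurent C s ≤ K := laurent_le hK.isClosed hCK hs
  refine Spans.finiteOver hle (spans_of_approx p (laurent_isComplete hK hCK hs) mem_laurent hs0 hs1
    hle (b := fun i : Fin n => t ^ (i : ℕ)) (fun i => K.pow_mem ht.mem _) fun x hx hx1 => ?_)
  obtain ⟨a, ha, hxa⟩ := exists_expansion ht (S := {c | c ∈ C ∧ ‖c‖ ≤ 1}) (fun c hc => hCK hc.1)
    (fun x hx hx1 => by
      obtain ⟨c, hc, h⟩ := hKC x hx hx1
      exact ⟨c, ⟨hc, norm_le_one_of_sub hx1 h⟩, h⟩) n hx hx1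
  exact ⟨a, fun i => le_laurent (ha i).1, fun i => (ha i).2, by
    rw [hn, zpow_natCast]; exact hxa⟩

/-- Elements with a `p ^ n`-th power in the field of Laurent series in `s` over a perfect field
are obtained by adjoining a `p ^ n`-th root of `s`. -/
theorem mem_adj_of_pow_mem_laurent (hK : IsComplete (K : Set Ω)) (hCK : C ≤ K)
    (hC : ∀ c ∈ C, c ≠ 0 → ‖c‖ = 1) (hperf : ∀ c ∈ C, ∃ d ∈ C, d ^ p = c)
    (hs : s ∈ K) (hs0 : s ≠ 0) (hs1 : ‖s‖ < 1) {n : ℕ} {w x : Ω} (hw : w ^ p ^ n = s)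
    (hx : x ^ p ^ n ∈ laurent C s) : x ∈ adj (laurent C s) {w} := by
  have hu := laurent_isUniformizer hC hs0 hs1
  have hk := laurent_isComplete hK hCK hs
  have hroot : ∀ n : ℕ, ∀ c ∈ C, ∃ d ∈ C, d ^ p ^ n = c := by
    intro n
    induction n with
    | zero => exact fun c hc => ⟨c, hc, by simp⟩
    | succ n ih =>
      intro c hc
      obtain ⟨d, hd, rfl⟩ := hperf c hc
      obtain ⟨e, he, rfl⟩ := ih d hd
      exact ⟨e, he, by rw [pow_succ, pow_mul]⟩
  have hC1 : ∀ c ∈ C, ‖c‖ ≤ 1 := fun c hc => by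
    by_cases h : c = 0
    · simp [h]
    · exact (hC c hc h).le
  have H : ∀ y ∈ laurent C s, ‖y‖ ≤ 1 →
      y ∈ (adj (laurent C s) {w}).map (iterateFrobenius Ω p n) := by
    intro y hy hy1
    obtain ⟨a, ha, -, rfl⟩ := exists_eq_sum_pow p n hk hu.mem hs0 hs1 le_rfl
      (b := fun i : Fin (p ^ n) => s ^ (i : ℕ)) (fun i => Subfield.pow_mem _ hu.mem _)
      (fun x hx hx1 => by
        obtain ⟨a, ha, hxa⟩ := exists_expansion hu (S := C) (fun c hc => le_laurent hc)
          (fun x hx hx1 => laurent_residue hC hs0 hs1 hx hx1) (p ^ n) hx hx1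
        choose d hd hda using fun i => hroot n (a i) (ha i)
        refine ⟨d, fun i => le_laurent (hd i), fun i => hC1 _ (hd i), ?_⟩
        simpa only [hda] using hxa) hy hy1
    refine Subfield.sum_mem _ fun i _ => Subfield.mul_mem _ (Subfield.mem_map.2
      ⟨a i, le_adj _ _ (ha i), rfl⟩) (Subfield.pow_mem _ (Subfield.mem_map.2
        ⟨w, subset_adj _ _ (Set.mem_singleton _), hw⟩) _)
  have H' : x ^ p ^ n ∈ (adj (laurent C s) {w}).map (iterateFrobenius Ω p n) := by
    rcases le_total ‖x‖ 1 with h | h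
    · exact H _ hx (norm_pow_le_one h _)
    · have := H _ (Subfield.inv_mem _ hx) (by
        rw [norm_inv, norm_pow]; exact inv_le_one_of_one_le₀ (one_le_pow₀ h))
      simpa using Subfield.inv_mem _ this
  obtain ⟨y, hy, hyx⟩ := H'
  have : y = x := pow_p_injective p n hyx
  rwa [← this]

/-- Laurent series over the largest perfect subfield, in a root of an element of the base subfield,
are algebraic over the closure of the field generated by the Teichmüller representatives. -/
theorem isAlgebraic_constantBase {B : Subfield Ω} (hK : IsComplete (K : Set Ω))
    (ht : IsUniformizer K t) (hBK : B ≤ K) {j : ℕ} (hs : s ^ p ^ j ∈ B) {x : Ω}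
    (hx : x ∈ laurent (perfectCore p K) s) : IsAlgebraic (constantBase p B K) x := by
  have hp : p.Prime := Fact.out
  have hcl : IsClosed ((constantBase p B K : Subfield Ω) : Set Ω) :=
    (Subfield.isClosed_topologicalClosure _).inter hK.isClosed
  have hB : B ≤ constantBase p B K := le_inf (fun y hy =>
    Subfield.le_topologicalClosure _ (Subfield.subset_closure (Or.inl hy))) hBK
  have hR : perfectCore p K ≤ constantBase p B K := fun y hy => by
    have h1 : ‖y‖ ≤ 1 := by
      by_cases h : y = 0
      · simp [h]
      · exact (ht.norm_eq_one_of_roots hp.one_lt h hy).le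
    exact ⟨Subfield.le_topologicalClosure _ (Subfield.subset_closure
      (Or.inr (mem_teichmullerReps hy h1))), perfectCore_le p hy⟩
  have hle : laurent (perfectCore p K) s ≤ (constantBase p B K).comap (iterateFrobenius Ω p j) := by
    refine laurent_le (hcl.preimage (f := fun y : Ω => y ^ p ^ j) (continuous_pow _)) ?_ ?_
    · intro y hy
      exact Subfield.pow_mem _ (hR hy) (p ^ j)
    · exact hB hs
  have h : x ^ p ^ j ∈ constantBase p B K := hle hx
  exact IsAlgebraic.of_pow (pow_pos hp.pos j) (isAlgebraic_algebraMap
    (⟨_, h⟩ : (constantBase p B K : Subfield Ω)))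

end Setting

/-! ### The field generated by the unramified elements and the constants -/

section Levels

variable {Ω : Type*} [NormedField Ω] [IsUltrametricDist Ω] {E M T l k : Subfield Ω} {s t π : Ω}
variable {p : ℕ} [Fact p.Prime] [CharP Ω p]

/-- If `M` is generated as a vector space over `T` by `1, s, …, s ^ (e - 1)`, where `‖s‖ ^ e` is the
value of a uniformizer of `T`, then `s` is a uniformizer of `M` and `M` has the residue field
of `T`. -/
theorem isUniformizer_of_spans (hT : IsUniformizer T t) (hs : s ∈ M) {e : ℕ}
    (he : ‖t‖ = ‖s‖ ^ e) (hsp : Spans T M (fun i : Fin e => s ^ (i : ℕ))) :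
    IsUniformizer M s ∧ ∀ x ∈ M, ‖x‖ ≤ 1 → ∃ y ∈ T, ‖x - y‖ < 1 := by
  have he0 : e ≠ 0 := by
    rintro rfl
    rw [pow_zero] at he
    exact hT.norm_lt.ne he
  have hs0 : s ≠ 0 := by
    rintro rfl
    rw [norm_zero, zero_pow he0] at he
    exact hT.norm_pos.ne' he
  have hs1 : ‖s‖ < 1 := by
    by_contra h
    exact hT.norm_lt.not_ge (he ▸ one_le_pow₀ (not_lt.1 h))
  have hspos : 0 < ‖s‖ := norm_pos_iff.2 hs0
  have hterm : ∀ a ∈ T, a ≠ 0 → ∀ i : ℕ, ∃ n : ℤ, ‖a * s ^ i‖ = ‖s‖ ^ (e * n + i) := by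
    intro a ha ha0 i
    obtain ⟨n, hn⟩ := hT.exists_zpow a ha ha0
    refine ⟨n, ?_⟩
    rw [norm_mul, norm_pow, hn, he, zpow_add₀ hspos.ne', zpow_mul, zpow_natCast, zpow_natCast]
  have hinj : Function.Injective (fun n : ℤ => ‖s‖ ^ n) :=
    zpow_right_injective₀ hspos hs1.ne
  have hne : ∀ a : Fin e → Ω, (∀ i, a i ∈ T) → ∀ i j : Fin e, i ≠ j → a i * s ^ (i : ℕ) ≠ 0 →
      ‖a i * s ^ (i : ℕ)‖ ≠ ‖a j * s ^ (j : ℕ)‖ := by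
    intro a ha i j hij hi0 h
    have hj0 : a j * s ^ (j : ℕ) ≠ 0 := by
      rw [← norm_pos_iff, ← h]; exact norm_pos_iff.2 hi0
    obtain ⟨n, hn⟩ := hterm _ (ha i) (left_ne_zero_of_mul hi0) i
    obtain ⟨m, hm⟩ := hterm _ (ha j) (left_ne_zero_of_mul hj0) j
    have h1 : (e : ℤ) * n + i = e * m + j := hinj (by simp only [← hn, ← hm, h])
    have h2 : (i : ℤ) = j := by
      have := congrArg (· % (e : ℤ)) h1
      simp only [Int.mul_add_emod_self_left] at this
      rwa [Int.emod_eq_of_lt (by omega) (by omega), Int.emod_eq_of_lt (by omega) (by omega)] at this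
    exact hij (Fin.ext (by omega))
  refine ⟨⟨hs, hs0, hs1, fun x hx hx0 => ?_⟩, fun x hx hx1 => ?_⟩
  · obtain ⟨a, ha, rfl⟩ := hsp x hx
    obtain ⟨i, hi⟩ : ∃ i, ‖∑ i, a i * s ^ (i : ℕ)‖ ≤ ‖a i * s ^ (i : ℕ)‖ := by
      have : Nonempty (Fin e) := ⟨⟨0, Nat.pos_of_ne_zero he0⟩⟩
      obtain ⟨i, -, hi⟩ := IsUltrametricDist.exists_norm_finsetSum_le_of_nonempty
        (Finset.univ_nonempty (α := Fin e)) (fun i => a i * s ^ (i : ℕ))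
      exact ⟨i, hi⟩
    have hi' := le_antisymm hi
      (norm_le_norm_sum_of_ne (f := fun i => a i * s ^ (i : ℕ)) (hne a ha) i)
    have h0 : a i * s ^ (i : ℕ) ≠ 0 := by
      rw [← norm_pos_iff, ← hi']; exact norm_pos_iff.2 hx0
    obtain ⟨n, hn⟩ := hterm _ (ha i) (left_ne_zero_of_mul h0) i
    exact ⟨_, hi'.trans hn⟩
  · obtain ⟨a, ha, rfl⟩ := hsp x hx
    have hle := norm_le_norm_sum_of_ne (f := fun i => a i * s ^ (i : ℕ)) (hne a ha)
    refine ⟨a ⟨0, Nat.pos_of_ne_zero he0⟩, ha _, ?_⟩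
    have h1 : ∑ i, a i * s ^ (i : ℕ) - a ⟨0, Nat.pos_of_ne_zero he0⟩ =
        ∑ i ∈ Finset.univ.erase (⟨0, Nat.pos_of_ne_zero he0⟩ : Fin e), a i * s ^ (i : ℕ) := by
      rw [← Finset.add_sum_erase _ _ (Finset.mem_univ (⟨0, Nat.pos_of_ne_zero he0⟩ : Fin e))]
      simp
    rw [h1]
    refine (IsUltrametricDist.norm_sum_le_of_forall_le_of_nonneg hspos.le (C := ‖s‖)
      fun i hi => ?_).trans_lt hs1
    by_cases h0 : a i = 0
    · simp [h0]
    obtain ⟨n, hn⟩ := hterm _ (ha i) h0 i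
    have h2 := (hle i).trans hx1
    rw [hn, ← zpow_zero ‖s‖, zpow_le_zpow_iff_right_of_lt_one₀ hspos hs1] at h2
    rw [hn]
    conv_rhs => rw [← zpow_one ‖s‖]
    rw [zpow_le_zpow_iff_right_of_lt_one₀ hspos hs1]
    have h3 : (i : ℕ) ≠ 0 := fun h => (Finset.mem_erase.1 hi).1 (Fin.ext h)
    rcases lt_or_ge n 0 with hn0 | hn0
    · exfalso
      have : (e : ℤ) * n ≤ e * (-1) := mul_le_mul_of_nonneg_left (by omega) (by omega)
      omega
    · have : 0 ≤ (e : ℤ) * n := by positivity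
      omega

theorem exists_sepOver_pow (p : ℕ) [Fact p.Prime] {F : Type*} [Field F] [CharP F p]
    {M : Subfield F} {x : F} (hx : IsAlgebraic M x) : ∃ n : ℕ, SepOver M (x ^ p ^ n) := by
  have := charP_subfield p M
  obtain ⟨g, hg, n, hn⟩ := (minpoly.irreducible hx.isIntegral).hasSeparableContraction p
  refine ⟨n, hg.of_dvd (minpoly.dvd _ _ ?_)⟩
  rw [← Polynomial.expand_aeval, hn, minpoly.aeval]

/-- The data from which the fields of constants and of unramified elements are built: a complete
discretely valued field `E` and a complete subfield `k` with the same uniformizer `π`, a perfect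
residue field, and which contains the largest perfect subfield of `E`. -/
structure IsConstantBase (p : ℕ) [Fact p.Prime] [CharP Ω p] (E k : Subfield Ω) (π : Ω) : Prop where
  le : k ≤ E
  isComplete : IsComplete (E : Set Ω)
  isComplete_constants : IsComplete (k : Set Ω)
  isUniformizer : IsUniformizer E π
  mem : π ∈ k
  exists_pow : ∀ y ∈ residueSubfield k, ∃ z ∈ residueSubfield k, z ^ p = y
  core_le : perfectCore p E ≤ k
  isAlgebraic : ∀ x : Ω, IsAlgebraic E x

theorem IsConstantBase.constants (h : IsConstantBase p E k π) : IsUniformizer k π :=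
  ⟨h.mem, h.isUniformizer.ne_zero, h.isUniformizer.norm_lt,
    fun x hx hx0 => h.isUniformizer.exists_zpow x (h.le hx) hx0⟩

theorem IsConstantBase.isNormBase (h : IsConstantBase p E k π) : IsNormBase E :=
  isNormBase_of_isComplete h.isComplete ⟨π, h.isUniformizer.mem, h.isUniformizer.ne_zero,
    h.isUniformizer.norm_lt⟩ h.isAlgebraic

/-- Every residue has a `p`-power which is the residue of an unramified element. -/
theorem IsConstantBase.exists_isEtaleElement_res_eq_pow [IsAlgClosed Ω]
    (h : IsConstantBase p E k π) (y : BigResidue Ω) :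
    ∃ n : ℕ, ∃ b, IsEtaleElement E b ∧ res b = y ^ p ^ n := by
  have := charP_bigResidue (Ω := Ω) p
  obtain ⟨x, hx1, rfl⟩ := exists_res_eq y
  have hfin : FiniteOver E (adj E {x}) :=
    finiteOver_adj (Set.finite_singleton x) fun y _ => h.isAlgebraic y
  obtain ⟨n, hn⟩ := exists_sepOver_pow p
    (hfin.residue.isAlgebraic (res_mem (subset_adj E {x} (Set.mem_singleton x))))
  exact ⟨n, exists_isEtaleElement hn⟩

/-- The unramified elements and the constants. -/
def unramifiedConstants (E k : Subfield Ω) : Set Ω := {b | IsEtaleElement E b} ∪ algClosure k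

/-- Finitely many unramified elements `Z` and constants `c` generate a field whose uniformizer is
constant, after the adjunction of finitely many unramified elements.  The field `k (c)` is spanned
over `k` by products `b i * s ^ j` of unramified elements `b i`, which lift a basis of its residue
field, and powers of a uniformizer `s`; if the `b i` are adjoined too, the powers of `s` suffice. -/
theorem IsConstantBase.exists_level [IsAlgClosed Ω] (h : IsConstantBase p E k π) (Z c : Finset Ω)
    (hZ : ∀ b ∈ Z, IsEtaleElement E b) (hc : ∀ b ∈ c, b ∈ algClosure k) :
    ∃ Z' : Finset Ω, Z ⊆ Z' ∧ (∀ b ∈ Z', IsEtaleElement E b) ∧ ∃ s,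
      StdField p (algClosure k) (adj E (Z' ∪ c)) s ∧
      residueSubfield (adj E (Z' ∪ c)) ≤ residueSubfield (adj E Z') ∧
      FiniteOver E (adj E (Z' ∪ c)) := by
  classical
  have hu := h.constants
  set l := adj k (c : Set Ω) with hl
  have hkl : FiniteOver k l := finiteOver_adj c.finite_toSet fun b hb => mem_algClosure.1 (hc b hb)
  have hlκ : l ≤ algClosure k := adj_le le_algClosure hc
  have hnt : ∃ x ∈ k, x ≠ 0 ∧ ‖x‖ < 1 := ⟨π, hu.mem, hu.ne_zero, hu.norm_lt⟩
  have hlc : IsComplete (l : Set Ω) := hkl.isComplete h.isComplete_constants hnt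
  obtain ⟨s, hs⟩ := hkl.exists_isUniformizer hu
  obtain ⟨r, hrl, hrli, hrs⟩ := hkl.residue.exists_basis
  have hsep : ∀ i, SepOver (residueSubfield k) (r i) := fun i => by
    have := charP_bigResidue (Ω := Ω) p
    exact sepOver_of_perfect p h.exists_pow (hkl.residue.isAlgebraic (hrl i))
  choose b hbe hbr using fun i => exists_isEtaleElement (hsep i)
  have hbl : ∀ i, b i ∈ l := by
    intro i
    obtain ⟨y, hy, hyb⟩ := (res_mem_iff (hbe i).norm_le).1 (by rw [hbr i]; exact hrl i)
    exact (hbe i).mem_of_isComplete hkl.1 hlc.isClosed hy hyb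
  obtain ⟨e, he⟩ := hs.exists_zpow π (hkl.1 hu.mem) hu.ne_zero
  have he0 : 0 < e := hs.zpow_lt_iff.1 (by rw [← he, zpow_zero]; exact hu.norm_lt)
  lift e to ℕ using he0.le
  rw [zpow_natCast] at he
  -- the integral combinations of the `b i` represent the residues of `l`
  have hspl : Spans k l (fun ij : Fin _ × Fin e => b ij.1 * s ^ (ij.2 : ℕ)) := by
    refine spans_of_approx p h.isComplete_constants hu.mem hu.ne_zero hu.norm_lt hkl.1
      (fun ij => l.mul_mem (hbl _) (l.pow_mem hs.mem _)) fun x hx hx1 => ?_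
    obtain ⟨a, ha, hxa⟩ := exists_expansion hs
      (S := {y | ∃ d : Fin _ → Ω, (∀ i, d i ∈ k) ∧ (∀ i, ‖d i‖ ≤ 1) ∧ y = ∑ i, d i * b i})
      (by
        rintro _ ⟨d, hd, -, rfl⟩
        exact l.sum_mem fun i _ => l.mul_mem (hkl.1 (hd i)) (hbl i))
      (fun x hx hx1 => by
        obtain ⟨d, hd, hxd⟩ := hrs (res x) (res_mem hx)
        choose d' hd' hd1 hdd using fun i => mem_residueSubfield.1 (hd i)
        refine ⟨_, ⟨d', hd', hd1, rfl⟩, ?_⟩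
        have h1 := fun i => (hbe i).norm_le
        rw [← res_eq_iff hx1 (norm_sum_mul_le_one hd1 h1), hxd,
          res_sum _ fun i _ => norm_mul_le_one (hd1 i) (h1 i)]
        exact Finset.sum_congr rfl fun i _ => by rw [res_mul (hd1 i) (h1 i), hdd, hbr]) e hx hx1
    choose d hd hd1 hda using ha
    refine ⟨fun ij => d ij.2 ij.1, fun ij => hd _ _, fun ij => hd1 _ _, ?_⟩
    rw [he]
    convert hxa using 3
    rw [Fintype.sum_prod_type_right]
    refine Finset.sum_congr rfl fun j _ => ?_
    rw [hda, Finset.sum_mul]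
    exact Finset.sum_congr rfl fun i _ => by ring
  have hZ' : ∀ x ∈ Z ∪ Finset.univ.image b, IsEtaleElement E x := by
    intro x hx
    rcases Finset.mem_union.1 hx with hx | hx
    · exact hZ x hx
    · obtain ⟨i, -, rfl⟩ := Finset.mem_image.1 hx
      exact (hbe i).mono h.le
  refine ⟨Z ∪ Finset.univ.image b, Finset.subset_union_left, hZ', s, ?_⟩
  set Z' := Z ∪ Finset.univ.image b
  set T := adj E (Z' : Set Ω) with hT
  have hET : E ≤ T := le_adj _ _
  have hM : adj E (Z' ∪ c : Set Ω) = T ⊔ l := by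
    rw [← adj_adj, ← hT, hl, sup_adj, sup_eq_left.2 (h.le.trans hET)]
  have hbT : ∀ i, b i ∈ T := fun i => subset_adj _ _ (Finset.mem_coe.2
    (Finset.mem_union_right _ (Finset.mem_image_of_mem b (Finset.mem_univ i))))
  have hTr := isResidual_adj h.isNormBase Z' hZ'
  have hTu : IsUniformizer T π := ⟨hET h.isUniformizer.mem, hu.ne_zero, hu.norm_lt, by
    intro x hx hx0
    obtain ⟨y, hy, hy0, hxy⟩ := hTr.1.exists_norm_eq hx hx0
    rw [hxy]
    exact h.isUniformizer.exists_zpow y hy hy0⟩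
  have hsp : Spans T (T ⊔ l) (fun i : Fin e => s ^ (i : ℕ)) := by
    intro x hx
    obtain ⟨a, ha, rfl⟩ := Spans.sup hkl.1 (fun ij => l.mul_mem (hbl _) (l.pow_mem hs.mem _)) hspl
      (h.le.trans hET) x hx
    refine ⟨fun j => ∑ i, a (i, j) * b i, fun j =>
      T.sum_mem fun i _ => T.mul_mem (ha _) (hbT i), ?_⟩
    rw [Fintype.sum_prod_type_right]
    refine Finset.sum_congr rfl fun j _ => ?_
    rw [Finset.sum_mul]
    exact Finset.sum_congr rfl fun i _ => by ring
  obtain ⟨h1, h2⟩ := isUniformizer_of_spans hTu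
    ((le_sup_right : l ≤ T ⊔ l) hs.mem) he hsp
  have hfin : FiniteOver E (T ⊔ l) := hTr.1.1.trans (Spans.finiteOver le_sup_left hsp)
  rw [hM]
  refine ⟨⟨hfin.isComplete h.isComplete ⟨π, h.isUniformizer.mem, hu.ne_zero, hu.norm_lt⟩, h1,
    hlκ hs.mem, fun x hx => ?_⟩, fun y hy => ?_, hfin⟩
  · exact mem_algClosure.2 (isAlgebraic_mono h.core_le (isAlgebraic_perfectCore p hfin hx))
  · obtain ⟨x, hx, hx1, rfl⟩ := mem_residueSubfield.1 hy
    exact (res_mem_iff hx1).2 (h2 x hx hx1)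

/-- Finitely many elements of the field generated by the unramified elements and the constants lie
in a field as in `IsConstantBase.exists_level`. -/
theorem IsConstantBase.exists_level_subset [IsAlgClosed Ω] (h : IsConstantBase p E k π)
    (Z T : Finset Ω) (hZ : ∀ b ∈ Z, IsEtaleElement E b)
    (hT : (T : Set Ω) ⊆ adj E (unramifiedConstants E k)) :
    ∃ Z' c : Finset Ω, ∃ s, Z ⊆ Z' ∧ (∀ b ∈ Z', IsEtaleElement E b) ∧ (∀ b ∈ c, b ∈ algClosure k) ∧
      (T : Set Ω) ⊆ adj E (Z' ∪ c) ∧ StdField p (algClosure k) (adj E (Z' ∪ c)) s ∧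
      residueSubfield (adj E (Z' ∪ c)) ≤ residueSubfield (adj E Z') := by
  classical
  obtain ⟨T', hT', hTT'⟩ := exists_finset_subset_adj T hT
  obtain ⟨Z', hZZ, hZ', s, hs, hr, -⟩ := h.exists_level (Z ∪ T'.filter (IsEtaleElement E))
    (T'.filter (· ∈ algClosure k))
    (fun b hb => (Finset.mem_union.1 hb).elim (hZ b) fun hb => (Finset.mem_filter.1 hb).2)
    (fun b hb => (Finset.mem_filter.1 hb).2)
  refine ⟨Z', _, s, Finset.subset_union_left.trans hZZ, hZ', fun b hb => (Finset.mem_filter.1 hb).2,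
    hTT'.trans (adj_mono le_rfl fun x hx => ?_), hs, hr⟩
  rcases hT' hx with hx' | hx'
  · exact Or.inl (hZZ (Finset.mem_union_right _ (Finset.mem_filter.2 ⟨hx, hx'⟩)))
  · exact Or.inr (Finset.mem_filter.2 ⟨hx, hx'⟩)

theorem IsConstantBase.isConstantClosed [IsAlgClosed Ω] (h : IsConstantBase p E k π) :
    IsConstantClosed p (algClosure k) (adj E (unramifiedConstants E k)) := by
  refine ⟨fun x hx => subset_adj _ _ (Or.inr hx), fun y => ?_, fun T hT => ?_⟩
  · obtain ⟨n, b, hb, hby⟩ := h.exists_isEtaleElement_res_eq_pow y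
    exact ⟨n, hby ▸ res_mem (subset_adj _ _ (Or.inl hb))⟩
  · obtain ⟨Z, c, s, -, hZ, hc, hTM, hs, hr⟩ := h.exists_level_subset ∅ T (by simp) hT
    refine ⟨_, s, hs, hTM, adj_mono le_rfl (Set.union_subset_union hZ hc), fun y hy => ?_⟩
    obtain ⟨x, hx, hx1, rfl⟩ := mem_residueSubfield.1 hy
    obtain ⟨Z₁, c₁, s₁, -, hZ₁, -, hTM₁, -, hr₁⟩ :=
      h.exists_level_subset ∅ {x} (by simp) (by simpa using hx)
    have h1 := hr₁ (res_mem (hTM₁ (Finset.mem_coe.2 (Finset.mem_singleton_self x))))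
    exact ((isResidual_adj h.isNormBase Z₁ hZ₁).2 _ h1).mono (residueSubfield_mono (le_adj _ _))

end Levels

/-! ### Residue fields of constant extensions -/

section ConstantExtensions

variable {Ω : Type*} [NormedField Ω] [IsUltrametricDist Ω] {X P k : Subfield Ω}
variable {p : ℕ} [Fact p.Prime] [CharP Ω p]

/-- A constant extension of a field which contains the roots of all constants, and over whose
residue field all residues are purely inseparable, has the same residue field.  An integral
element `x` of the extension has the same residue as `Tr (t x) / Tr t`, for a constant `t` with
`‖Tr t‖` close to `‖t‖`: such a constant is a root of high order of a constant with nonzero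
trace. -/
theorem residueSubfield_sup_algClosure [IsAlgClosed Ω] (hX : IsNormBase X) (hPX : P ≤ X)
    (hP : ∀ y ∈ P, ∃ z ∈ P, z ^ p = y)
    (hres : ∀ y : BigResidue Ω, ∃ n : ℕ, y ^ p ^ n ∈ residueSubfield X) :
    residueSubfield (X ⊔ algClosure P) ≤ residueSubfield X := by
  have hp : p.Prime := Fact.out
  intro y hy
  obtain ⟨x, hx, hx1, rfl⟩ := mem_residueSubfield.1 hy
  rw [← Subfield.closure_eq (algClosure P)] at hx
  obtain ⟨c, hcκ, hxc⟩ := exists_finset_mem_adj hx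
  have hsepP : ∀ z, IsAlgebraic P z → SepOver P z := fun z hz => sepOver_of_perfect p hP hz
  have hcal : ∀ z ∈ (c : Set Ω), IsAlgebraic P z := fun z hz => mem_algClosure.1 (hcκ hz)
  have hPE : FiniteOver P (adj P c) := finiteOver_adj c.finite_toSet hcal
  obtain ⟨b, hbE, -, hbs⟩ := hPE.exists_basis
  have hXE : X ⊔ adj P c = adj X c := by rw [sup_adj, sup_eq_left.2 hPX]
  have hspan := hbs.sup hPE.1 hbE hPX
  rw [hXE] at hspan
  set F : IntermediateField X Ω := IntermediateField.adjoin X c with hF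
  have : FiniteDimensional X F := by
    have := c.finite_toSet.to_subtype
    exact IntermediateField.finiteDimensional_adjoin fun x _ => (hX.isAlgebraic x).isIntegral
  have hsepF : Algebra.IsSeparable X F := by
    rw [hF, IntermediateField.isSeparable_adjoin_iff_isSeparable]
    exact fun z hz => (hsepP z (hcal z hz)).mono hPX
  have hmem : ∀ {z : Ω}, z ∈ adj X c → z ∈ F := fun hz => mem_adj_iff.1 hz
  have hEF : ∀ {z : Ω}, z ∈ adj P c → z ∈ F := fun hz => hmem (adj_mono hPX le_rfl hz)
  -- some element of the basis has nonzero trace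
  obtain ⟨i, hi⟩ : ∃ i, Algebra.trace X F ⟨b i, hEF (hbE i)⟩ ≠ 0 := by
    by_contra hcon
    push Not at hcon
    refine Algebra.trace_ne_zero X F (LinearMap.ext fun f => ?_)
    obtain ⟨a, ha, hfa⟩ := hspan f (mem_adj_iff.2 f.2)
    have hf : f = ∑ i, (⟨a i, ha i⟩ : X) • (⟨b i, hEF (hbE i)⟩ : F) := by
      apply Subtype.ext
      rw [hfa, IntermediateField.coe_sum]
      rfl
    rw [hf, map_sum, Finset.sum_eq_zero fun i _ => by rw [map_smul, hcon, smul_zero]]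
    rfl
  have htr : ∀ f : F, ((Algebra.trace X F f : X) : Ω) = ∑ σ : F →ₐ[X] Ω, σ f := fun f =>
    trace_eq_sum_embeddings (K := X) (L := F) Ω (x := f)
  have hσ : ∀ (σ : F →ₐ[X] Ω) (f : F), ∃ τ : Ω ≃ₐ[X] Ω, τ f = σ f := by
    intro σ f
    refine exists_algEquiv_of_root hX.isAlgebraic ?_
    rw [Polynomial.aeval_algHom_apply, ← IntermediateField.minpoly_eq, minpoly.aeval, map_zero]
  have hσn : ∀ (σ : F →ₐ[X] Ω) (f : F), ‖σ f‖ = ‖(f : Ω)‖ := by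
    intro σ f
    obtain ⟨τ, hτ⟩ := hσ σ f
    rw [← hτ, hX.norm_algEquiv]
  set x' : F := ⟨x, hmem hxc⟩ with hx'
  have hσx : ∀ σ : F →ₐ[X] Ω, ‖σ x' - x‖ < 1 := by
    intro σ
    obtain ⟨τ, hτ⟩ := hσ σ x'
    obtain ⟨n, hn⟩ := hres (res x)
    rw [← hτ]
    exact norm_algEquiv_sub_lt hX hx1 hn τ
  obtain ⟨σ₀, hσ₀⟩ := Finite.exists_max fun σ : F →ₐ[X] Ω => ‖σ x' - x‖
  set δ := ‖σ₀ x' - x‖ with hδ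
  have hδ1 : δ < 1 := hσx σ₀
  have hδ0 : 0 ≤ δ := norm_nonneg _
  set t₀ := b i with ht₀
  set S₀ : Ω := ((Algebra.trace X F ⟨t₀, hEF (hbE i)⟩ : X) : Ω) with hS₀
  have hS0 : S₀ ≠ 0 := fun h => hi (Subtype.ext h)
  obtain ⟨n, hn⟩ : ∃ n : ℕ, δ ^ p ^ n * ‖t₀‖ < ‖S₀‖ := by
    have h1 : Filter.Tendsto (fun n : ℕ => δ ^ p ^ n * ‖t₀‖) Filter.atTop (nhds (0 * ‖t₀‖)) :=
      ((tendsto_pow_atTop_nhds_zero_of_lt_one hδ0 hδ1).comp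
        (tendsto_pow_atTop_atTop_of_one_lt hp.one_lt)).mul_const _
    rw [zero_mul] at h1
    exact (h1.eventually_lt_const (norm_pos_iff.2 hS0)).exists
  obtain ⟨t, ht⟩ := IsAlgClosed.exists_pow_nat_eq t₀ (pow_pos hp.pos n)
  have htE : t ∈ adj P c := by
    refine mem_of_sepOver_of_pow_mem p (n := n) ((hsepP t ?_).mono (le_adj P c)) (ht ▸ hbE i)
    exact IsAlgebraic.of_pow (pow_pos hp.pos n) (ht ▸ hPE.isAlgebraic (hbE i))
  set t' : F := ⟨t, hEF htE⟩ with ht'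
  set S : Ω := ((Algebra.trace X F t' : X) : Ω) with hS
  have hSS : S ^ p ^ n = S₀ := by
    rw [hS, hS₀, htr, htr]
    have := map_sum (iterateFrobenius Ω p n) (fun σ : F →ₐ[X] Ω => σ t') Finset.univ
    simp only [iterateFrobenius_def] at this
    rw [this]
    refine Finset.sum_congr rfl fun σ _ => ?_
    rw [← map_pow]
    exact congrArg σ (Subtype.ext ht)
  have hSne : S ≠ 0 := by
    intro h
    rw [h, zero_pow (pow_pos hp.pos n).ne'] at hSS
    exact hS0 hSS.symm
  refine (res_mem_iff hx1).2 ⟨_, (Algebra.trace X F (t' * x') / Algebra.trace X F t').2, ?_⟩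
  have h1 : x - ((Algebra.trace X F (t' * x') / Algebra.trace X F t' : X) : Ω) =
      (∑ σ : F →ₐ[X] Ω, -(σ t' * (σ x' - x))) / S := by
    have h2 : ((Algebra.trace X F (t' * x') / Algebra.trace X F t' : X) : Ω) =
        (∑ σ : F →ₐ[X] Ω, σ t' * σ x') / S := by
      have h3 := htr (t' * x')
      simp only [map_mul] at h3
      rw [← h3]
      rfl
    rw [h2, eq_div_iff hSne, sub_mul, div_mul_cancel₀ _ hSne, Finset.sum_neg_distrib]
    simp only [mul_sub, Finset.sum_sub_distrib, ← Finset.sum_mul]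
    rw [hS, htr]
    ring
  have h2 : ‖∑ σ : F →ₐ[X] Ω, -(σ t' * (σ x' - x))‖ ≤ ‖t‖ * δ := by
    refine IsUltrametricDist.norm_sum_le_of_forall_le_of_nonneg
      (mul_nonneg (norm_nonneg _) hδ0) fun σ _ => ?_
    rw [norm_neg, norm_mul, hσn]
    exact mul_le_mul_of_nonneg_left (hσ₀ σ) (norm_nonneg _)
  have h3 : ‖t‖ * δ < ‖S‖ := by
    refine lt_of_pow_lt_pow_left₀ (p ^ n) (norm_nonneg _) ?_
    rw [mul_pow, ← norm_pow t, ← norm_pow S, hSS, ht, mul_comm]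
    exact hn
  rw [h1, norm_div, div_lt_one (norm_pos_iff.2 hSne)]
  exact h2.trans_lt h3

end ConstantExtensions

/-! ### Linear disjointness and purely inseparable elements -/

section LinearDisjointness

variable {F : Type*} [Field F] {A M N : Subfield F} {ι : Type*} [Fintype ι] {b : ι → F}

/-- A family `b` which is fixed by a set `G` of automorphisms stabilizing `A` is independent over
`A` if it has no nontrivial relations with coefficients in `A` which are fixed by `G`. -/
theorem linearIndependent_of_fixed {G : Set (F ≃+* F)} (hGA : ∀ σ ∈ G, ∀ x ∈ A, σ x ∈ A)
    (hGb : ∀ σ ∈ G, ∀ i, σ (b i) = b i)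
    (H : ∀ a : ι → F, (∀ i, a i ∈ A) → (∀ σ ∈ G, ∀ i, σ (a i) = a i) →
      ∑ i, a i * b i = 0 → ∀ i, a i = 0) : LinearIndependent A b := by
  classical
  refine linearIndependent_subfield_iff.2 fun a ha hab => ?_
  induction hn : (Finset.univ.filter fun i => a i ≠ 0).card using Nat.strong_induction_on
    generalizing a with
  | _ n ih =>
    by_contra hcon
    push Not at hcon
    obtain ⟨j, hj⟩ := hcon
    have h0 : ∑ i, a i / a j * b i = 0 := by
      rw [← zero_div (a j), ← hab, Finset.sum_div]
      exact Finset.sum_congr rfl fun i _ => by ring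
    have h1 := H (fun i => a i / a j) (fun i => A.div_mem (ha i) (ha j)) (fun σ hσ i => ?_) h0 j
    · exact div_ne_zero hj hj h1
    have h2 : ∑ i, (σ (a i / a j) - a i / a j) * b i = 0 := by
      have h3 := congrArg σ h0
      rw [map_sum, map_zero] at h3
      simp only [sub_mul, Finset.sum_sub_distrib, h0, sub_zero]
      rw [← h3]
      exact Finset.sum_congr rfl fun i _ => by rw [map_mul, hGb σ hσ]
    refine sub_eq_zero.1 (ih _ ?_ (fun i => σ (a i / a j) - a i / a j)
      (fun i => A.sub_mem (hGA σ hσ _ (A.div_mem (ha i) (ha j))) (A.div_mem (ha i) (ha j)))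
      h2 rfl i)
    rw [← hn]
    refine Finset.card_lt_card (Finset.ssubset_iff_of_subset (fun i hi => ?_) |>.2 ⟨j, ?_, ?_⟩)
    · rw [Finset.mem_filter] at hi ⊢
      refine ⟨hi.1, fun h => hi.2 (by simp [h])⟩
    · simpa using hj
    · simp [div_self hj, (map_ne_zero σ).2 hj]

/-- The powers of a root of order `p ^ n` of an element which is not a `p`-th power are
independent. -/
theorem linearIndependent_pow_of_root (p : ℕ) [Fact p.Prime] [CharP F p] {w : F} {n : ℕ}
    (hw : w ^ p ^ n ∈ M) (hne : ∀ z ∈ M, z ^ p ≠ w ^ p ^ n) :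
    LinearIndependent M (fun i : Fin (p ^ n) => w ^ (i : ℕ)) := by
  have hp : p.Prime := Fact.out
  have := charP_subfield p M
  obtain ⟨m, y, hm⟩ := (minpoly.natSepDegree_eq_one_iff_eq_X_pow_sub_C (F := M) (x := w) p).1
    ((minpoly.natSepDegree_eq_one_iff_pow_mem p).2 ⟨n, ⟨⟨_, hw⟩, rfl⟩⟩)
  have hwm : w ^ p ^ m = y := by
    have h := minpoly.aeval M w
    rw [hm] at h
    rw [map_sub, map_pow, Polynomial.aeval_X, Polynomial.aeval_C] at h
    exact sub_eq_zero.1 h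
  have hnm : n ≤ m := by
    by_contra hlt
    obtain ⟨d, rfl⟩ := Nat.exists_eq_add_of_lt (not_le.1 hlt)
    refine hne (y ^ p ^ d) (M.pow_mem y.2 _) ?_
    rw [← hwm, ← pow_mul, ← pow_mul, ← pow_succ, ← pow_add, add_assoc]
  have hdeg : (minpoly M w).natDegree = p ^ m := by
    rw [hm, Polynomial.natDegree_X_pow_sub_C]
  have hli := linearIndependent_pow (K := M) w
  rw [hdeg] at hli
  exact hli.comp (fun i : Fin (p ^ n) => (⟨i, i.2.trans_le (Nat.pow_le_pow_right hp.pos hnm)⟩ :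
    Fin (p ^ m))) fun i j h => Fin.ext (by simpa using h)

/-- Independence over a field `M` is preserved by the adjunction of a root of an element that has
no `p`-th root in the field `N`. -/
theorem linearIndependent_adj_root (p : ℕ) [Fact p.Prime] [CharP F p] {w : F} {n : ℕ}
    (hMN : M ≤ N) (hb : ∀ i, b i ∈ N) (hl : LinearIndependent M b)
    (hw : w ^ p ^ n ∈ M) (hne : ∀ z ∈ N, z ^ p ≠ w ^ p ^ n) :
    LinearIndependent (adj M {w}) b := by
  have hp : p.Prime := Fact.out
  have hN := linearIndependent_subfield_iff.1 (linearIndependent_pow_of_root p (hMN hw) hne)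
  have hsp : Spans M (adj M {w}) (fun i : Fin (p ^ n) => w ^ (i : ℕ)) := by
    have h := spans_powers (M := M) (Polynomial.X ^ p ^ n - Polynomial.C ⟨_, hw⟩)
      (Polynomial.monic_X_pow_sub_C _ (pow_pos hp.pos n).ne') (y := w)
      (by rw [map_sub, map_pow, Polynomial.aeval_X, Polynomial.aeval_C]; exact sub_self _)
    rw [Polynomial.natDegree_X_pow_sub_C] at h
    exact h
  refine linearIndependent_subfield_iff.2 fun a ha hab => ?_
  choose c hc hca using fun i => hsp (a i) (ha i)
  have h1 : ∀ j, ∑ i, c i j * b i = 0 := by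
    refine hN (fun j => ∑ i, c i j * b i)
      (fun j => N.sum_mem fun i _ => N.mul_mem (hMN (hc i j)) (hb i)) ?_
    rw [← hab]
    simp only [hca, Finset.sum_mul]
    rw [Finset.sum_comm]
    exact Finset.sum_congr rfl fun i _ => Finset.sum_congr rfl fun j _ => by ring
  intro i
  rw [hca]
  exact Finset.sum_eq_zero fun j _ => by
    rw [linearIndependent_subfield_iff.1 hl (fun i => c i j) (fun i => hc i j) (h1 j) i, zero_mul]

/-- The elements with a `p ^ n`-th power in `M` for some `n`. -/
def perfClosure (p : ℕ) [Fact p.Prime] [CharP F p] (M : Subfield F) : Subfield F where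
  carrier := {x | ∃ n : ℕ, x ^ p ^ n ∈ M}
  zero_mem' := ⟨0, by simp⟩
  one_mem' := ⟨0, by simp⟩
  add_mem' := by
    rintro x y ⟨n, hn⟩ ⟨m, hm⟩
    refine ⟨n + m, ?_⟩
    rw [add_pow_char_pow]
    exact M.add_mem (by rw [pow_add, pow_mul]; exact M.pow_mem hn _)
      (by rw [add_comm, pow_add, pow_mul]; exact M.pow_mem hm _)
  mul_mem' := by
    rintro x y ⟨n, hn⟩ ⟨m, hm⟩
    refine ⟨n + m, ?_⟩
    rw [mul_pow]
    exact M.mul_mem (by rw [pow_add, pow_mul]; exact M.pow_mem hn _)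
      (by rw [add_comm, pow_add, pow_mul]; exact M.pow_mem hm _)
  neg_mem' := by
    rintro x ⟨n, hn⟩
    refine ⟨n, ?_⟩
    rw [neg_pow]
    exact M.mul_mem (M.pow_mem (M.neg_mem M.one_mem) _) hn
  inv_mem' := by
    rintro x ⟨n, hn⟩
    exact ⟨n, by rw [inv_pow]; exact M.inv_mem hn⟩

variable (p : ℕ) [Fact p.Prime] [CharP F p]

theorem le_perfClosure : M ≤ perfClosure p M := fun x hx => ⟨0, by simpa using hx⟩

theorem perfClosure_le_algClosure : perfClosure p M ≤ algClosure M := by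
  rintro x ⟨n, hn⟩
  exact mem_algClosure.2 (IsAlgebraic.of_pow (pow_pos (Fact.out : p.Prime).pos n)
    (isAlgebraic_algebraMap (⟨_, hn⟩ : M)))

theorem algClosure_perfClosure : algClosure (perfClosure p M) = algClosure M := by
  refine le_antisymm (fun x hx => mem_algClosure.2 ?_) fun x hx =>
    mem_algClosure.2 (isAlgebraic_mono (le_perfClosure p) (mem_algClosure.1 hx))
  exact isAlgebraic_trans (fun y hy => mem_algClosure.1 (perfClosure_le_algClosure p hy))
    (le_perfClosure p) (mem_algClosure.1 hx)

theorem exists_pow_perfClosure [IsAlgClosed F] {x : F} (hx : x ∈ perfClosure p M) :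
    ∃ z ∈ perfClosure p M, z ^ p = x := by
  obtain ⟨n, hn⟩ := hx
  obtain ⟨z, hz⟩ := IsAlgClosed.exists_pow_nat_eq x (Fact.out : p.Prime).pos
  exact ⟨z, ⟨n + 1, by rw [pow_succ', pow_mul, hz]; exact hn⟩, hz⟩

end LinearDisjointness

section FixedElements

variable {Ω : Type*} [NormedField Ω] [IsUltrametricDist Ω]

/-- Elements fixed by all automorphisms over `M` are purely inseparable over `M`. -/
theorem mem_perfClosure_of_fixed (p : ℕ) [Fact p.Prime] [CharP Ω p] [IsAlgClosed Ω]
    {M : Subfield Ω} (hM : ∀ x : Ω, IsAlgebraic M x) {x : Ω} (hx : ∀ σ : Ω ≃ₐ[M] Ω, σ x = x) :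
    x ∈ perfClosure p M := by
  classical
  obtain ⟨n, hn⟩ := exists_sepOver_pow p (hM x)
  refine ⟨n, ?_⟩
  set y := x ^ p ^ n with hy
  have hroots : ∀ c ∈ ((minpoly M y).map (algebraMap M Ω)).roots, c = y := by
    intro c hc
    have hc' := (Polynomial.mem_roots'.1 hc).2
    rw [Polynomial.IsRoot.def, Polynomial.eval_map_algebraMap] at hc'
    obtain ⟨σ, rfl⟩ := exists_algEquiv_of_root hM hc'
    rw [hy, map_pow, hx]
  have hcard : ((minpoly M y).map (algebraMap M Ω)).roots.card ≤ 1 := by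
    rw [Multiset.eq_replicate_card.2 hroots]
    have hnd := Polynomial.nodup_roots (Polynomial.Separable.map (f := algebraMap M Ω) hn)
    rw [Multiset.eq_replicate_card.2 hroots] at hnd
    simpa using (Multiset.nodup_iff_count_le_one.1 hnd) y
  have hsplit := (IsAlgClosed.splits ((minpoly M y).map (algebraMap M Ω))).natDegree_eq_card_roots
  rw [Polynomial.natDegree_map] at hsplit
  have hd : (minpoly M y).degree = 1 := by
    refine (Polynomial.degree_eq_iff_natDegree_eq_of_pos Nat.one_pos).2 ?_
    exact le_antisymm (hsplit ▸ hcard) (minpoly.natDegree_pos (hM y).isIntegral)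
  obtain ⟨z, hz⟩ := minpoly.mem_range_of_degree_eq_one M y hd
  rw [← hz]
  exact z.2

end FixedElements

/-! ### Towers of roots of a uniformizer -/

section RootTowers

variable {Ω : Type*} [NormedField Ω] [IsUltrametricDist Ω] {K L X E k : Subfield Ω} {π : Ω}
variable {p : ℕ} [Fact p.Prime] [CharP Ω p] {ϖ : ℕ → Ω}

/-- The sequence of the roots `ϖ n` of order `p ^ n` of `π`, each of which generates all roots of
this order of elements of `k`. -/
structure IsRootTower (p : ℕ) (k : Subfield Ω) (π : Ω) (ϖ : ℕ → Ω) : Prop where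
  pow_eq : ∀ n, ϖ n ^ p ^ n = π
  mem_adj : ∀ n x, x ^ p ^ n ∈ k → x ∈ adj k {ϖ n}

theorem IsRootTower.eq_pow (h : IsRootTower p k π ϖ) {n m : ℕ} (hnm : n ≤ m) :
    ϖ n = ϖ m ^ p ^ (m - n) := by
  refine pow_p_injective p n ?_
  simp only
  rw [h.pow_eq, ← pow_mul, ← pow_add, Nat.sub_add_cancel hnm, h.pow_eq]

/-- The field generated by finitely many unramified elements and one root. -/
def rootLevel (X : Subfield Ω) (Z : Finset Ω) (w : Ω) : Subfield Ω := adj X (Z ∪ {w})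

theorem le_rootLevel (Z : Finset Ω) (w : Ω) : X ≤ rootLevel X Z w := le_adj _ _

theorem mem_rootLevel (Z : Finset Ω) (w : Ω) : w ∈ rootLevel X Z w :=
  subset_adj _ _ (Set.mem_union_right _ (Set.mem_singleton w))

theorem rootLevel_eq (Z : Finset Ω) (w : Ω) : rootLevel X Z w = adj (adj X {w}) Z := by
  rw [adj_adj, Set.union_comm]; rfl

theorem IsRootTower.rootLevel_le (h : IsRootTower p k π ϖ) {Z Z' : Finset Ω} (hZ : Z ⊆ Z')
    {n m : ℕ} (hnm : n ≤ m) : rootLevel X Z (ϖ n) ≤ rootLevel X Z' (ϖ m) := by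
  refine adj_le (le_rootLevel _ _) (Set.union_subset (fun b hb =>
    subset_adj _ _ (Or.inl (hZ hb))) (Set.singleton_subset_iff.2 ?_))
  rw [h.eq_pow hnm]
  exact Subfield.pow_mem _ (mem_rootLevel _ _) _

theorem IsRootTower.exists_finset_subset [DecidableEq Ω] (h : IsRootTower p k π ϖ) (hk : k ≤ X)
    (T : Finset Ω) (hT : (T : Set Ω) ⊆ adj X ({b | IsEtaleElement E b} ∪ perfClosure p k)) :
    ∃ Z : Finset Ω, ∃ n, (∀ b ∈ Z, IsEtaleElement E b) ∧ (T : Set Ω) ⊆ rootLevel X Z (ϖ n) := by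
  obtain ⟨S, hS, hTS⟩ := exists_finset_subset_adj T hT
  suffices ∃ Z : Finset Ω, ∃ n, (∀ b ∈ Z, IsEtaleElement E b) ∧
      (S : Set Ω) ⊆ rootLevel X Z (ϖ n) by
    obtain ⟨Z, n, hZ, hSZ⟩ := this
    exact ⟨Z, n, hZ, hTS.trans (adj_le (le_rootLevel _ _) hSZ)⟩
  clear hTS hT
  induction S using Finset.induction_on with
  | empty => exact ⟨∅, 0, by simp, by simp⟩
  | insert a S _ ih =>
    rw [Finset.coe_insert, Set.insert_subset_iff] at hS
    obtain ⟨Z, n, hZ, hSZ⟩ := ih hS.2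
    rcases hS.1 with ha | ⟨m, hm⟩
    · refine ⟨insert a Z, n, fun b hb => ?_, ?_⟩
      · rcases Finset.mem_insert.1 hb with rfl | hb
        · exact ha
        · exact hZ b hb
      · rw [Finset.coe_insert, Set.insert_subset_iff]
        exact ⟨subset_adj _ _ (Or.inl (Finset.mem_insert_self a Z)),
          hSZ.trans (h.rootLevel_le (Finset.subset_insert a Z) le_rfl)⟩
    · refine ⟨Z, max n m, hZ, ?_⟩
      rw [Finset.coe_insert, Set.insert_subset_iff]
      refine ⟨h.rootLevel_le (X := X) le_rfl (le_max_right n m) ?_,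
        hSZ.trans (h.rootLevel_le le_rfl (le_max_left n m))⟩
      exact adj_mono hk Set.subset_union_right (h.mem_adj m a hm)

/-- The residues of the field generated by the unramified elements and the constants come from
fields generated by finitely many unramified elements and a root `ϖ n`. -/
theorem IsRootTower.exists_residue_mem [IsAlgClosed Ω] (h : IsRootTower p k π ϖ)
    (hb : IsConstantBase p E k π) (hX : E ≤ X) {ι : Type*} [Fintype ι] {y : ι → BigResidue Ω}
    (hy : ∀ i, y i ∈ residueSubfield (adj X (unramifiedConstants E k))) :
    ∃ Z : Finset Ω, ∃ n, (∀ b ∈ Z, IsEtaleElement E b) ∧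
      ∀ i, y i ∈ residueSubfield (rootLevel X Z (ϖ n)) := by
  classical
  set Y := adj X ({b | IsEtaleElement E b} ∪ perfClosure p k) with hY
  have hXY : X ≤ Y := le_adj _ _
  have hle : adj X (unramifiedConstants E k) ≤ Y ⊔ algClosure (perfClosure p k) := by
    rw [algClosure_perfClosure]
    refine adj_le (hXY.trans le_sup_left) (Set.union_subset (fun b hb => ?_) fun b hb => ?_)
    · exact (le_sup_left : Y ≤ _) (subset_adj _ _ (Or.inl hb))
    · exact (le_sup_right : _ ≤ Y ⊔ _) hb
  have hres := residueSubfield_sup_algClosure (p := p) (hb.isNormBase.mono (hX.trans hXY))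
    (P := perfClosure p k) (fun b hb => subset_adj _ _ (Or.inr hb))
    (fun y hy => exists_pow_perfClosure p hy) (fun z => by
      obtain ⟨n, b, hbe, hbz⟩ := hb.exists_isEtaleElement_res_eq_pow z
      exact ⟨n, hbz ▸ res_mem (subset_adj _ _ (Or.inl hbe))⟩)
  choose v hv hv1 hvy using fun i =>
    mem_residueSubfield.1 (hres (residueSubfield_mono hle (hy i)))
  obtain ⟨Z, n, hZ, hT⟩ := h.exists_finset_subset (E := E) ((hb.le.trans hX))
    (Finset.univ.image v) (by
      intro x hx
      obtain ⟨i, -, rfl⟩ := Finset.mem_image.1 (Finset.mem_coe.1 hx)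
      exact hv i)
  exact ⟨Z, n, hZ, fun i => hvy i ▸ res_mem (hT (Finset.mem_coe.2
    (Finset.mem_image_of_mem v (Finset.mem_univ i))))⟩

theorem algEquiv_mem_algClosure (hk : k ≤ X) (σ : Ω ≃ₐ[X] Ω) {x : Ω} (hx : x ∈ algClosure k) :
    σ x ∈ algClosure k := by
  obtain ⟨q, hq0, hq⟩ := mem_algClosure.1 hx
  refine mem_algClosure.2 ⟨q, hq0, ?_⟩
  have h1 := Polynomial.hom_eval₂ q (algebraMap k Ω) (σ : Ω →+* Ω) x
  rw [← Polynomial.aeval_def, hq, map_zero] at h1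
  have h2 : (σ : Ω →+* Ω).comp (algebraMap k Ω) = algebraMap k Ω := by
    ext a
    exact σ.commutes ⟨a, hk a.2⟩
  rw [h2] at h1
  exact h1.symm

theorem isStable_unramifiedConstants (hb : IsConstantBase p E k π) (hX : E ≤ X) :
    IsStable X (adj X (unramifiedConstants E k)) := by
  refine isStable_adj fun σ hσ x hx => ?_
  rcases hx with hx | hx
  · exact Or.inl (IsEtaleElement.algEquiv hx (hb.isNormBase.mono hX) hX
      (AlgEquiv.ofRingEquiv (f := σ) fun a => hσ a a.2))
  · exact Or.inr (algEquiv_mem_algClosure (hb.le.trans hX)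
      (AlgEquiv.ofRingEquiv (f := σ) fun a => hσ a a.2) hx)

/-- If `L` contains no elements of the field `A` generated by `K`, the unramified elements and the
constants, except those of `K`, then `L` and `A` are linearly disjoint over `K`.  The coefficients
of a relation over `A` may be taken to be fixed by the automorphisms over `L`.  Then they are purely
inseparable over `K`, hence lie in some `K (ϖ n)`. -/
theorem IsRootTower.linearIndependent [IsAlgClosed Ω] (h : IsRootTower p k π ϖ)
    (hb : IsConstantBase p E k π) (hK : E ≤ K) (hKL : K ≤ L)
    (hinf : ∀ x ∈ L, x ∈ adj K (unramifiedConstants E k) → x ∈ K) (hπ : ∀ z ∈ K, z ^ p ≠ π)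
    {ι : Type*} [Fintype ι] {b : ι → Ω} (hbL : ∀ i, b i ∈ L) (hl : LinearIndependent K b) :
    LinearIndependent (adj K (unramifiedConstants E k)) b := by
  classical
  have hp : p.Prime := Fact.out
  have hn := hb.isNormBase
  refine linearIndependent_of_fixed (G := {σ | ∀ x ∈ L, σ x = x})
    (fun σ hσ x hx => isStable_unramifiedConstants hb hK σ (fun a ha => hσ a (hKL ha)) x hx)
    (fun σ hσ i => hσ _ (hbL i)) fun a ha hσa hab => ?_
  have hpure : ∀ i, a i ∈ perfClosure p K := by
    intro i
    obtain ⟨t, ht⟩ := mem_perfClosure_of_fixed p (hn.mono (hK.trans hKL)).isAlgebraic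
      (fun σ => hσa σ.toRingEquiv (fun x hx => σ.commutes ⟨x, hx⟩) i)
    exact ⟨t, hinf _ ht (Subfield.pow_mem _ (ha i) _)⟩
  have hD : ∀ i, a i ∈ adj K (perfClosure p k : Set Ω) := by
    intro i
    obtain ⟨t, ht⟩ := hpure i
    refine mem_of_sepOver_of_pow_mem p (sepOver_of_mem_adj (S := unramifiedConstants E k) ?_
      (adj_mono (le_adj _ _) le_rfl (ha i))) (n := t) (le_adj _ _ ht)
    rintro x (hx | hx)
    · exact (hx.sepOver).mono (hK.trans (le_adj _ _))
    · rw [← algClosure_perfClosure p] at hx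
      exact (sepOver_of_perfect p (fun y hy => exists_pow_perfClosure p hy)
        (mem_algClosure.1 hx)).mono (subset_adj _ _)
  obtain ⟨Z, n, hZ, hT⟩ := h.exists_finset_subset (E := E) ((hb.le.trans hK))
    (Finset.univ.image a) (by
      intro x hx
      obtain ⟨i, -, rfl⟩ := Finset.mem_image.1 (Finset.mem_coe.1 hx)
      exact adj_mono le_rfl Set.subset_union_right (hD i))
  -- a purely inseparable element of a separable extension of `K (ϖ n)` lies in `K (ϖ n)`
  have hlev : ∀ i, a i ∈ adj K {ϖ n} := by
    intro i
    obtain ⟨t, ht⟩ := hpure i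
    have h1 : a i ∈ rootLevel K Z (ϖ n) :=
      hT (Finset.mem_coe.2 (Finset.mem_image_of_mem a (Finset.mem_univ i)))
    rw [rootLevel_eq] at h1
    exact mem_of_sepOver_of_pow_mem p (sepOver_of_mem_adj
      (fun x hx => ((hZ x hx).sepOver).mono (hK.trans (le_adj _ _))) h1) (n := t) (le_adj _ _ ht)
  have hπL : ∀ z ∈ L, z ^ p ≠ π := by
    intro z hz hzp
    refine hπ z (hinf z hz (subset_adj _ _ (Or.inr (mem_algClosure.2 ?_)))) hzp
    refine IsAlgebraic.of_pow hp.pos ?_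
    rw [hzp]
    exact isAlgebraic_algebraMap (⟨π, hb.mem⟩ : k)
  have hadj := linearIndependent_adj_root p (w := ϖ n) (n := n) hKL hbL hl
    (by rw [h.pow_eq]; exact hK (hb.le hb.mem)) (by rw [h.pow_eq]; exact hπL)
  exact linearIndependent_subfield_iff.1 hadj a hlev hab

/-- If a totally ramified extension of `X` has a constant uniformizer `s`, then `X` has a constant
uniformizer: the norm of `s`, which is a product of conjugates of `s`. -/
theorem exists_constant_norm_eq (p : ℕ) [Fact p.Prime] [CharP Ω p] [IsAlgClosed Ω]
    {S : Subfield Ω} {s t : Ω}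
    (hXn : IsNormBase X) (hXc : IsComplete (X : Set Ω)) (ht : IsUniformizer X t) (hXS : X ≤ S)
    (hs : IsUniformizer S s) (hres : ∀ x ∈ S, ‖x‖ ≤ 1 → ∃ y ∈ X, ‖x - y‖ < 1)
    (hk : k ≤ X) (hsk : s ∈ algClosure k) : ∃ c ∈ X, c ∈ algClosure k ∧ ‖c‖ = ‖t‖ := by
  obtain ⟨e, he⟩ := hs.exists_zpow t (hXS ht.mem) ht.ne_zero
  have he0 : 0 < e := hs.zpow_lt_iff.1 (by rw [← he, zpow_zero]; exact ht.norm_lt)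
  lift e to ℕ using he0.le
  rw [zpow_natCast] at he
  have hsp : Spans X S (fun i : Fin e => s ^ (i : ℕ)) := by
    refine spans_of_approx p hXc ht.mem ht.ne_zero ht.norm_lt hXS (fun i => S.pow_mem hs.mem _)
      fun x hx hx1 => ?_
    obtain ⟨a, ha, hxa⟩ := exists_expansion hs (S := {y | y ∈ X ∧ ‖y‖ ≤ 1})
      (fun y hy => hXS hy.1) (fun x hx hx1 => by
        obtain ⟨y, hy, hxy⟩ := hres x hx hx1
        exact ⟨y, ⟨hy, norm_le_one_of_sub hx1 hxy⟩, hxy⟩) e hx hx1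
    exact ⟨a, fun i => (ha i).1, fun i => (ha i).2, by rw [he]; exact hxa⟩
  set f := minpoly X s with hf
  have hd : f.natDegree ≤ e := by
    have h1 := (hsp.finiteOver hXS).natDegree_minpoly_le hs.mem
    have h2 := hsp.relfinrank_le hXS
    rw [Fintype.card_fin] at h2
    exact h1.trans h2
  have hd0 : 0 < f.natDegree := minpoly.natDegree_pos (hXn.isAlgebraic s).isIntegral
  have hc0 : ‖((f.coeff 0 : X) : Ω)‖ = ‖s‖ ^ f.natDegree := norm_coeff_zero_minpoly hXn s
  have hne : ((f.coeff 0 : X) : Ω) ≠ 0 := by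
    rw [← norm_ne_zero_iff, hc0]
    exact pow_ne_zero _ hs.norm_pos.ne'
  refine ⟨_, (f.coeff 0).2, ?_, ?_⟩
  · rw [hf, coeff_zero_minpoly hXn]
    refine Subfield.mul_mem _ (Subfield.pow_mem _ (Subfield.neg_mem _ (Subfield.one_mem _)) _)
      (Subfield.multiset_prod_mem _ _ fun r hr => ?_)
    obtain ⟨σ, rfl⟩ := exists_algEquiv_of_mem_roots hXn hr
    exact algEquiv_mem_algClosure hk σ hsk
  · -- the degree is a positive multiple of `e`
    obtain ⟨n, hn⟩ := ht.exists_zpow _ (f.coeff 0).2 hne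
    have h1 : (e : ℤ) * n = f.natDegree := by
      refine hs.zpow_inj.1 ?_
      rw [zpow_mul, zpow_natCast, ← he, ← hn, hc0, zpow_natCast]
    have h2 : n = 1 := by
      nlinarith
    rw [hn, h2, zpow_one]

end RootTowers

/-! ### Inseparable degrees of subfield extensions -/

section InseparableDegrees

variable {F : Type*} [Field F] {M N P M₁ N₁ M₂ N₂ : Subfield F}

/-- The inseparable degree is multiplicative in towers of subfields. -/
theorem finInsepDegree_mul (h : M ≤ N) (h' : N ≤ P) (hal : ∀ x ∈ N, IsAlgebraic M x) :
    Field.finInsepDegree M (Subfield.extendScalars h) *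
      Field.finInsepDegree N (Subfield.extendScalars h') =
      Field.finInsepDegree M (Subfield.extendScalars (h.trans h')) := by
  let : Algebra M N := (Subfield.inclusion h).toAlgebra
  let : Algebra N P := (Subfield.inclusion h').toAlgebra
  let : Algebra M P := (Subfield.inclusion (h.trans h')).toAlgebra
  have : IsScalarTower M N P := IsScalarTower.of_algebraMap_eq fun _ => rfl
  have : IsScalarTower M N F := IsScalarTower.of_algebraMap_eq fun _ => rfl
  have : Algebra.IsAlgebraic M N := ⟨fun x =>
    (isAlgebraic_algebraMap_iff (A := F) Subtype.val_injective).1 (hal x x.2)⟩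
  have e₁ : N ≃ₐ[M] Subfield.extendScalars h :=
    { toFun := fun x => ⟨x, x.2⟩, invFun := fun x => ⟨x, x.2⟩, left_inv := fun _ => rfl,
      right_inv := fun _ => rfl, map_mul' := fun _ _ => rfl, map_add' := fun _ _ => rfl,
      commutes' := fun _ => rfl }
  have e₂ : P ≃ₐ[N] Subfield.extendScalars h' :=
    { toFun := fun x => ⟨x, x.2⟩, invFun := fun x => ⟨x, x.2⟩, left_inv := fun _ => rfl,
      right_inv := fun _ => rfl, map_mul' := fun _ _ => rfl, map_add' := fun _ _ => rfl,
      commutes' := fun _ => rfl }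
  have e₃ : P ≃ₐ[M] Subfield.extendScalars (h.trans h') :=
    { toFun := fun x => ⟨x, x.2⟩, invFun := fun x => ⟨x, x.2⟩, left_inv := fun _ => rfl,
      right_inv := fun _ => rfl, map_mul' := fun _ _ => rfl, map_add' := fun _ _ => rfl,
      commutes' := fun _ => rfl }
  rw [← Field.finInsepDegree_eq_of_equiv _ _ _ e₁, ← Field.finInsepDegree_eq_of_equiv _ _ _ e₂,
    ← Field.finInsepDegree_eq_of_equiv _ _ _ e₃]
  exact Field.finInsepDegree_mul_finInsepDegree_of_isAlgebraic M N P

theorem isSeparable_extendScalars (h : M ≤ N) (hsep : ∀ x ∈ N, SepOver M x) :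
    Algebra.IsSeparable M (Subfield.extendScalars h) :=
  ⟨fun x => (isSeparable_map_iff (Subfield.extendScalars h).val
    Subtype.val_injective).1 (hsep x x.2)⟩

theorem isPurelyInseparable_extendScalars (p : ℕ) [Fact p.Prime] [CharP F p] (h : M ≤ N)
    (hN : N ≤ perfClosure p M) : IsPurelyInseparable M (Subfield.extendScalars h) := by
  have := charP_subfield p M
  refine (isPurelyInseparable_iff_pow_mem M p).2 fun x => ?_
  obtain ⟨n, hn⟩ := hN x.2
  exact ⟨n, ⟨_, hn⟩, Subtype.ext rfl⟩

/-- The inseparable degree of an extension is the degree of a purely inseparable extension which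
is obtained from it by separable extensions of both fields. -/
theorem finInsepDegree_eq_relfinrank (p : ℕ) [Fact p.Prime] [CharP F p] (h₁ : M₁ ≤ N₁)
    (hM : M₁ ≤ M₂) (hN : N₁ ≤ N₂) (h₂ : M₂ ≤ N₂) (hsM : ∀ x ∈ M₂, SepOver M₁ x)
    (hsN : ∀ x ∈ N₂, SepOver N₁ x) (hal : ∀ x ∈ N₁, IsAlgebraic M₁ x)
    (hp : N₂ ≤ perfClosure p M₂) :
    Field.finInsepDegree M₁ (Subfield.extendScalars h₁) = M₂.relfinrank N₂ := by
  have := isSeparable_extendScalars hM hsM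
  have := isSeparable_extendScalars hN hsN
  have := isPurelyInseparable_extendScalars p h₂ hp
  have h3 := finInsepDegree_mul h₁ hN hal
  have h4 := finInsepDegree_mul hM h₂ fun x hx => (hsM x hx).isIntegral.isAlgebraic
  rw [Algebra.IsSeparable.finInsepDegree_eq N₁ (Subfield.extendScalars hN), mul_one] at h3
  rw [Algebra.IsSeparable.finInsepDegree_eq M₁ (Subfield.extendScalars hM), one_mul,
    IsPurelyInseparable.finInsepDegree_eq] at h4
  rw [h3, ← h4, Subfield.relfinrank_eq_finrank_of_le h₂]

end InseparableDegrees

/-! ### Ferocious ramification and almost standard fields -/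

section Ramification

variable {Ω : Type*} [NormedField Ω] [IsUltrametricDist Ω] {B K L X E k : Subfield Ω} {π : Ω}
variable {p : ℕ} [Fact p.Prime] [CharP Ω p] {ϖ : ℕ → Ω}

theorem isUnramifiedExt_adj [IsAlgClosed Ω] (hX : IsNormBase X) (Z : Finset Ω)
    (hZ : ∀ b ∈ Z, IsEtaleElement X b) : IsUnramifiedExt X (adj X Z) := by
  obtain ⟨h1, h2⟩ := isResidual_adj hX Z hZ
  refine ⟨h1.1.1, (finiteOver_iff _).1 h1.1, isSeparable_extendScalars _ h2, ?_⟩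
  rw [← Subfield.relfinrank_eq_finrank_of_le, ← Subfield.relfinrank_eq_finrank_of_le, h1.eq]

theorem IsRootTower.mem_unramifiedConstants (h : IsRootTower p k π ϖ)
    (hb : IsConstantBase p E k π) (n : ℕ) : ϖ n ∈ unramifiedConstants E k :=
  Or.inr (perfClosure_le_algClosure p ⟨n, by rw [h.pow_eq]; exact hb.mem⟩)

theorem IsRootTower.rootLevel_le_adj (h : IsRootTower p k π ϖ) (hb : IsConstantBase p E k π)
    {Z : Finset Ω} (hZ : ∀ b ∈ Z, IsEtaleElement E b) (n : ℕ) :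
    rootLevel X Z (ϖ n) ≤ adj X (unramifiedConstants E k) :=
  adj_mono le_rfl (Set.union_subset (fun b hb => Or.inl (hZ b hb))
    (Set.singleton_subset_iff.2 (h.mem_unramifiedConstants hb n)))

theorem isResidual_adj_unramifiedConstants [IsAlgClosed Ω] (hb : IsConstantBase p E k π)
    (hX : FiniteOver E X) :
    IsResidual (adj E (unramifiedConstants E k)) (adj X (unramifiedConstants E k)) := by
  obtain ⟨b, hbX, -, hbs⟩ := hX.exists_basis
  refine hb.isConstantClosed.isResidual (hb.isNormBase.mono (le_adj _ _)) ?_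
  have h1 := Spans.finiteOver le_sup_left (hbs.sup hX.1 hbX (le_adj E (unramifiedConstants E k)))
  rwa [adj_sup, sup_eq_right.2 hX.1] at h1

/-- Over a large field `K (ϖ n)`, the extension `L / K` becomes ferociously ramified.  A basis of
the residues of the extension `adj L u / adj K u` of degree `[L : K]` consists of residues of some
`rootLevel L Z' (ϖ n)`; for large `Z'` these residues are purely inseparable over
`rootLevel K Z' (ϖ n)`. -/
theorem IsRootTower.exists_isFerocious [IsAlgClosed Ω] (h : IsRootTower p k π ϖ)
    (hb : IsConstantBase p E k π) (hK : FiniteOver E K) (hKL : FiniteOver K L)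
    (hinf : ∀ x ∈ L, x ∈ adj K (unramifiedConstants E k) → x ∈ K) (hπ : ∀ z ∈ K, z ^ p ≠ π) :
    ∃ n₀, ∀ n ≥ n₀, IsFerocious (adj K {ϖ n}) (adj L {ϖ n}) := by
  classical
  have := charP_bigResidue (Ω := Ω) p
  set u := unramifiedConstants E k with hu
  have hN := hb.isNormBase
  obtain ⟨b, hbL, hbl, hbs⟩ := hKL.exists_basis
  have hli := h.linearIndependent hb hK.1 hKL.1 hinf hπ hbL hbl
  -- the degree over a field between `K` and the field generated by `u` is the one of `L / K`
  have hdeg : ∀ X Y : Subfield Ω, K ≤ X → X ≤ adj K u → X ⊔ L = Y →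
      FiniteOver X Y ∧ X.relfinrank Y = K.relfinrank L := by
    rintro X _ hKX hX rfl
    have hs := hbs.sup hKL.1 hbL hKX
    have hf := Spans.finiteOver le_sup_left hs
    refine ⟨hf, le_antisymm ?_ ?_⟩
    · simpa using hs.relfinrank_le le_sup_left
    · have h1 := hf.card_le (fun i => (le_sup_right : L ≤ X ⊔ L) (hbL i))
        (linearIndependent_subfield_iff.2 fun a ha hab =>
          linearIndependent_subfield_iff.1 hli a (fun i => hX (ha i)) hab)
      simpa using h1
  obtain ⟨hAN, hANd⟩ := hdeg (adj K u) (adj L u) (le_adj _ _) le_rfl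
    (by rw [adj_sup, sup_eq_right.2 hKL.1])
  have hres : IsResidual (adj K u) (adj L u) :=
    ((isResidual_adj_unramifiedConstants hb (hK.trans hKL)).of_trans (adj_mono hK.1 le_rfl)
      (adj_mono hKL.1 le_rfl)).2
  obtain ⟨v, hvN, hv1, hvl, -⟩ := hres.exists_basis
  obtain ⟨Z, n₀, hZ, hvZ⟩ := h.exists_residue_mem hb (hK.1.trans hKL.1)
    (y := fun i => res (v i)) fun i => res_mem (hvN i)
  choose q z hz hzv using fun i => hb.exists_isEtaleElement_res_eq_pow (res (v i))
  refine ⟨n₀, fun n hn => ?_⟩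
  set Z' := Z ∪ Finset.univ.image z with hZ'
  have hZe : ∀ b ∈ Z', IsEtaleElement E b := by
    intro x hx
    rcases Finset.mem_union.1 hx with hx | hx
    · exact hZ x hx
    · obtain ⟨i, -, rfl⟩ := Finset.mem_image.1 hx
      exact hz i
  set X' := rootLevel K Z' (ϖ n) with hX'
  set Y' := rootLevel L Z' (ϖ n) with hY'
  have hXA : X' ≤ adj K u := h.rootLevel_le_adj hb hZe n
  obtain ⟨hXY, hXYd⟩ := hdeg X' Y' (le_rootLevel _ _) hXA
    (by rw [hX', rootLevel, adj_sup, sup_eq_right.2 hKL.1, hY', rootLevel])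
  have hvY : ∀ i, res (v i) ∈ residueSubfield Y' := fun i =>
    residueSubfield_mono (h.rootLevel_le Finset.subset_union_left hn) (hvZ i)
  have hvl' : LinearIndependent (residueSubfield X') (fun i => res (v i)) :=
    linearIndependent_subfield_iff.2 fun a ha hab =>
      linearIndependent_subfield_iff.1 hvl a (fun i => residueSubfield_mono hXA (ha i)) hab
  have hrd : (residueSubfield X').relfinrank (residueSubfield Y') = K.relfinrank L := by
    refine le_antisymm (hXYd ▸ hXY.relfinrank_residue_le) ?_
    have := hXY.residue.card_le hvY hvl'
    rwa [Fintype.card_fin, hANd] at this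
  have hvs : Spans (residueSubfield X') (residueSubfield Y') (fun i => res (v i)) :=
    hXY.residue.spans_of_card hvY hvl' (by rw [Fintype.card_fin, hANd, hrd])
  have hperf : residueSubfield Y' ≤ perfClosure p (residueSubfield X') := by
    refine hvs.le (le_perfClosure p) fun i => ⟨q i, ?_⟩
    rw [← hzv]
    refine res_mem (subset_adj _ _ (Or.inl (Finset.mem_coe.2
      (Finset.mem_union_right _ (Finset.mem_image_of_mem z (Finset.mem_univ i))))))
  have hϖ : ∀ X, adj X {ϖ n} ≤ adj X u := fun X => adj_mono le_rfl
    (Set.singleton_subset_iff.2 (h.mem_unramifiedConstants hb n))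
  obtain ⟨h1, h1d⟩ := hdeg (adj K {ϖ n}) (adj L {ϖ n}) (le_adj _ _) (hϖ K)
    (by rw [adj_sup, sup_eq_right.2 hKL.1])
  have hsep : ∀ X, E ≤ X → ∀ y ∈ residueSubfield (rootLevel X Z' (ϖ n)),
      SepOver (residueSubfield (adj X {ϖ n})) y := by
    intro X hX
    rw [rootLevel_eq]
    exact (isResidual_adj (hN.mono (hX.trans (le_adj _ _))) Z' fun b hb =>
      (hZe b hb).mono (hX.trans (le_adj _ _))).2
  have hle : adj K {ϖ n} ≤ adj L {ϖ n} := adj_mono hKL.1 le_rfl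
  refine ⟨hle, (finiteOver_iff _).1 h1, ?_⟩
  rw [← Subfield.relfinrank_eq_finrank_of_le, h1d, ← hrd]
  refine (finInsepDegree_eq_relfinrank p (residueSubfield_mono hle)
    (residueSubfield_mono (adj_mono le_rfl Set.subset_union_right))
    (residueSubfield_mono (adj_mono le_rfl Set.subset_union_right)) (residueSubfield_mono hXY.1)
    (hsep K hK.1) (hsep L (hK.1.trans hKL.1)) (fun x hx => h1.residue.isAlgebraic hx) hperf).symm

theorem mem_constantSubfield (hBk : k ≤ constantSubfield p B K) (hKX : K ≤ X) {c : Ω}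
    (hc : c ∈ algClosure k) (hcX : c ∈ X) : c ∈ constantSubfield p B X := by
  have h1 : constantBase p B K ≤ constantBase p B X := by
    refine inf_le_inf (Subfield.topologicalClosure_minimal _ (le_trans ?_
      (Subfield.le_topologicalClosure _)) (Subfield.isClosed_topologicalClosure _)) hKX
    refine Subfield.closure_mono (Set.union_subset_union le_rfl ?_)
    rintro x ⟨x', hx, hxK, hr, hroot⟩
    refine ⟨x', hx, hKX hxK, fun n => ?_, fun n => ?_⟩
    · obtain ⟨z, hz, hzx⟩ := hr n
      exact ⟨z, residueSubfield_mono hKX hz, hzx⟩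
    · obtain ⟨z, hz, hzx⟩ := hroot n
      exact ⟨z, hKX hz, hzx⟩
  have h2 : k ≤ algClosure (constantBase p B X) := fun x hx =>
    mem_algClosure.2 (isAlgebraic_mono h1 (mem_algClosure.1 (hBk hx).1))
  exact ⟨mem_algClosure.2 (isAlgebraic_trans (fun y hy => mem_algClosure.1 hy) le_algClosure
    (isAlgebraic_mono h2 (mem_algClosure.1 hc))), hcX⟩

/-- The fields `K (ϖ n)` are almost standard for large `n`.  For a suitable field `M` of
`IsConstantBase.exists_level_subset`, the compositum `S` of `K` and `M` has the uniformizer of `M`,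
which is constant, and the residue field of an unramified extension `X'` of `K (ϖ n)`. -/
theorem IsRootTower.exists_isAlmostStandard [IsAlgClosed Ω] (h : IsRootTower p k π ϖ)
    (hb : IsConstantBase p E k π) (hK : FiniteOver E K) (hBk : k ≤ constantSubfield p B K) :
    ∃ n₀, ∀ n ≥ n₀, IsAlmostStandard p B (adj K {ϖ n}) := by
  classical
  set u := unramifiedConstants E k with hu
  have hN := hb.isNormBase
  have hnt : ∃ x ∈ E, x ≠ 0 ∧ ‖x‖ < 1 := ⟨π, hb.isUniformizer.mem, hb.isUniformizer.ne_zero,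
    hb.isUniformizer.norm_lt⟩
  have hA := isResidual_adj_unramifiedConstants hb hK
  obtain ⟨v₀, hv₀, hv₀1, hv₀l, -⟩ := hA.exists_basis
  obtain ⟨Z, n₀, hZ, hvZ⟩ := h.exists_residue_mem hb hK.1
    (y := fun i => res (v₀ i)) fun i => res_mem (hv₀ i)
  choose v hv hv1 hvv using fun i => mem_residueSubfield.1 (hvZ i)
  have hvl : LinearIndependent (residueSubfield (adj E u)) (fun i => res (v i)) := by
    simp only [hvv]; exact hv₀l
  have hvs : Spans (adj E u) (adj K u) v :=
    hA.spans (fun i => h.rootLevel_le_adj hb hZ n₀ (hv i)) hv1 hvl (by simp)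
  obtain ⟨g, hgK, -, hgs⟩ := hK.exists_basis
  choose a ha hag using fun j => hvs (g j) (le_adj _ _ (hgK j))
  refine ⟨n₀, fun n hn => ?_⟩
  obtain ⟨Z', c, s, hZZ', hZ', hc, hT, hs, hr⟩ := hb.exists_level_subset Z
    (insert (ϖ n) (Finset.univ.image fun ji : _ × _ => a ji.1 ji.2)) hZ (by
      rw [Finset.coe_insert, Set.insert_subset_iff]
      refine ⟨subset_adj _ _ (h.mem_unramifiedConstants hb n), fun x hx => ?_⟩
      obtain ⟨ji, -, rfl⟩ := Finset.mem_image.1 (Finset.mem_coe.1 hx)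
      exact ha _ _)
  set M := adj E (Z' ∪ c : Set Ω) with hM
  have hEM : E ≤ M := le_adj _ _
  have hMA : M ≤ adj E u := adj_mono le_rfl (Set.union_subset_union hZ' hc)
  have hϖM : ϖ n ∈ M := hT (Finset.mem_coe.2 (Finset.mem_insert_self _ _))
  have haM : ∀ j i, a j i ∈ M := fun j i => hT (Finset.mem_coe.2 (Finset.mem_insert_of_mem
    (Finset.mem_image_of_mem (fun ji : _ × _ => a ji.1 ji.2) (Finset.mem_univ (j, i)))))
  set X' := rootLevel K Z' (ϖ n) with hX'
  have hKX : K ≤ X' := le_rootLevel _ _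
  have hvX : ∀ i, v i ∈ X' := fun i => h.rootLevel_le hZZ' hn (hv i)
  set S := M ⊔ K with hS
  have hXS : X' ≤ S := by
    refine adj_le le_sup_right (Set.union_subset (fun b hb => ?_) (Set.singleton_subset_iff.2 ?_))
    · exact (le_sup_left : M ≤ S) (subset_adj _ _ (Or.inl hb))
    · exact (le_sup_left : M ≤ S) hϖM
  -- the basis of `K` and then all of `S` is expressed by the `v i`
  have hsp : Spans M S v := by
    intro x hx
    obtain ⟨d, hd, rfl⟩ := hgs.sup hK.1 hgK hEM x hx
    refine ⟨fun i => ∑ j, d j * a j i, fun i => M.sum_mem fun j _ => M.mul_mem (hd j) (haM j i), ?_⟩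
    simp only [Finset.sum_mul]
    rw [Finset.sum_comm]
    refine Finset.sum_congr rfl fun j _ => ?_
    rw [hag, Finset.mul_sum]
    exact Finset.sum_congr rfl fun i _ => by ring
  have hvlM : LinearIndependent (residueSubfield M) (fun i => res (v i)) :=
    linearIndependent_subfield_iff.2 fun d hd hdv =>
      linearIndependent_subfield_iff.1 hvl d (fun i => residueSubfield_mono hMA (hd i)) hdv
  have hsS : IsUniformizer S s := ⟨(le_sup_left : M ≤ S) hs.isUniformizer.mem,
    hs.isUniformizer.ne_zero, hs.isUniformizer.norm_lt, fun x hx hx0 => by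
      obtain ⟨y, hy, hy0, hxy⟩ := exists_norm_eq hsp hv1 hvlM hx hx0
      rw [hxy]
      exact hs.isUniformizer.exists_zpow y hy hy0⟩
  have hresS : residueSubfield S ≤ residueSubfield X' := by
    refine (spans_residue hsp hv1 hvlM).le (hr.trans (residueSubfield_mono ?_))
      fun i => res_mem (hvX i)
    exact adj_mono hK.1 Set.subset_union_left
  have hfin : FiniteOver E X' := hK.trans (finiteOver_adj
    (Set.Finite.union Z'.finite_toSet (Set.finite_singleton _))
      fun x _ => (hN.mono hK.1).isAlgebraic x)
  obtain ⟨t, ht⟩ := hfin.exists_isUniformizer hb.isUniformizer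
  obtain ⟨c₀, hc₀X, hc₀, hc₀t⟩ := exists_constant_norm_eq p (hN.mono hfin.1)
    (hfin.isComplete hb.isComplete hnt) ht hXS hsS
    (fun x hx hx1 => (res_mem_iff hx1).1 (hresS (res_mem hx))) (hb.le.trans hfin.1) hs.mem
  refine ⟨X', ?_, ?_⟩
  · rw [hX', rootLevel_eq]
    exact isUnramifiedExt_adj (hN.mono (hK.1.trans (le_adj _ _))) Z' fun b hb =>
      (hZ' b hb).mono (hK.1.trans (le_adj _ _))
  · refine ramIndex_eq_one fun x hx hx0 => ?_
    obtain ⟨m, hm⟩ := ht.exists_zpow x hx hx0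
    refine ⟨c₀ ^ m, Subfield.zpow_mem _ (mem_constantSubfield hBk hKX hc₀ hc₀X) m, ?_⟩
    rw [hm, norm_zpow, hc₀t]

end Ramification

/-! ### Construction of the constants and infernal extensions -/

section Construction

variable {Ω : Type*} [NormedField Ω] [IsUltrametricDist Ω] {B K L : Subfield Ω} {t : Ω}
variable {p : ℕ} [Fact p.Prime] [CharP Ω p]

/-- A complete discretely valued field is finite over a field of Laurent series in an element `π`
which has no `p`-th root and which is algebraic over the base subfield. -/
theorem exists_isConstantBase [IsAlgClosed Ω] (hal : ∀ x : Ω, IsAlgebraic K x)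
    (hK : IsComplete (K : Set Ω)) (ht : IsUniformizer K t) (hB : IsBaseSubfield p B K) :
    ∃ (E k : Subfield Ω) (π : Ω) (ϖ : ℕ → Ω), IsConstantBase p E k π ∧ IsRootTower p k π ϖ ∧
      FiniteOver E K ∧ k ≤ constantSubfield p B K ∧ ∀ z ∈ K, z ^ p ≠ π := by
  have hp : p.Prime := Fact.out
  obtain ⟨π₀, hπ₀, hπ₀0, hπ₀1⟩ := hB.nontrivial
  obtain ⟨π, hπ, ⟨j, hj⟩, hroot⟩ := exists_pow_eq_of_isUniformizer (p := p) ht (hB.le hπ₀) hπ₀0 hπ₀1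
  have hπ0 : π ≠ 0 := by
    rintro rfl
    exact hπ₀0 (by rw [← hj, zero_pow (pow_pos hp.pos j).ne'])
  have hπ1 : ‖π‖ < 1 := norm_lt_one_of_pow (n := p ^ j) (by rw [hj]; exact hπ₀1)
  obtain ⟨C, hCK, hC, hKC⟩ := exists_coefficientField p hK ht
  set R := perfectCore p K with hR
  have hRC : R ≤ C := perfectCore_le_coefficientField ht hCK hC hKC
  have hRK : R ≤ K := perfectCore_le p
  have hR1 : ∀ c ∈ R, c ≠ 0 → ‖c‖ = 1 := fun c hc => hC c (hRC hc)
  have hEK : laurent C π ≤ K := laurent_le hK.isClosed hCK hπ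
  have hkE : laurent R π ≤ laurent C π := laurent_le
    (Subfield.isClosed_topologicalClosure _) (hRC.trans le_laurent) mem_laurent
  have hfin : FiniteOver (laurent C π) K := finiteOver_laurent p hK ht hCK hKC hπ hπ0 hπ1
  choose ϖ hϖ using fun n : ℕ => IsAlgClosed.exists_pow_nat_eq π (pow_pos hp.pos n)
  refine ⟨laurent C π, laurent R π, π, ϖ, ?_, ⟨hϖ, fun n x hx => ?_⟩, hfin, fun x hx => ?_, hroot⟩
  · refine ⟨hkE, laurent_isComplete hK hCK hπ, laurent_isComplete hK hRK hπ,
      laurent_isUniformizer hC hπ0 hπ1, mem_laurent, fun y hy => ?_, fun x hx => ?_, fun x =>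
        isAlgebraic_trans (fun y hy => hfin.isAlgebraic hy) hEK (hal x)⟩
    · obtain ⟨x, hx, hx1, rfl⟩ := mem_residueSubfield.1 hy
      obtain ⟨c, hc, hxc⟩ := laurent_residue hR1 hπ0 hπ1 hx hx1
      have hc1 := norm_le_one_of_sub hx1 hxc
      obtain ⟨d, hd, rfl⟩ := exists_root_perfectCore p hc
      refine ⟨res d, res_mem (le_laurent hd), ?_⟩
      rw [← res_pow (norm_le_one_of_pow hp.ne_zero hc1), (res_eq_iff hx1 hc1).2 hxc]
    · refine le_laurent fun n => ?_
      obtain ⟨z, hz, hzx⟩ := hx n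
      exact ⟨z, hEK hz, hzx⟩
  · exact mem_adj_of_pow_mem_laurent hK hRK hR1 (fun c hc => exists_root_perfectCore p hc) hπ hπ0
      hπ1 (hϖ n) hx
  · exact ⟨mem_algClosure.2 (isAlgebraic_constantBase hK ht hB.le (by rw [hj]; exact hπ₀) hx),
      hEK (hkE hx)⟩

/-- An infernal extension contains no elements of the compositum of the constant and the unramified
extensions. -/
theorem IsInfernal.mem [IsAlgClosed Ω] {E k : Subfield Ω} {π : Ω} (hb : IsConstantBase p E k π)
    (hEK : E ≤ K) (hk : k ≤ constantSubfield p B K) (hL : IsInfernal p B K L) {x : Ω} (hx : x ∈ L)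
    (hxA : x ∈ adj K (unramifiedConstants E k)) : x ∈ K := by
  classical
  obtain ⟨T, hT, hxT⟩ := exists_finset_mem_adj hxA
  have hsub : adj K {x} ≤ L := adj_le hL.1.1 (Set.singleton_subset_iff.2 hx)
  have heq := hL.2 (adj K {x}) (le_adj _ _) hsub ⟨le_adj _ _,
    algClosure (constantSubfield p B K) ⊔ K, adj K (T.filter (IsEtaleElement E) : Finset Ω),
    ⟨algClosure (constantSubfield p B K), le_algClosure, ⟨fun y =>
      (isAlgebraic_algebraMap_iff (A := Ω) Subtype.val_injective).1 (mem_algClosure.1 y.2)⟩, rfl⟩,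
    isUnramifiedExt_adj (hb.isNormBase.mono hEK) _
      fun b hb => (Finset.mem_filter.1 hb).2.mono hEK, ?_⟩
  · rw [← heq]
    exact subset_adj _ _ (Set.mem_singleton x)
  · refine adj_le (le_sup_right.trans le_sup_left) (Set.singleton_subset_iff.2 ?_)
    refine adj_le (M := K) (S := (T : Set Ω)) (le_sup_right.trans le_sup_left) (fun b hb => ?_) hxT
    rcases hT hb with hbe | hbk
    · exact (le_sup_right : _ ≤ _ ⊔ adj K _) (subset_adj _ _
        (Finset.mem_coe.2 (Finset.mem_filter.2 ⟨hb, hbe⟩)))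
    · refine (le_sup_left.trans le_sup_left : algClosure (constantSubfield p B K) ≤ _) ?_
      exact mem_algClosure.2 (isAlgebraic_mono hk (mem_algClosure.1 hbk))

end Construction

end RamTheory

open RamTheory in
theorem proposition0p2p1 {p : ℕ} [Fact p.Prime]
    {Ω : Type*} [NormedField Ω] [IsUltrametricDist Ω] [CharP Ω p]
    (K : Subfield Ω) [IsAlgClosure K Ω]
    (hcomplete : IsComplete (K : Set Ω)) (hdiscrete : (val K).IsRankOneDiscrete)
    (B : Subfield Ω) (hB : IsBaseSubfield p B K)
    (L : Subfield Ω) (hL : IsInfernal p B K L) :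
    ∃ l : Subfield Ω,
      IsFinitePurelyInsep (constantSubfield p B K) l ∧
      IsAlmostStandard p B (l ⊔ K) ∧
      IsFerocious (l ⊔ K) (l ⊔ L) := by
  have : IsAlgClosed Ω := IsAlgClosure.isAlgClosed K
  have halK : Algebra.IsAlgebraic K Ω := IsAlgClosure.isAlgebraic
  obtain ⟨t, ht⟩ := exists_isUniformizer_of_isRankOneDiscrete hdiscrete
  obtain ⟨E, k, π, ϖ, hb, h, hEK, hk, hroot⟩ :=
    exists_isConstantBase halK.isAlgebraic hcomplete ht hB
  have hKL : FiniteOver K L := (finiteOver_iff hL.1.1).2 hL.1.2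
  obtain ⟨n₁, h₁⟩ := h.exists_isFerocious hb hEK hKL
    (fun x hx hxA => IsInfernal.mem hb hEK.1 hk hL hx hxA) hroot
  obtain ⟨n₂, h₂⟩ := h.exists_isAlmostStandard hb hEK hk
  set n := max n₁ n₂
  have hcK : constantSubfield p B K ≤ K := inf_le_right
  have hϖ : ϖ n ^ p ^ n ∈ constantSubfield p B K := by
    rw [h.pow_eq]; exact hk hb.mem
  refine ⟨adj (constantSubfield p B K) {ϖ n}, ⟨le_adj _ _, ?_, ?_⟩, ?_, ?_⟩
  · refine (finiteOver_iff _).1 (finiteOver_adj (Set.finite_singleton _) fun x hx => ?_)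
    rw [Set.mem_singleton_iff.1 hx]
    exact mem_algClosure.1 (perfClosure_le_algClosure p ⟨n, hϖ⟩)
  · exact isPurelyInseparable_extendScalars p _ (adj_le (le_perfClosure p)
      (Set.singleton_subset_iff.2 ⟨n, hϖ⟩))
  · rw [adj_sup, sup_eq_right.2 hcK]
    exact h₂ n (le_max_right _ _)
  · rw [adj_sup, adj_sup, sup_eq_right.2 hcK, sup_eq_right.2 (hcK.trans hL.1.1)]
    exact h₁ n (le_max_left _ _)
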